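/- Let $(\mathbb X,\mathcal F,\mu)$ be a probability space. A connection function is a measurable symmetric function $\phi:\mathbb X\times\mathbb X\to[0,1]$; write $\overline\phi=\sup_{x,y}\phi(x,y)$, and for $\varepsilon>0$ let $\Phi_\varepsilon$ be the class of connection functions with $$\inf_{x}\int\phi(x,y)\,\mu(dy)\ \ge\ \varepsilon\,\sup_{x}\int\phi(x,y)\,\mu(dy).$$ Let $X_1,X_2,\dots$ be independent random elements of $\mathbb X$ with law $\mu$, let $\mathcal X_n=\{X_1,\dots,X_n\}$ (allowing multiplicities), and let $\mathcal P_s=\{X_1,\dots,X_{Z_s}\}$, where $Z_s$ is Poisson with mean $s>0$ and independent of $(X_i)$; thus $\mathcal P_s$ is a Poisson process on $\mathbb X$ with mean measure $s\mu$. For a finite collection $\mathcal V$ of points of $\mathbb X$, $G(\mathcal V,\phi)$ is the random graph with vertex set $\mathcal V$ in which, given $\mathcal V$, each pair $\{x,y\}$ is joined by an edge with probability $\phi(x,y)$, independently of all other pairs. Let $N_k(G)$ denote the number of connected components of $G$ with exactly $k$ vertices. Theorem. Let $k\in\{1,2,\dots\}$, $\alpha\in(0,\infty)$, and let $\phi_s$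 be a connection function for each $s>0$. Let $\mathcal Z_\alpha$ be a Poisson random variable with mean $\alpha$ and $\mathcal N$ a standard normal random variable; all limits are as $s\to\infty$ (through real values). (a) Suppose $\mathbb E N_k(G(\mathcal P_s,\phi_s))\to\alpha$. Then: (i) if $\overline\phi_s=o(1/\log s)$, then $N_k(G(\mathcal P_s,\phi_s))\to\mathcal Z_\alpha$ in distribution; (ii) if $\overline\phi_s=o(s^{-1/2})$, then $N_k(G(\mathcal X_{\lfloor s\rfloor},\phi_{\lfloor s\rfloor}))\to\mathcal Z_\alpha$ in distribution; (iii) if there exists $\varepsilon>0$ such that $\phi_s\in\Phi_\varepsilon$ and $\overline\phi_s\le 1-\varepsilon$ for all $s>0$, then $N_k(G(\mathcal P_s,\phi_s))\to\mathcal Z_\alpha$ and $N_k(G(\mathcal X_{\lfloor s\rfloor},\phi_{\lfloor s\rfloor}))\to\mathcal Z_\alpha$ in distribution. (b) Suppose instead that $\alpha_s:=\mathbb E N_k(G(\mathcal P_s,\phi_s))\to\infty$ but $\alpha_s=o(s)$, and that there exists $\varepsilon>0$ such that $\phi_s\in\Phi_\varepsilon$ and $\overline\phi_s\le 1-\varepsilon$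 for all $s>0$. Then $(N_k(G(\mathcal P_s,\phi_s))-\alpha_s)/\sqrt{\alpha_s}\to\mathcal N$ in distribution. -/

import Mathlib

open MeasureTheory ProbabilityTheory Filter Asymptotics Topology
open scoped NNReal

namespace IRG

/-- A connection function on a measurable space `X`: a (jointly) measurable symmetric function
`X × X → [0,1]`. -/
structure ConnectionFunction (X : Type*) [MeasurableSpace X] where
  toFun : X → X → ℝ
  measurable' : Measurable (Function.uncurry toFun)
  symm' : ∀ x y, toFun x y = toFun y x
  nonneg' : ∀ x y, 0 ≤ toFun x y
  le_one' : ∀ x y, toFun x y ≤ 1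

namespace ConnectionFunction

variable {X : Type*} [MeasurableSpace X]

instance : CoeFun (ConnectionFunction X) (fun _ => X → X → ℝ) := ⟨toFun⟩

/-- The supremum of `φ (x, y)` over all `x, y`. -/
noncomputable def supValue (φ : ConnectionFunction X) : ℝ :=
  ⨆ p : X × X, φ p.1 p.2

/-- `ε`-homogeneity with respect to `μ`: `inf_x ∫ φ(x,y) μ(dy) ≥ ε sup_x ∫ φ(x,y) μ(dy)`. -/
def Homogeneous (φ : ConnectionFunction X) (μ : Measure X) (ε : ℝ) : Prop :=
  ε * (⨆ x, ∫ y, φ x y ∂μ) ≤ ⨅ x, ∫ y, φ x y ∂μ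

end ConnectionFunction

/-- The number of connected components of `G` having exactly `k` vertices. -/
noncomputable def componentCount {V : Type*} (k : ℕ) (G : SimpleGraph V) : ℕ :=
  {c : G.ConnectedComponent | c.supp.ncard = k}.ncard

section Graphs

variable {X : Type*} [MeasurableSpace X]

/-- The graph on the first `n` points of the sequence `x`, where the `i`-th and the `j`-th points
(`i ≠ j`) are joined if and only if the mark `u s(i, j)` of the unordered pair `{i, j}` is at most
`φ (x i) (x j)`. The points are told apart by their indices, so multiplicities are allowed. -/
def markedGraph (φ : ConnectionFunction X) (n : ℕ) (x : ℕ → X) (u : Sym2 ℕ → unitInterval) :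
    SimpleGraph (Fin n) where
  Adj i j := i ≠ j ∧ (u s((i : ℕ), (j : ℕ)) : ℝ) ≤ φ (x i) (x j)
  symm := ⟨fun i j h => ⟨h.1.symm, by
    rw [Sym2.eq_swap, φ.symm' (x j) (x i)]
    exact h.2⟩⟩
  loopless := ⟨fun _ h => h.1 rfl⟩

/-- The joint law of a sequence of independent points with law `μ` and of an independent family of
independent uniform marks on `[0,1]`, one for each unordered pair of indices. -/
noncomputable def sampleMeasure (μ : Measure X) [IsProbabilityMeasure μ] :
    Measure ((ℕ → X) × (Sym2 ℕ → unitInterval)) :=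
  (Measure.infinitePi (fun _ : ℕ => μ)).prod
    (Measure.infinitePi (fun _ : Sym2 ℕ => (volume : Measure unitInterval)))

instance (μ : Measure X) [IsProbabilityMeasure μ] : IsProbabilityMeasure (sampleMeasure μ) := by
  unfold sampleMeasure
  infer_instance

/-- The joint law of a Poisson variable of mean `s` and, independently of it, the points and the
marks. The first `Z` points, with `Z` the Poisson variable, form a Poisson process with mean
measure `s μ`. -/
noncomputable def poissonSampleMeasure (μ : Measure X) [IsProbabilityMeasure μ] (s : ℝ) :
    Measure (ℕ × (ℕ → X) × (Sym2 ℕ → unitInterval)) :=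
  (poissonMeasure s.toNNReal).prod (sampleMeasure μ)

instance (μ : Measure X) [IsProbabilityMeasure μ] (s : ℝ) :
    IsProbabilityMeasure (poissonSampleMeasure μ s) := by
  unfold poissonSampleMeasure
  infer_instance

/-- The random graph on the binomial process of `n` points, on the probability space
`sampleMeasure μ`. -/
def binomialGraph (φ : ConnectionFunction X) (n : ℕ)
    (ω : (ℕ → X) × (Sym2 ℕ → unitInterval)) : SimpleGraph (Fin n) :=
  markedGraph φ n ω.1 ω.2

/-- The random graph on the Poisson process with mean measure `s μ`, on the probability space
`poissonSampleMeasure μ s`. -/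
def poissonGraph (φ : ConnectionFunction X)
    (ω : ℕ × (ℕ → X) × (Sym2 ℕ → unitInterval)) : SimpleGraph (Fin ω.1) :=
  markedGraph φ ω.1 ω.2.1 ω.2.2

/-- The expected number of components with `k` vertices of the random graph on the Poisson process
with mean measure `s μ`. -/
noncomputable def expectedCount (μ : Measure X) [IsProbabilityMeasure μ] (k : ℕ) (s : ℝ)
    (φ : ConnectionFunction X) : ℝ :=
  ∫ ω, (componentCount k (poissonGraph φ ω) : ℝ) ∂(poissonSampleMeasure μ s)

end Graphs

end IRG

/-!
The number `W` of components with `k` vertices of the graph on a Poisson process is a sum of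
indicators of *blocks*, the `k`-subsets of the points that are connected and not joined to any
other point. Once a block `S` is split off, the remaining points form a Poisson process thinned by
the condition that they are not joined to `S`. This gives a Stein identity: `E[W f(W)]` differs from
`α E[f(W + 1)]`, where `α = E W`, by at most the Lipschitz constant of `f` times an explicit double
integral `IRG.steinError`, which collects the pairs of blocks joined by an edge or having a common
neighbour (`IRG.abs_stein_le`).

No solution of a Stein equation is needed. For `f = cos (t ·)` and `f = sin (t ·)` the identity says
that the characteristic function `ψ` of `W` almost solves `ψ' = i α exp (it) ψ`, the differential
equation for the characteristic function of a Poisson law, and integration of this equation bounds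
the distance of `ψ` to `exp (α (exp (it) - 1))` by `2 t² exp (α t² / 2)` times the Stein error
(`IRG.norm_integral_cexp_sub_le`). By Lévy's continuity theorem the Poisson limit holds if the
Stein error vanishes, and, with `t` replaced by `t / √α`, the normal limit holds if it is of
smaller order than `α → ∞` (`IRG.tendstoInDistribution_poisson`,
`IRG.tendstoInDistribution_gaussian`).

If `sup φ = o(1 / log s)`, the Stein error is at most `α² o(1)` plus the contribution of blocks with
more than `(2 k + 1) log s` expected neighbours, which are isolated with negligible probability
(`IRG.steinError_le_of_le`). In the homogeneous case let `x` be `s` times the maximal connection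
probability of a point. A non-cut vertex can be removed from a connected graph, so `k` points are
connected with probability at most of order `(x / s) ^ (k - 1)` (`IRG.integral_connProb_mul_le`),
and a block is isolated with probability at most `exp (-ε x)`; hence the Stein error is at most
`α` times a constant multiple of `x ^ k (1 + x) exp (-c x)`. The components that are stars show that
`α / s` is at least of order `x ^ (k - 1) exp (-k x)`. So `α = o(s)` forces `x` towards zero or
infinity in just the way that makes the relative error vanish
(`IRG.tendsto_steinError_of_homogeneous`).

Finally, adding one point changes `W` with small probability. The characteristic functions for `m`
and `n` points are therefore close if `|m - n|` is of order `√n`, provided that `√n` times the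
maximal connection probability of a point vanishes, and by Chebyshev's inequality the Poisson number
of points may be replaced by its mean (`IRG.tendsto_integral_sampleCharFun_sub`).
-/

/-! ### Components of a graph as blocks of vertices -/

namespace IRG

section Blocks

open scoped Classical in
/-- The indicator that the graph induced by `G` on `S` is connected. -/
noncomputable def connInd (G : SimpleGraph ℕ) (S : Finset ℕ) : ℝ :=
  if (G.induce (S : Set ℕ)).Connected then 1 else 0

open scoped Classical in
/-- The indicator that `z` has no neighbour in `S`. -/
noncomputable def sepInd (G : SimpleGraph ℕ) (S : Finset ℕ) (z : ℕ) : ℝ :=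
  if ∀ i ∈ S, ¬ G.Adj i z then 1 else 0

open scoped Classical in
/-- The indicator that `v` and `w` are adjacent. -/
noncomputable def adjInd (G : SimpleGraph ℕ) (v w : ℕ) : ℝ :=
  if G.Adj v w then 1 else 0

/-- For `S ⊆ V`, the indicator that `S` is the vertex set of a connected component of the graph
induced by `G` on `V`. -/
noncomputable def blockInd (G : SimpleGraph ℕ) (V S : Finset ℕ) : ℝ :=
  connInd G S * ∏ z ∈ V \ S, sepInd G S z

/-- The number, as a real, of the connected components with `k` vertices of the graph induced by `G`
on the finite set `V`. -/
noncomputable def count (k : ℕ) (G : SimpleGraph ℕ) (V : Finset ℕ) : ℝ :=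
  ∑ S ∈ V.powersetCard k, blockInd G V S

variable {G : SimpleGraph ℕ} {V S T R : Finset ℕ} {k : ℕ}

lemma connInd_nonneg (G : SimpleGraph ℕ) (S : Finset ℕ) : 0 ≤ connInd G S := by
  unfold connInd; split_ifs <;> simp

lemma connInd_le_one (G : SimpleGraph ℕ) (S : Finset ℕ) : connInd G S ≤ 1 := by
  unfold connInd; split_ifs <;> simp

lemma sepInd_nonneg (G : SimpleGraph ℕ) (S : Finset ℕ) (z : ℕ) : 0 ≤ sepInd G S z := by
  unfold sepInd; split_ifs <;> simp

lemma sepInd_le_one (G : SimpleGraph ℕ) (S : Finset ℕ) (z : ℕ) : sepInd G S z ≤ 1 := by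
  unfold sepInd; split_ifs <;> simp

lemma adjInd_nonneg (G : SimpleGraph ℕ) (v w : ℕ) : 0 ≤ adjInd G v w := by
  unfold adjInd; split_ifs <;> simp

lemma adjInd_le_one (G : SimpleGraph ℕ) (v w : ℕ) : adjInd G v w ≤ 1 := by
  unfold adjInd; split_ifs <;> simp

lemma blockInd_nonneg (G : SimpleGraph ℕ) (V S : Finset ℕ) : 0 ≤ blockInd G V S :=
  mul_nonneg (connInd_nonneg _ _) (Finset.prod_nonneg fun _ _ => sepInd_nonneg _ _ _)

lemma prod_sepInd_le_one (G : SimpleGraph ℕ) (S V : Finset ℕ) : ∏ z ∈ V, sepInd G S z ≤ 1 :=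
  Finset.prod_le_one (fun _ _ => sepInd_nonneg _ _ _) fun _ _ => sepInd_le_one _ _ _

lemma prod_sepInd_anti (G : SimpleGraph ℕ) (S : Finset ℕ) {A B : Finset ℕ} (h : A ⊆ B) :
    ∏ z ∈ B, sepInd G S z ≤ ∏ z ∈ A, sepInd G S z := by
  rw [← Finset.prod_sdiff h]
  exact mul_le_of_le_one_left (Finset.prod_nonneg fun _ _ => sepInd_nonneg _ _ _)
    (prod_sepInd_le_one _ _ _)

lemma blockInd_le_one (G : SimpleGraph ℕ) (V S : Finset ℕ) : blockInd G V S ≤ 1 :=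
  mul_le_one₀ (connInd_le_one _ _) (Finset.prod_nonneg fun _ _ => sepInd_nonneg _ _ _)
    (prod_sepInd_le_one _ _ _)

lemma count_nonneg (k : ℕ) (G : SimpleGraph ℕ) (V : Finset ℕ) : 0 ≤ count k G V :=
  Finset.sum_nonneg fun _ _ => blockInd_nonneg _ _ _

lemma count_le_choose (k : ℕ) (G : SimpleGraph ℕ) (V : Finset ℕ) :
    count k G V ≤ V.card.choose k := by
  refine (Finset.sum_le_sum fun S _ => blockInd_le_one G V S).trans ?_
  simp [Finset.card_powersetCard]

lemma blockInd_eq_ite (G : SimpleGraph ℕ) (V S : Finset ℕ)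
    [Decidable ((G.induce (S : Set ℕ)).Connected ∧ ∀ z ∈ V \ S, ∀ i ∈ S, ¬ G.Adj i z)] :
    blockInd G V S =
      if (G.induce (S : Set ℕ)).Connected ∧ ∀ z ∈ V \ S, ∀ i ∈ S, ¬ G.Adj i z then 1 else 0 := by
  classical
  by_cases hc : (G.induce (S : Set ℕ)).Connected
  · by_cases hz : ∀ z ∈ V \ S, ∀ i ∈ S, ¬ G.Adj i z
    · rw [if_pos ⟨hc, hz⟩, blockInd, connInd, if_pos hc, one_mul]
      exact Finset.prod_eq_one fun z h => if_pos (hz z h)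
    · rw [if_neg fun h => hz h.2, blockInd]
      push Not at hz
      obtain ⟨z, hzV, i, hi, hadj⟩ := hz
      rw [Finset.prod_eq_zero hzV, mul_zero]
      exact if_neg fun h => h i hi hadj
  · rw [if_neg fun h => hc h.1, blockInd, connInd, if_neg hc, zero_mul]

/-- Transporting an induced subgraph along an injection of the vertices. -/
lemma connected_induce_comap_iff {A B : Type*} (g : A ↪ B) (G : SimpleGraph B) (S : Set A) :
    ((G.comap g).induce S).Connected ↔ (G.induce (g '' S)).Connected := by
  refine SimpleGraph.Iso.connected_iff ⟨Equiv.Set.image g S g.injective, ?_⟩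
  intro a b
  exact Iff.rfl

lemma connInd_comap (g : ℕ ↪ ℕ) (G : SimpleGraph ℕ) (S : Finset ℕ) :
    connInd (G.comap g) S = connInd G (S.map g) := by
  unfold connInd
  congr 1
  rw [eq_iff_iff, connected_induce_comap_iff, Finset.coe_map]

lemma sepInd_comap (g : ℕ ↪ ℕ) (G : SimpleGraph ℕ) (S : Finset ℕ) (z : ℕ) :
    sepInd (G.comap g) S z = sepInd G (S.map g) (g z) := by
  unfold sepInd
  congr 1
  simp only [Finset.mem_map, forall_exists_index, and_imp, forall_apply_eq_imp_iff₂,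
    SimpleGraph.comap_adj]

lemma blockInd_comap (g : ℕ ↪ ℕ) (G : SimpleGraph ℕ) (V S : Finset ℕ) :
    blockInd (G.comap g) V S = blockInd G (V.map g) (S.map g) := by
  unfold blockInd
  rw [connInd_comap, ← Finset.map_sdiff, Finset.prod_map]
  simp_rw [sepInd_comap]

lemma count_comap (k : ℕ) (g : ℕ ↪ ℕ) (G : SimpleGraph ℕ) (V : Finset ℕ) :
    count k (G.comap g) V = count k G (V.map g) := by
  unfold count
  rw [Finset.powersetCard_map, Finset.sum_map]
  exact Finset.sum_congr rfl fun S _ => blockInd_comap g G V S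

/-- A set of vertices that no edge leaves contains every vertex reachable from it. -/
lemma mem_of_reachable {A : Type*} {G : SimpleGraph A} {S : Set A}
    (h : ∀ a ∈ S, ∀ b, G.Adj a b → b ∈ S) {a b : A} (hab : G.Reachable a b) (ha : a ∈ S) :
    b ∈ S := by
  obtain ⟨w⟩ := hab
  induction w with
  | nil => exact ha
  | cons hadj _ ih => exact ih (h _ ha _ hadj)

/-- The blocks are the vertex sets of the connected components. -/
theorem componentCount_comap_eq_count (k n : ℕ) (G : SimpleGraph ℕ) :
    (componentCount k (G.comap (Fin.valEmbedding : Fin n ↪ ℕ)) : ℝ) =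
      count k G (Finset.range n) := by
  classical
  set H := G.comap (Fin.valEmbedding : Fin n ↪ ℕ) with hH
  set P : Finset ℕ → Prop := fun S =>
    (G.induce (S : Set ℕ)).Connected ∧ ∀ z ∈ Finset.range n \ S, ∀ i ∈ S, ¬ G.Adj i z with hP
  have hcount : count k G (Finset.range n) =
      (((Finset.range n).powersetCard k).filter P).card := by
    unfold count
    rw [Finset.card_filter]
    push_cast
    exact Finset.sum_congr rfl fun S _ => blockInd_eq_ite G _ S
  rw [hcount, componentCount]
  norm_cast
  rw [← Set.ncard_coe_finset]
  let F : H.ConnectedComponent → Finset ℕ := fun c => c.supp.toFinset.map Fin.valEmbedding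
  have hFcoe : ∀ c, ((F c : Finset ℕ) : Set ℕ) = Fin.valEmbedding '' c.supp := by
    intro c; simp [F]
  have hFinj : Function.Injective F := by
    intro c d h
    apply SimpleGraph.ConnectedComponent.supp_injective
    have := Finset.map_injective _ h
    simpa using congrArg (fun s : Finset (Fin n) => (s : Set (Fin n))) this
  rw [← Set.ncard_image_of_injective _ hFinj]
  congr 1
  ext S
  simp only [Set.mem_image, Set.mem_ofPred_eq, Finset.coe_filter, Finset.mem_powersetCard]
  constructor
  · rintro ⟨c, hc, rfl⟩
    refine ⟨⟨?_, ?_⟩, ?_, ?_⟩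
    · intro i hi
      simp only [F, Finset.mem_map] at hi
      obtain ⟨a, _, rfl⟩ := hi
      simp
    · rw [← hc, Set.ncard_eq_toFinset_card']
      simp [F]
    · rw [hFcoe, ← connected_induce_comap_iff]
      exact c.connected_toSimpleGraph
    · intro z hz i hi hadj
      simp only [Finset.mem_sdiff, Finset.mem_range] at hz
      simp only [F, Finset.mem_map, Set.mem_toFinset] at hi
      obtain ⟨a, ha, rfl⟩ := hi
      apply hz.2
      simp only [F, Finset.mem_map, Set.mem_toFinset]
      refine ⟨⟨z, hz.1⟩, ?_, rfl⟩
      exact SimpleGraph.ConnectedComponent.mem_supp_of_adj_mem_supp c ha (by simpa [hH] using hadj)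
  · rintro ⟨⟨hSV, hcard⟩, hconn, hsep⟩
    obtain ⟨i, hi⟩ := hconn.nonempty
    have hin : i < n := by simpa using hSV hi
    set c := H.connectedComponentMk ⟨i, hin⟩ with hcdef
    have hsupp : c.supp = {a : Fin n | (a : ℕ) ∈ S} := by
      ext a
      rw [SimpleGraph.ConnectedComponent.mem_supp_iff, hcdef, SimpleGraph.ConnectedComponent.eq]
      constructor
      · intro hr
        refine mem_of_reachable (S := {a : Fin n | (a : ℕ) ∈ S}) ?_ hr.symm hi
        intro a ha b hab
        by_contra hb
        exact hsep b (by simpa using hb) a ha (by simpa [hH] using hab)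
      · intro ha
        have h1 := hconn.preconnected ⟨a, ha⟩ ⟨i, hi⟩
        let f : G.induce (S : Set ℕ) →g H :=
          ⟨fun j => ⟨j.1, by simpa using hSV j.2⟩, fun {a b} hab => by simpa [hH] using hab⟩
        exact h1.map f
    have hFS : F c = S := by
      apply Finset.coe_injective
      rw [hFcoe, hsupp]
      ext j
      simp only [Set.mem_image, Set.mem_ofPred_eq, Fin.valEmbedding_apply, Finset.mem_coe]
      constructor
      · rintro ⟨a, ha, rfl⟩; exact ha
      · intro hj; exact ⟨⟨j, by simpa using hSV hj⟩, hj, rfl⟩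
    refine ⟨c, ?_, hFS⟩
    rw [← hcard, ← hFS, Set.ncard_eq_toFinset_card']
    simp [F]

/-- Two blocks of the same size either coincide or are disjoint; so, next to a block `S`, the other
blocks are the blocks of the complement. -/
lemma blockInd_mul_count (hS : S ∈ V.powersetCard k) (f : ℝ → ℝ) :
    blockInd G V S * f (count k G V) =
      connInd G S * ((∏ z ∈ V \ S, sepInd G S z) * f (1 + count k G (V \ S))) := by
  classical
  rw [← mul_assoc]
  change _ = blockInd G V S * _
  rw [Finset.mem_powersetCard] at hS
  by_cases hb : (G.induce (S : Set ℕ)).Connected ∧ ∀ z ∈ V \ S, ∀ i ∈ S, ¬ G.Adj i z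
  swap
  · rw [blockInd_eq_ite, if_neg hb, zero_mul, zero_mul]
  congr 2
  have key : ∀ T ∈ V.powersetCard k, blockInd G V T =
      (if T = S then 1 else 0) + if T ⊆ V \ S then blockInd G (V \ S) T else 0 := by
    intro T hT
    rw [Finset.mem_powersetCard] at hT
    by_cases hTS : T = S
    · subst hTS
      have hne : ¬ T ⊆ V \ T := by
        intro h
        obtain ⟨i, hi⟩ := hb.1.nonempty
        exact (Finset.mem_sdiff.1 (h hi)).2 hi
      rw [if_pos rfl, if_neg hne, blockInd_eq_ite, if_pos hb, add_zero]
    rw [if_neg hTS, zero_add]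
    by_cases hsub : T ⊆ V \ S
    · rw [if_pos hsub, blockInd_eq_ite, blockInd_eq_ite]
      congr 1
      simp only [eq_iff_iff, and_congr_right_iff]
      intro _
      constructor
      · intro h z hz
        simp only [Finset.mem_sdiff] at hz
        exact h z (by simp [hz])
      · intro h z hz i hi
        by_cases hzS : z ∈ S
        · intro hadj
          exact hb.2 i (hsub hi) z hzS hadj.symm
        · simp only [Finset.mem_sdiff] at hz
          exact h z (by simp [hz, hzS]) i hi
    · rw [if_neg hsub, blockInd_eq_ite, if_neg]
      rintro ⟨hTc, -⟩
      apply hTS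
      have hex : ∃ i ∈ T, i ∈ S := by
        by_contra hcon
        push Not at hcon
        exact hsub fun i hi => Finset.mem_sdiff.2 ⟨hT.1 hi, hcon i hi⟩
      obtain ⟨i, hiT, hiS⟩ := hex
      have hsubT : T ⊆ S := by
        intro j hj
        have hr := hTc.preconnected ⟨i, hiT⟩ ⟨j, hj⟩
        refine mem_of_reachable (S := {a : (T : Set ℕ) | (a : ℕ) ∈ S}) ?_ hr hiS
        intro a ha b hab
        by_contra hbS
        exact hb.2 b (Finset.mem_sdiff.2 ⟨hT.1 b.2, hbS⟩) a ha (by simpa using hab)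
      exact Finset.eq_of_subset_of_card_le hsubT (by rw [hS.2, hT.2])
  have hSV : S ∈ V.powersetCard k := Finset.mem_powersetCard.2 hS
  unfold count
  rw [Finset.sum_congr rfl key, Finset.sum_add_distrib, Finset.sum_ite_eq' , if_pos hSV,
    ← Finset.sum_filter]
  congr 1
  refine Finset.sum_congr ?_ fun _ _ => rfl
  ext T
  simp only [Finset.mem_filter, Finset.mem_powersetCard]
  constructor
  · rintro ⟨⟨_, h⟩, h'⟩; exact ⟨h', h⟩
  · rintro ⟨h, h'⟩; exact ⟨⟨h.trans Finset.sdiff_subset, h'⟩, h⟩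

lemma count_mul_eq_sum (k : ℕ) (G : SimpleGraph ℕ) (V : Finset ℕ) (f : ℝ → ℝ) :
    count k G V * f (count k G V) = ∑ S ∈ V.powersetCard k,
      connInd G S * ((∏ z ∈ V \ S, sepInd G S z) * f (1 + count k G (V \ S))) := by
  rw [← Finset.sum_congr rfl fun S hS => blockInd_mul_count (G := G) hS f, ← Finset.sum_mul, count]

/-- Expansion over the random subsets `R` of `V` that keep each `i` with probability `q i`,
restricted to those that contain `S`. -/
lemma sum_powerset_weight_mul (hS : S ⊆ V) (q e : ℕ → ℝ) :
    ∑ R ∈ V.powerset, ((∏ i ∈ R, q i) * ∏ i ∈ V \ R, (1 - q i)) *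
        (if S ⊆ R then ∏ i ∈ R \ S, e i else 0) =
      (∏ i ∈ S, q i) * ∏ i ∈ V \ S, (1 - q i * (1 - e i)) := by
  have h1 : (∏ i ∈ S, q i) * ∏ i ∈ V \ S, (1 - q i * (1 - e i)) =
      ∏ i ∈ V, ((if i ∈ S then q i else q i * e i) + (if i ∈ S then 0 else 1 - q i)) := by
    rw [← Finset.prod_sdiff hS, mul_comm]
    congr 1
    · refine Finset.prod_congr rfl fun i hi => ?_
      rw [Finset.mem_sdiff] at hi
      rw [if_neg hi.2, if_neg hi.2]; ring
    · refine Finset.prod_congr rfl fun i hi => ?_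
      rw [if_pos hi, if_pos hi, add_zero]
  rw [h1, Finset.prod_add]
  refine Finset.sum_congr rfl fun R hR => ?_
  rw [Finset.mem_powerset] at hR
  by_cases hSR : S ⊆ R
  · rw [if_pos hSR]
    have h2 : ∏ i ∈ V \ R, (if i ∈ S then (0 : ℝ) else 1 - q i) = ∏ i ∈ V \ R, (1 - q i) := by
      refine Finset.prod_congr rfl fun i hi => if_neg fun hiS => ?_
      exact (Finset.mem_sdiff.1 hi).2 (hSR hiS)
    have h3 : ∏ i ∈ R, (if i ∈ S then q i else q i * e i) =
        (∏ i ∈ R, q i) * ∏ i ∈ R \ S, e i := by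
      rw [← Finset.prod_sdiff hSR, ← Finset.prod_sdiff hSR (f := q)]
      rw [Finset.prod_congr rfl (fun i (hi : i ∈ R \ S) => if_neg (Finset.mem_sdiff.1 hi).2),
        Finset.prod_congr rfl (fun i (hi : i ∈ S) => if_pos hi), Finset.prod_mul_distrib]
      ring
    rw [h2, h3]; ring
  · rw [if_neg hSR]
    obtain ⟨i, hiS, hiR⟩ := Finset.not_subset.1 hSR
    have h0 : ∏ i ∈ V \ R, (if i ∈ S then (0 : ℝ) else 1 - q i) = 0 :=
      Finset.prod_eq_zero (Finset.mem_sdiff.2 ⟨hS hiS, hiR⟩) (if_pos hiS)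
    rw [h0, mul_zero, mul_zero]

lemma sum_powerset_weight (V : Finset ℕ) (q : ℕ → ℝ) :
    ∑ R ∈ V.powerset, ((∏ i ∈ R, q i) * ∏ i ∈ V \ R, (1 - q i)) = 1 := by
  have := sum_powerset_weight_mul (S := ∅) (V := V) (by simp) q (fun _ => 1)
  simpa using this

lemma count_eq_sum_superset (k : ℕ) (G : SimpleGraph ℕ) (hR : R ⊆ V) :
    count k G R = ∑ S ∈ V.powersetCard k, connInd G S *
      (if S ⊆ R then ∏ z ∈ R \ S, sepInd G S z else 0) := by
  unfold count blockInd
  simp_rw [mul_ite, mul_zero]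
  rw [← Finset.sum_filter]
  refine Finset.sum_congr ?_ fun _ _ => rfl
  ext T
  simp only [Finset.mem_filter, Finset.mem_powersetCard]
  constructor
  · rintro ⟨h, h'⟩; exact ⟨⟨h.trans hR, h'⟩, h⟩
  · rintro ⟨⟨_, h⟩, h'⟩; exact ⟨h', h⟩

/-- The mean effect on the number of blocks of deleting each vertex `i` with probability `1 - q i`:
a block is lost if one of its vertices is deleted, and one is gained only if all the outer
neighbours of a connected set are deleted. -/
theorem sum_weight_abs_count_sub_le (k : ℕ) (G : SimpleGraph ℕ) (V : Finset ℕ) (q : ℕ → ℝ)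
    (h0 : ∀ i, 0 ≤ q i) (h1 : ∀ i, q i ≤ 1) :
    ∑ R ∈ V.powerset, ((∏ i ∈ R, q i) * ∏ i ∈ V \ R, (1 - q i)) *
        |count k G V - count k G R| ≤
      ∑ S ∈ V.powersetCard k, connInd G S *
        ((1 - ∏ i ∈ S, q i) * ∏ z ∈ V \ S, sepInd G S z +
          (∏ i ∈ S, q i) * (∏ z ∈ V \ S, (1 - q z * (1 - sepInd G S z)) -
            ∏ z ∈ V \ S, sepInd G S z)) := by
  have hw : ∀ R, 0 ≤ (∏ i ∈ R, q i) * ∏ i ∈ V \ R, (1 - q i) := fun R =>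
    mul_nonneg (Finset.prod_nonneg fun i _ => h0 i)
      (Finset.prod_nonneg fun i _ => sub_nonneg.2 (h1 i))
  have hstep : ∀ R ∈ V.powerset, |count k G V - count k G R| ≤
      ∑ S ∈ V.powersetCard k, connInd G S * (∏ z ∈ V \ S, sepInd G S z +
        (if S ⊆ R then ∏ z ∈ R \ S, sepInd G S z else 0) -
        2 * (∏ z ∈ V \ S, sepInd G S z) * (if S ⊆ R then ∏ z ∈ R \ S, 1 else 0)) := by
    intro R hR
    rw [Finset.mem_powerset] at hR
    rw [count_eq_sum_superset k G hR, count, ← Finset.sum_sub_distrib]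
    refine (Finset.abs_sum_le_sum_abs _ _).trans (Finset.sum_le_sum fun S _ => ?_)
    rw [blockInd, ← mul_sub, abs_mul, abs_of_nonneg (connInd_nonneg _ _)]
    refine mul_le_mul_of_nonneg_left ?_ (connInd_nonneg _ _)
    have ha : 0 ≤ ∏ z ∈ V \ S, sepInd G S z := Finset.prod_nonneg fun _ _ => sepInd_nonneg _ _ _
    split_ifs with hSR
    · have hle : ∏ z ∈ V \ S, sepInd G S z ≤ ∏ z ∈ R \ S, sepInd G S z :=
        prod_sepInd_anti _ _ (Finset.sdiff_subset_sdiff hR le_rfl)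
      rw [abs_of_nonpos (by linarith)]
      simp only [Finset.prod_const_one]; linarith
    · rw [sub_zero, abs_of_nonneg ha]; simp
  refine (Finset.sum_le_sum fun R hR => mul_le_mul_of_nonneg_left (hstep R hR) (hw R)).trans
    (le_of_eq ?_)
  simp_rw [Finset.mul_sum]
  rw [Finset.sum_comm]
  refine Finset.sum_congr rfl fun S hS => ?_
  have hSV : S ⊆ V := (Finset.mem_powersetCard.1 hS).1
  have e1 := sum_powerset_weight_mul hSV q (sepInd G S)
  have e2 := sum_powerset_weight_mul hSV q (fun _ => 1)
  have e3 := sum_powerset_weight V q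
  simp only [sub_self, mul_zero, sub_zero, Finset.prod_const_one, mul_one] at e2
  set a := ∏ z ∈ V \ S, sepInd G S z
  calc _ = connInd G S * (a * ∑ R ∈ V.powerset, ((∏ i ∈ R, q i) * ∏ i ∈ V \ R, (1 - q i)) +
        ∑ R ∈ V.powerset, ((∏ i ∈ R, q i) * ∏ i ∈ V \ R, (1 - q i)) *
          (if S ⊆ R then ∏ z ∈ R \ S, sepInd G S z else 0) -
        2 * a * ∑ R ∈ V.powerset, ((∏ i ∈ R, q i) * ∏ i ∈ V \ R, (1 - q i)) *
          (if S ⊆ R then 1 else 0)) := by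
        simp only [Finset.mul_sum, ← Finset.sum_add_distrib, ← Finset.sum_sub_distrib]
        refine Finset.sum_congr rfl fun R _ => ?_
        simp only [Finset.prod_const_one]; ring
    _ = _ := by rw [e1, e2, e3]; ring

/-- Adding a vertex creates at most the blocks that contain it and destroys the blocks adjacent to
it. -/
lemma abs_count_insert_sub_le (k : ℕ) (G : SimpleGraph ℕ) {m : ℕ} (hm : m ∉ V) :
    |count k G (insert m V) - count k G V| ≤
      (∑ S ∈ (insert m V).powersetCard k with m ∈ S, blockInd G (insert m V) S) +
        ∑ S ∈ V.powersetCard k, (blockInd G V S - blockInd G (insert m V) S) := by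
  have hsplit : count k G (insert m V) =
      (∑ S ∈ (insert m V).powersetCard k with m ∈ S, blockInd G (insert m V) S) +
        ∑ S ∈ V.powersetCard k, blockInd G (insert m V) S := by
    rw [count, ← Finset.sum_filter_add_sum_filter_not _ (fun S => m ∈ S)]
    congr 1
    refine Finset.sum_congr ?_ fun _ _ => rfl
    ext T
    simp only [Finset.mem_filter, Finset.mem_powersetCard]
    constructor
    · rintro ⟨⟨h, h'⟩, hT⟩
      exact ⟨(Finset.subset_insert_iff_of_notMem hT).1 h, h'⟩
    · rintro ⟨h, h'⟩
      exact ⟨⟨h.trans (Finset.subset_insert _ _), h'⟩, fun hT => hm (h hT)⟩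
  have hle : ∀ S ∈ V.powersetCard k, 0 ≤ blockInd G V S - blockInd G (insert m V) S := by
    intro S _
    rw [sub_nonneg]
    refine mul_le_mul_of_nonneg_left ?_ (connInd_nonneg _ _)
    exact prod_sepInd_anti _ _ (Finset.sdiff_subset_sdiff (Finset.subset_insert _ _) le_rfl)
  have h2 := Finset.sum_nonneg hle
  have h1 : 0 ≤ ∑ S ∈ (insert m V).powersetCard k with m ∈ S, blockInd G (insert m V) S :=
    Finset.sum_nonneg fun _ _ => blockInd_nonneg _ _ _
  rw [hsplit, count]
  rw [Finset.sum_sub_distrib] at h2 ⊢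
  rw [abs_le]
  constructor <;> linarith

/-- A connected graph with at least two vertices stays connected after the removal of a suitable
vertex, which has a neighbour among the others. -/
lemma connInd_le_sum_erase (G : SimpleGraph ℕ) (hS : 2 ≤ S.card) :
    connInd G S ≤ ∑ v ∈ S, ∑ w ∈ S.erase v, connInd G (S.erase v) * adjInd G v w := by
  classical
  have hnn : ∀ v w, 0 ≤ connInd G (S.erase v) * adjInd G v w := fun v w =>
    mul_nonneg (connInd_nonneg _ _) (adjInd_nonneg _ _ _)
  by_cases hc : (G.induce (S : Set ℕ)).Connected
  swap
  · rw [connInd, if_neg hc]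
    exact Finset.sum_nonneg fun v _ => Finset.sum_nonneg fun w _ => hnn v w
  have hnt : Nontrivial (S : Set ℕ) := by
    obtain ⟨a, ha, b, hb, hab⟩ := Finset.one_lt_card.1 (show 1 < S.card by omega)
    exact ⟨⟨a, ha⟩, ⟨b, hb⟩, by simpa using hab⟩
  obtain ⟨v, hv⟩ := hc.exists_connected_induce_compl_singleton_of_finite_nontrivial
  obtain ⟨w, hw⟩ := hc.preconnected.exists_adj_of_nontrivial v
  have hadj : G.Adj v w := by simpa using hw
  have hwS : (w : ℕ) ∈ S.erase v := Finset.mem_erase.2 ⟨hadj.ne', w.2⟩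
  have hce : (G.induce ((S.erase v : Finset ℕ) : Set ℕ)).Connected := by
    have h := (connected_induce_comap_iff (Function.Embedding.subtype (· ∈ (S : Set ℕ))) G
      ({v}ᶜ)).1 hv
    have himg : ((S.erase v : Finset ℕ) : Set ℕ) =
        Function.Embedding.subtype (· ∈ (S : Set ℕ)) '' {v}ᶜ := by
      ext j
      constructor
      · intro hj
        rw [Finset.mem_coe, Finset.mem_erase] at hj
        exact ⟨⟨j, hj.2⟩, fun h => hj.1 (congrArg Subtype.val h), rfl⟩
      · rintro ⟨a, ha, rfl⟩
        rw [Finset.mem_coe, Finset.mem_erase]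
        exact ⟨fun h => ha (Subtype.ext h), a.2⟩
    rw [himg]
    exact h
  rw [connInd, if_pos hc]
  calc (1 : ℝ) = connInd G (S.erase v) * adjInd G v w := by
        rw [connInd, if_pos hce, adjInd, if_pos hadj, one_mul]
    _ ≤ ∑ w ∈ S.erase v, connInd G (S.erase v) * adjInd G v w :=
        Finset.single_le_sum (f := fun w => connInd G (S.erase v) * adjInd G v w)
          (fun w _ => hnn v w) hwS
    _ ≤ _ := Finset.single_le_sum
        (f := fun v => ∑ w ∈ S.erase v, connInd G (S.erase v) * adjInd G v w)
          (fun v _ => Finset.sum_nonneg fun w _ => hnn v w) v.2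

/-- A graph containing a star is connected. -/
lemma prod_adjInd_le_connInd (G : SimpleGraph ℕ) (hk : 1 ≤ k) :
    ∏ j ∈ Finset.Ico 1 k, adjInd G 0 j ≤ connInd G (Finset.range k) := by
  classical
  by_cases h : ∀ j ∈ Finset.Ico 1 k, G.Adj 0 j
  · have h0 : (0 : ℕ) ∈ ((Finset.range k : Finset ℕ) : Set ℕ) := by
      simpa using Nat.lt_of_lt_of_le Nat.zero_lt_one hk
    have hc : (G.induce ((Finset.range k : Finset ℕ) : Set ℕ)).Connected := by
      have hr : ∀ a, (G.induce ((Finset.range k : Finset ℕ) : Set ℕ)).Reachable ⟨0, h0⟩ a := by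
        rintro ⟨j, hj⟩
        by_cases hj0 : j = 0
        · subst hj0; rfl
        · refine SimpleGraph.Adj.reachable ?_
          have : G.Adj 0 j := h j (by simp at hj ⊢; omega)
          simpa using this
      exact { preconnected := fun a b => (hr a).symm.trans (hr b), nonempty := ⟨⟨0, h0⟩⟩ }
    rw [connInd, if_pos hc]
    exact Finset.prod_le_one (fun _ _ => adjInd_nonneg _ _ _) fun _ _ => adjInd_le_one _ _ _
  · push Not at h
    obtain ⟨j, hj, hadj⟩ := h
    rw [Finset.prod_eq_zero hj (if_neg hadj)]
    exact connInd_nonneg _ _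

end Blocks

end IRG

/-! ### Infinite product measures: reindexing, resampling and independence -/

namespace IRG

section InfiniteProduct

variable {E : Type*} [MeasurableSpace E] (ν : Measure E) [IsProbabilityMeasure ν] {ι : Type*}

lemma measurePreserving_reindex {α : Type*} {g : α → ι} (hg : Function.Injective g) :
    MeasurePreserving (fun (ω : ι → E) i => ω (g i)) (Measure.infinitePi fun _ : ι => ν)
      (Measure.infinitePi fun _ : α => ν) :=
  ⟨by fun_prop, Measure.map_infinitePi_infinitePi_of_inj (P := fun _ : ι => ν) hg⟩

open scoped Classical in
/-- The coordinates in `A` of the first sequence, the other ones of the second sequence. -/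
noncomputable def merge {E ι : Type*} (A : Set ι) (p : (ι → E) × (ι → E)) : ι → E :=
  fun i => if i ∈ A then p.1 i else p.2 i

lemma merge_of_mem {E ι : Type*} {A : Set ι} {p : (ι → E) × (ι → E)} {i : ι} (h : i ∈ A) :
    merge A p i = p.1 i := if_pos h

lemma merge_of_notMem {E ι : Type*} {A : Set ι} {p : (ι → E) × (ι → E)} {i : ι} (h : i ∉ A) :
    merge A p i = p.2 i := if_neg h

lemma measurable_merge (A : Set ι) : Measurable (merge A : (ι → E) × (ι → E) → ι → E) := by
  refine measurable_pi_lambda _ fun i => ?_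
  unfold merge
  split_ifs <;> fun_prop

lemma measurePreserving_merge (A : Set ι) :
    MeasurePreserving (merge A) ((Measure.infinitePi fun _ : ι => ν).prod
      (Measure.infinitePi fun _ : ι => ν)) (Measure.infinitePi fun _ : ι => ν) := by
  classical
  refine ⟨measurable_merge A, Measure.eq_infinitePi _ fun s t ht => ?_⟩
  rw [Measure.map_apply (measurable_merge A)
    (MeasurableSet.pi s.countable_toSet fun i _ => ht i)]
  have hpre : merge A ⁻¹' ((s : Set ι).pi t) =
      ((s.filter (· ∈ A) : Finset ι) : Set ι).pi t ×ˢ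
        ((s.filter (· ∉ A) : Finset ι) : Set ι).pi t := by
    ext p
    simp only [Set.mem_preimage, Set.mem_pi, Set.mem_prod, Finset.mem_coe, Finset.mem_filter]
    constructor
    · intro h
      exact ⟨fun i hi => merge_of_mem (p := p) hi.2 ▸ h i hi.1,
        fun i hi => merge_of_notMem (p := p) hi.2 ▸ h i hi.1⟩
    · rintro ⟨h1, h2⟩ i hi
      by_cases hA : i ∈ A
      · rw [merge_of_mem hA]; exact h1 i ⟨hi, hA⟩
      · rw [merge_of_notMem hA]; exact h2 i ⟨hi, hA⟩
  rw [hpre, Measure.prod_prod, Measure.infinitePi_pi _ fun i _ => ht i,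
    Measure.infinitePi_pi _ fun i _ => ht i, Finset.prod_filter_mul_prod_filter_not]

variable {ν}

lemma integral_comp_of_measurePreserving {Ω Ω' : Type*} [MeasurableSpace Ω] [MeasurableSpace Ω']
    {P : Measure Ω} {Q : Measure Ω'} {T : Ω → Ω'} (hT : MeasurePreserving T P Q) {F : Ω' → ℝ}
    (hF : Measurable F) : ∫ ω, F (T ω) ∂P = ∫ ω, F ω ∂Q := by
  rw [← hT.map_eq, integral_map hT.measurable.aemeasurable hF.aestronglyMeasurable]

/-- Functions of disjoint sets of coordinates are independent. -/
lemma integral_mul_of_dependsOn {F H : (ι → E) → ℝ} (hF : Measurable F) (hH : Measurable H)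
    {A B : Set ι} (hFA : DependsOn F A) (hHB : DependsOn H B) (hAB : Disjoint A B) :
    ∫ ω, F ω * H ω ∂(Measure.infinitePi fun _ : ι => ν) =
      (∫ ω, F ω ∂(Measure.infinitePi fun _ : ι => ν)) *
        ∫ ω, H ω ∂(Measure.infinitePi fun _ : ι => ν) := by
  rw [← integral_comp_of_measurePreserving (F := fun ω => F ω * H ω)
    (measurePreserving_merge ν A) (hF.mul hH), ← integral_prod_mul]
  refine integral_congr_ae (Eventually.of_forall fun p => ?_)
  change F _ * H _ = _
  rw [hFA fun i hi => merge_of_mem hi,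
    hHB fun i hi => merge_of_notMem fun h => Set.disjoint_left.1 hAB h hi]

lemma dependsOn_prod {E ι κ : Type*} {F : κ → (ι → E) → ℝ} {A : κ → Set ι} {B : Set ι} {s : Finset κ}
    (h : ∀ i ∈ s, DependsOn (F i) (A i)) (hB : ∀ i ∈ s, A i ⊆ B) :
    DependsOn (fun ω => ∏ i ∈ s, F i ω) B := fun _ _ hxy =>
  Finset.prod_congr rfl fun i hi => h i hi fun j hj => hxy j (hB i hi hj)

/-- Functions of pairwise disjoint sets of coordinates are independent. -/
lemma integral_prod_of_dependsOn {κ : Type*} [DecidableEq κ] {F : κ → (ι → E) → ℝ}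
    (hF : ∀ i, Measurable (F i)) {A : κ → Set ι} (s : Finset κ)
    (hFA : ∀ i ∈ s, DependsOn (F i) (A i))
    (hA : ∀ i ∈ s, ∀ j ∈ s, i ≠ j → Disjoint (A i) (A j)) :
    ∫ ω, ∏ i ∈ s, F i ω ∂(Measure.infinitePi fun _ : ι => ν) =
      ∏ i ∈ s, ∫ ω, F i ω ∂(Measure.infinitePi fun _ : ι => ν) := by
  induction s using Finset.induction_on with
  | empty => simp
  | insert a s has ih =>
    simp only [Finset.prod_insert has]
    rw [integral_mul_of_dependsOn (hF a) (Finset.measurable_prod _ fun i _ => hF i)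
      (hFA a (Finset.mem_insert_self a s))
      (dependsOn_prod (A := A) (B := ⋃ i ∈ s, A i)
        (fun i hi => hFA i (Finset.mem_insert_of_mem hi))
        fun i hi => Set.subset_biUnion_of_mem (u := A) hi)
      (by
        rw [Set.disjoint_iUnion₂_right]
        exact fun i hi => hA a (Finset.mem_insert_self a s) i (Finset.mem_insert_of_mem hi)
          fun h => has (h ▸ hi)),
      ih (fun i hi => hFA i (Finset.mem_insert_of_mem hi))
        fun i hi j hj => hA i (Finset.mem_insert_of_mem hi) j (Finset.mem_insert_of_mem hj)]

lemma integral_eval {β : E → ℝ} (hβ : Measurable β) (i : ι) :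
    ∫ x, β (x i) ∂(Measure.infinitePi fun _ : ι => ν) = ∫ z, β z ∂ν :=
  integral_comp_of_measurePreserving (measurePreserving_eval_infinitePi (fun _ : ι => ν) i) hβ

lemma integral_prod_eval {β : E → ℝ} (hβ : Measurable β) (s : Finset ι) :
    ∫ x, ∏ i ∈ s, β (x i) ∂(Measure.infinitePi fun _ : ι => ν) = (∫ z, β z ∂ν) ^ s.card := by
  classical
  rw [integral_prod_of_dependsOn (F := fun i (x : ι → E) => β (x i)) (A := fun i => {i})
    (fun i => hβ.comp (measurable_pi_apply i)) s
    (fun i _ x y h => congrArg β (h i rfl)) fun i _ j _ h => by simpa using h]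
  simp [integral_eval hβ]

/-- Resampling the coordinate `v`. -/
lemma measurePreserving_update [DecidableEq ι] (v : ι) :
    MeasurePreserving (fun p : E × (ι → E) => Function.update p.2 v p.1)
      (ν.prod (Measure.infinitePi fun _ : ι => ν)) (Measure.infinitePi fun _ : ι => ν) := by
  have hm : Measurable (fun p : E × (ι → E) => Function.update p.2 v p.1) := by
    refine measurable_pi_lambda _ fun i => ?_
    by_cases h : i = v
    · subst h; simpa using measurable_fst
    · simp only [Function.update_of_ne h]
      fun_prop
  have h2 : MeasurePreserving (Prod.map (fun y : ι → E => y v) id)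
      ((Measure.infinitePi fun _ : ι => ν).prod (Measure.infinitePi fun _ : ι => ν))
      (ν.prod (Measure.infinitePi fun _ : ι => ν)) :=
    (measurePreserving_eval_infinitePi (fun _ : ι => ν) v).prod (MeasurePreserving.id _)
  refine ⟨hm, ?_⟩
  rw [← h2.map_eq, Measure.map_map hm h2.measurable]
  convert (measurePreserving_merge ν ({v} : Set ι)).map_eq using 2
  ext p i
  by_cases h : i = v
  · subst h; rw [merge_of_mem (by simp)]; simp
  · rw [merge_of_notMem (by simpa using h)]; simp [h]

lemma integrable_of_abs_le {Ω : Type*} [MeasurableSpace Ω] {P : Measure Ω} [IsFiniteMeasure P]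
    {F : Ω → ℝ} (hF : Measurable F) (C : ℝ) (hC : ∀ ω, |F ω| ≤ C) : Integrable F P :=
  Integrable.of_bound hF.aestronglyMeasurable C (Eventually.of_forall hC)

end InfiniteProduct

/-- Two disjoint finite sets of integers can be moved to two consecutive intervals. -/
lemma exists_embedding_map_range {S V : Finset ℕ} (h : Disjoint S V) :
    ∃ g : ℕ ↪ ℕ, (Finset.range S.card).map g = S ∧
      (Finset.Ico S.card (S.card + V.card)).map g = V := by
  classical
  let y : Fin (S.card + V.card) ↪ ℕ :=
    ⟨Fin.append (S.orderEmbOfFin rfl) (V.orderEmbOfFin rfl), by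
      rw [Fin.append_injective_iff]
      refine ⟨(S.orderEmbOfFin rfl).injective, (V.orderEmbOfFin rfl).injective, ?_⟩
      intro i j hij
      exact Finset.disjoint_left.1 h (S.orderEmbOfFin_mem rfl i)
        (by rw [hij]; exact V.orderEmbOfFin_mem rfl j)⟩
  obtain ⟨σ, hσ⟩ := (Equiv.Perm.isMultiplyPretransitive ℕ (S.card + V.card)).exists_smul_eq
    Fin.valEmbedding y
  have hσ' : ∀ i : Fin (S.card + V.card), σ i = y i := fun i => by
    rw [← hσ]; rfl
  refine ⟨σ.toEmbedding, ?_, ?_⟩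
  · refine Finset.eq_of_subset_of_card_le ?_ (by simp)
    intro j hj
    rw [Finset.mem_map] at hj
    obtain ⟨i, hi, rfl⟩ := hj
    rw [Finset.mem_range] at hi
    have := hσ' (Fin.castAdd V.card ⟨i, hi⟩)
    simp only [Fin.val_castAdd] at this
    change σ i ∈ S
    rw [this]
    change Fin.append _ _ _ ∈ S
    rw [Fin.append_left]
    exact S.orderEmbOfFin_mem rfl _
  · refine Finset.eq_of_subset_of_card_le ?_ (by simp)
    intro j hj
    rw [Finset.mem_map] at hj
    obtain ⟨i, hi, rfl⟩ := hj
    rw [Finset.mem_Ico] at hi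
    have := hσ' (Fin.natAdd S.card ⟨i - S.card, by omega⟩)
    simp only [Fin.val_natAdd] at this
    rw [Nat.add_sub_cancel' hi.1] at this
    change σ i ∈ V
    rw [this]
    change Fin.append _ _ _ ∈ V
    rw [Fin.append_right]
    exact V.orderEmbOfFin_mem rfl _

end IRG

/-! ### The infinite random graph and its factorization over blocks -/

namespace IRG

/-- The law of the marks. -/
noncomputable abbrev markMeasure : Measure (Sym2 ℕ → unitInterval) :=
  Measure.infinitePi fun _ : Sym2 ℕ => (volume : Measure unitInterval)

section RandomGraph

variable {X : Type*} [MeasurableSpace X]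

/-- The law of the points. -/
noncomputable abbrev pointMeasure (μ : Measure X) [IsProbabilityMeasure μ] : Measure (ℕ → X) :=
  Measure.infinitePi fun _ : ℕ => μ

/-- The random graph on all the points of the sequence `x`; `markedGraph φ n x u` is the graph that
it induces on the first `n` points. -/
def pointGraph (φ : ConnectionFunction X) (x : ℕ → X) (u : Sym2 ℕ → unitInterval) :
    SimpleGraph ℕ where
  Adj i j := i ≠ j ∧ (u s(i, j) : ℝ) ≤ φ (x i) (x j)
  symm := ⟨fun i j h => ⟨h.1.symm, by
    rw [Sym2.eq_swap, φ.symm' (x j) (x i)]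
    exact h.2⟩⟩
  loopless := ⟨fun _ h => h.1 rfl⟩

lemma markedGraph_eq_comap (φ : ConnectionFunction X) (n : ℕ) (x : ℕ → X)
    (u : Sym2 ℕ → unitInterval) :
    markedGraph φ n x u = (pointGraph φ x u).comap (Fin.valEmbedding : Fin n ↪ ℕ) := by
  ext i j
  simp [markedGraph, pointGraph, Fin.val_inj]

lemma componentCount_markedGraph (φ : ConnectionFunction X) (k n : ℕ) (x : ℕ → X)
    (u : Sym2 ℕ → unitInterval) :
    (componentCount k (markedGraph φ n x u) : ℝ) =
      count k (pointGraph φ x u) (Finset.range n) := by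
  rw [markedGraph_eq_comap, componentCount_comap_eq_count]

lemma pointGraph_reindex (φ : ConnectionFunction X) (g : ℕ ↪ ℕ) (x : ℕ → X)
    (u : Sym2 ℕ → unitInterval) :
    pointGraph φ (fun i => x (g i)) (fun e => u (Sym2.map g e)) = (pointGraph φ x u).comap g := by
  ext i j
  simp [pointGraph]

/-- A function of graphs on `ℕ` that depends only on the graph induced on `V`. -/
def IsLocal (F : SimpleGraph ℕ → ℝ) (V : Finset ℕ) : Prop :=
  ∀ G H : SimpleGraph ℕ, (∀ i ∈ V, ∀ j ∈ V, (G.Adj i j ↔ H.Adj i j)) → F G = F H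

lemma IsLocal.mono {F : SimpleGraph ℕ → ℝ} {V W : Finset ℕ} (h : IsLocal F V) (hVW : V ⊆ W) :
    IsLocal F W := fun G H hGH => h G H fun i hi j hj => hGH i (hVW hi) j (hVW hj)

lemma isLocal_connInd (S : Finset ℕ) : IsLocal (fun G => connInd G S) S := by
  intro G H h
  have : G.induce (S : Set ℕ) = H.induce (S : Set ℕ) := by
    ext a b
    exact h a a.2 b b.2
  change connInd G S = connInd H S
  rw [connInd, connInd]
  congr 1
  rw [this]

lemma isLocal_sepInd (S : Finset ℕ) (z : ℕ) : IsLocal (fun G => sepInd G S z) (insert z S) := by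
  intro G H h
  have : (∀ i ∈ S, ¬ G.Adj i z) ↔ ∀ i ∈ S, ¬ H.Adj i z :=
    forall₂_congr fun i hi => not_congr
      (h i (Finset.mem_insert_of_mem hi) z (Finset.mem_insert_self z S))
  change sepInd G S z = sepInd H S z
  rw [sepInd, sepInd]
  congr 1
  exact propext this

lemma isLocal_adjInd (v w : ℕ) : IsLocal (fun G => adjInd G v w) {v, w} := by
  intro G H h
  have : G.Adj v w ↔ H.Adj v w := h v (by simp) w (by simp)
  change adjInd G v w = adjInd H v w
  rw [adjInd, adjInd]
  congr 1
  exact propext this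

lemma isLocal_count (k : ℕ) (V : Finset ℕ) : IsLocal (fun G => count k G V) V := by
  intro G H h
  refine Finset.sum_congr rfl fun S hS => ?_
  have hSV := (Finset.mem_powersetCard.1 hS).1
  refine congrArg₂ (· * ·) (((isLocal_connInd S).mono hSV) G H h)
    (Finset.prod_congr rfl fun z hz => ?_)
  exact ((isLocal_sepInd S z).mono
    (Finset.insert_subset (Finset.sdiff_subset hz) hSV)) G H h

variable (φ : ConnectionFunction X)

lemma measurable_adj (i j : ℕ) :
    Measurable fun ω : (ℕ → X) × (Sym2 ℕ → unitInterval) => (pointGraph φ ω.1 ω.2).Adj i j := by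
  refine measurableSet_setOfPred.1 ?_
  have h1 : Measurable fun ω : (ℕ → X) × (Sym2 ℕ → unitInterval) => φ (ω.1 i) (ω.1 j) :=
    φ.measurable'.comp (f := fun ω : (ℕ → X) × (Sym2 ℕ → unitInterval) => (ω.1 i, ω.1 j))
      (by fun_prop)
  have h2 : Measurable fun ω : (ℕ → X) × (Sym2 ℕ → unitInterval) => (ω.2 s(i, j) : ℝ) := by
    fun_prop
  exact (MeasurableSet.const _).inter (measurableSet_le h2 h1)

lemma IsLocal.measurable {F : SimpleGraph ℕ → ℝ} {V : Finset ℕ} (hF : IsLocal F V) :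
    Measurable fun ω : (ℕ → X) × (Sym2 ℕ → unitInterval) => F (pointGraph φ ω.1 ω.2) := by
  let Φ : (V → V → Prop) → ℝ := fun b =>
    F (SimpleGraph.fromRel fun i j => ∃ (hi : i ∈ V) (hj : j ∈ V), b ⟨i, hi⟩ ⟨j, hj⟩)
  have hΦ : Measurable Φ := Measurable.of_discrete
  have ha : Measurable fun (ω : (ℕ → X) × (Sym2 ℕ → unitInterval)) (i j : V) =>
      (pointGraph φ ω.1 ω.2).Adj i j :=
    measurable_pi_lambda _ fun i => measurable_pi_lambda _ fun j => measurable_adj φ i j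
  convert hΦ.comp ha using 1
  ext ω
  refine hF _ _ fun i hi j hj => ?_
  simp only [SimpleGraph.fromRel_adj]
  constructor
  · intro h; exact ⟨h.ne, Or.inl ⟨hi, hj, h⟩⟩
  · rintro ⟨-, ⟨-, -, h⟩ | ⟨-, -, h⟩⟩
    · exact h
    · exact h.symm

lemma IsLocal.measurable_right {F : SimpleGraph ℕ → ℝ} {V : Finset ℕ} (hF : IsLocal F V)
    (x : ℕ → X) : Measurable fun u => F (pointGraph φ x u) :=
  (hF.measurable φ).comp (f := fun u => (x, u)) (by fun_prop)

lemma IsLocal.dependsOn {F : SimpleGraph ℕ → ℝ} {V : Finset ℕ} (hF : IsLocal F V) (x : ℕ → X) :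
    DependsOn (fun u => F (pointGraph φ x u)) {e : Sym2 ℕ | ∀ i ∈ e, i ∈ V} := by
  intro u v h
  refine hF _ _ fun i hi j hj => ?_
  have : u s(i, j) = v s(i, j) := h _ (by
    intro a ha
    rcases Sym2.mem_iff.1 ha with rfl | rfl <;> assumption)
  simp only [pointGraph, this]

lemma IsLocal.dependsOn_points {F : SimpleGraph ℕ → ℝ} {V : Finset ℕ} (hF : IsLocal F V)
    (u : Sym2 ℕ → unitInterval) :
    DependsOn (fun x => F (pointGraph φ x u)) (V : Set ℕ) := by
  intro x y h
  refine hF _ _ fun i hi j hj => ?_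
  simp only [pointGraph, h i hi, h j hj]

lemma dependsOn_sepInd (S : Finset ℕ) (z : ℕ) (x : ℕ → X) :
    DependsOn (fun u => sepInd (pointGraph φ x u) S z) ((fun i => s(i, z)) '' (S : Set ℕ)) := by
  intro u v h
  have : (∀ i ∈ S, ¬ (pointGraph φ x u).Adj i z) ↔ ∀ i ∈ S, ¬ (pointGraph φ x v).Adj i z := by
    refine forall₂_congr fun i hi => ?_
    simp only [pointGraph, h s(i, z) ⟨i, hi, rfl⟩]
  change sepInd _ S z = sepInd _ S z
  rw [sepInd, sepInd]
  congr 1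
  exact propext this

lemma dependsOn_adjInd (v w : ℕ) (x : ℕ → X) :
    DependsOn (fun u => adjInd (pointGraph φ x u) v w) {s(v, w)} := by
  intro u u' h
  have : (pointGraph φ x u).Adj v w ↔ (pointGraph φ x u').Adj v w := by
    simp only [pointGraph, h s(v, w) rfl]
  change adjInd _ v w = adjInd _ v w
  rw [adjInd, adjInd]
  congr 1
  exact propext this

lemma integral_adjInd {v w : ℕ} (hvw : v ≠ w) (x : ℕ → X) :
    ∫ u, adjInd (pointGraph φ x u) v w ∂markMeasure = φ (x v) (x w) := by
  have h : (fun u : Sym2 ℕ → unitInterval => adjInd (pointGraph φ x u) v w) =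
      fun u => (Set.Iic (⟨φ (x v) (x w), φ.nonneg' _ _, φ.le_one' _ _⟩ : unitInterval)).indicator
        (fun _ => (1 : ℝ)) (u s(v, w)) := by
    ext u
    simp only [adjInd, pointGraph, Set.indicator, Set.mem_Iic, ← Subtype.coe_le_coe, hvw, ne_eq,
      not_false_eq_true, true_and]
  rw [h, integral_eval (ν := (volume : Measure unitInterval))
    (measurable_const.indicator measurableSet_Iic), integral_indicator measurableSet_Iic]
  simp [measureReal_def, unitInterval.volume_Iic, φ.nonneg']

/-- The probability that a point at `z` is joined to none of the points `y i`, `i ∈ S`. -/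
noncomputable def avoid (S : Finset ℕ) (y : ℕ → X) (z : X) : ℝ := ∏ i ∈ S, (1 - φ (y i) z)

/-- The probability that the points `y i`, `i ∈ S`, form a connected graph. -/
noncomputable def connProb (S : Finset ℕ) (y : ℕ → X) : ℝ :=
  ∫ u, connInd (pointGraph φ y u) S ∂markMeasure

/-- The mean over the marks of a function of the number of blocks of `V`. -/
noncomputable def meanCount (k : ℕ) (V : Finset ℕ) (h : ℝ → ℝ) (x : ℕ → X) : ℝ :=
  ∫ u, h (count k (pointGraph φ x u) V) ∂markMeasure

lemma avoid_nonneg (S : Finset ℕ) (y : ℕ → X) (z : X) : 0 ≤ avoid φ S y z :=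
  Finset.prod_nonneg fun _ _ => sub_nonneg.2 (φ.le_one' _ _)

lemma avoid_le_one (S : Finset ℕ) (y : ℕ → X) (z : X) : avoid φ S y z ≤ 1 :=
  Finset.prod_le_one (fun _ _ => sub_nonneg.2 (φ.le_one' _ _))
    fun _ _ => sub_le_self _ (φ.nonneg' _ _)

lemma ConnectionFunction.measurable_comp {Ω : Type*} [MeasurableSpace Ω] {f g : Ω → X}
    (hf : Measurable f) (hg : Measurable g) : Measurable fun ω => φ (f ω) (g ω) :=
  φ.measurable'.comp (hf.prodMk hg)

lemma measurable_avoid (S : Finset ℕ) : Measurable fun p : (ℕ → X) × X => avoid φ S p.1 p.2 :=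
  Finset.measurable_prod _ fun i _ => measurable_const.sub
    (φ.measurable_comp ((measurable_pi_apply i).comp measurable_fst) measurable_snd)

lemma measurable_avoid_comp {Ω : Type*} [MeasurableSpace Ω] (S : Finset ℕ) {f : Ω → ℕ → X}
    {g : Ω → X} (hf : Measurable f) (hg : Measurable g) :
    Measurable fun ω => avoid φ S (f ω) (g ω) :=
  (measurable_avoid φ S).comp (hf.prodMk hg)

lemma measurable_connProb (S : Finset ℕ) : Measurable (connProb φ S) :=
  (((isLocal_connInd S).measurable φ).stronglyMeasurable.integral_prod_right'
    (ν := markMeasure)).measurable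

lemma IsLocal.comp {F : SimpleGraph ℕ → ℝ} {V : Finset ℕ} (hF : IsLocal F V) (h : ℝ → ℝ) :
    IsLocal (fun G => h (F G)) V := fun G H hGH => congrArg h (hF G H hGH)

lemma measurable_meanCount (k : ℕ) (V : Finset ℕ) (h : ℝ → ℝ) : Measurable (meanCount φ k V h) :=
  ((((isLocal_count k V).comp h).measurable φ).stronglyMeasurable.integral_prod_right'
    (ν := markMeasure)).measurable

lemma connProb_nonneg (S : Finset ℕ) (y : ℕ → X) : 0 ≤ connProb φ S y :=
  integral_nonneg fun _ => connInd_nonneg _ _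

lemma abs_integral_le_of_abs_le {Ω : Type*} [MeasurableSpace Ω] {P : Measure Ω}
    [IsProbabilityMeasure P] {F : Ω → ℝ} {C : ℝ} (h : ∀ ω, |F ω| ≤ C) : |∫ ω, F ω ∂P| ≤ C := by
  simpa using norm_integral_le_of_norm_le_const (μ := P) (f := F) (Eventually.of_forall h)

lemma connProb_le_one (S : Finset ℕ) (y : ℕ → X) : connProb φ S y ≤ 1 :=
  (le_abs_self _).trans (abs_integral_le_of_abs_le fun _ => by
    rw [abs_of_nonneg (connInd_nonneg _ _)]; exact connInd_le_one _ _)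

lemma abs_meanCount_le (k : ℕ) (V : Finset ℕ) {h : ℝ → ℝ} {C : ℝ} (hC : ∀ w, |h w| ≤ C)
    (x : ℕ → X) : |meanCount φ k V h x| ≤ C :=
  abs_integral_le_of_abs_le fun _ => hC _

lemma dependsOn_connProb (S : Finset ℕ) : DependsOn (connProb φ S) (S : Set ℕ) := fun _ _ h =>
  integral_congr_ae (Eventually.of_forall fun u => (isLocal_connInd S).dependsOn_points φ u h)

lemma dependsOn_meanCount (k : ℕ) (V : Finset ℕ) (h : ℝ → ℝ) :
    DependsOn (meanCount φ k V h) (V : Set ℕ) := fun _ _ hxy =>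
  integral_congr_ae (Eventually.of_forall fun u =>
    ((isLocal_count k V).comp h).dependsOn_points φ u hxy)

lemma sym2_map_injective (g : ℕ ↪ ℕ) : Function.Injective (Sym2.map g) :=
  Sym2.map.injective g.injective

lemma meanCount_reindex (k : ℕ) (V : Finset ℕ) (h : ℝ → ℝ) (hh : Measurable h) (g : ℕ ↪ ℕ)
    (x : ℕ → X) :
    meanCount φ k (V.map g) h x = meanCount φ k V h (fun i => x (g i)) := by
  unfold meanCount
  rw [← integral_comp_of_measurePreserving
    (F := fun u => h (count k (pointGraph φ (fun i => x (g i)) u) V))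
    (measurePreserving_reindex (volume : Measure unitInterval) (sym2_map_injective g))
    (hh.comp ((isLocal_count k V).measurable_right φ (fun i => x (g i))))]
  simp_rw [pointGraph_reindex, count_comap]

lemma sepInd_eq_prod (G : SimpleGraph ℕ) (S : Finset ℕ) (z : ℕ) :
    sepInd G S z = ∏ i ∈ S, (1 - adjInd G i z) := by
  classical
  unfold sepInd adjInd
  split_ifs with h
  · exact (Finset.prod_eq_one fun i hi => by rw [if_neg (h i hi), sub_zero]).symm
  · push Not at h
    obtain ⟨i, hi, hadj⟩ := h
    rw [Finset.prod_eq_zero hi (by rw [if_pos hadj, sub_self])]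

lemma sym2_mk_right_inj {i j z : ℕ} (h : s(i, z) = s(j, z)) : i = j := by
  rw [Sym2.eq_iff] at h
  omega

lemma integral_sepInd {S : Finset ℕ} {z : ℕ} (hz : z ∉ S) (x : ℕ → X) :
    ∫ u, sepInd (pointGraph φ x u) S z ∂markMeasure = avoid φ S x (x z) := by
  simp_rw [sepInd_eq_prod]
  rw [integral_prod_of_dependsOn (F := fun i u => 1 - adjInd (pointGraph φ x u) i z)
    (A := fun i => {s(i, z)})
    (fun i => measurable_const.sub ((isLocal_adjInd i z).measurable_right φ x)) S
    (fun i _ u v h => congrArg (1 - ·) (dependsOn_adjInd φ i z x h))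
    (fun i _ j _ hij => by
      rw [Set.disjoint_singleton]; exact fun h => hij (sym2_mk_right_inj h))]
  refine Finset.prod_congr rfl fun i hi => ?_
  have hiz : i ≠ z := fun h => hz (h ▸ hi)
  rw [integral_sub (integrable_const _) (integrable_of_abs_le
    ((isLocal_adjInd i z).measurable_right φ x) 1 fun u => by
      rw [abs_of_nonneg (adjInd_nonneg _ _ _)]; exact adjInd_le_one _ _ _), integral_adjInd φ hiz]
  simp

/-- Given the points, the edges between a block and the outside are independent of the rest. -/
lemma integral_prod_sepInd_mul {S V : Finset ℕ} (hSV : Disjoint S V) (x : ℕ → X) (b₀ b₁ : ℕ → ℝ)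
    {H : (Sym2 ℕ → unitInterval) → ℝ} (hH : Measurable H) {D : Set (Sym2 ℕ)} (hD : DependsOn H D)
    (hDS : ∀ i ∈ S, ∀ z ∈ V, s(i, z) ∉ D) :
    ∫ u, (∏ z ∈ V, (b₀ z + b₁ z * sepInd (pointGraph φ x u) S z)) * H u ∂markMeasure =
      (∏ z ∈ V, (b₀ z + b₁ z * avoid φ S x (x z))) * ∫ u, H u ∂markMeasure := by
  have hmeas : ∀ z, Measurable fun u => b₀ z + b₁ z * sepInd (pointGraph φ x u) S z := fun z =>
    measurable_const.add (measurable_const.mul ((isLocal_sepInd S z).measurable_right φ x))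
  have hdep : ∀ z, DependsOn (fun u => b₀ z + b₁ z * sepInd (pointGraph φ x u) S z)
      ((fun i => s(i, z)) '' (S : Set ℕ)) := fun z u v h =>
    congrArg (fun t => b₀ z + b₁ z * t) (dependsOn_sepInd φ S z x h)
  rw [integral_mul_of_dependsOn (Finset.measurable_prod _ fun z _ => hmeas z) hH
    (dependsOn_prod (B := ⋃ z ∈ V, (fun i => s(i, z)) '' (S : Set ℕ)) (fun z _ => hdep z)
      fun z hz => Set.subset_biUnion_of_mem (u := fun z => (fun i => s(i, z)) '' (S : Set ℕ)) hz)
    hD ?_]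
  · congr 1
    rw [integral_prod_of_dependsOn hmeas V (fun z _ => hdep z)]
    · refine Finset.prod_congr rfl fun z hz => ?_
      rw [integral_add (integrable_const _), integral_const_mul,
        integral_sepInd φ (Finset.disjoint_right.1 hSV hz)]
      · simp
      · refine Integrable.const_mul (integrable_of_abs_le
          ((isLocal_sepInd S z).measurable_right φ x) 1 fun u => ?_) _
        rw [abs_of_nonneg (sepInd_nonneg _ _ _)]; exact sepInd_le_one _ _ _
    · intro z hz w hw hzw
      rw [Set.disjoint_left]
      rintro _ ⟨i, hi, rfl⟩ ⟨j, hj, h⟩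
      have h : s(j, w) = s(i, z) := h
      rw [Sym2.eq_iff] at h
      rcases h with ⟨_, h⟩ | ⟨h, _⟩
      · exact hzw h.symm
      · exact Finset.disjoint_left.1 hSV hj (h ▸ hz)
  · rw [Set.disjoint_iUnion₂_left]
    intro z hz
    rw [Set.disjoint_left]
    rintro _ ⟨i, hi, rfl⟩ h
    exact hDS i hi z hz h

/-- Integration over the marks, for fixed points: the graph on `S`, the graph on `V` and the edges
between them are independent. -/
lemma integral_marks {S V : Finset ℕ} (hSV : Disjoint S V) (k : ℕ) (x : ℕ → X) (b₀ b₁ : ℕ → ℝ)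
    (h : ℝ → ℝ) :
    ∫ u, (∏ z ∈ V, (b₀ z + b₁ z * sepInd (pointGraph φ x u) S z)) *
        (connInd (pointGraph φ x u) S * h (count k (pointGraph φ x u) V)) ∂markMeasure =
      (∏ z ∈ V, (b₀ z + b₁ z * avoid φ S x (x z))) *
        (connProb φ S x * meanCount φ k V h x) := by
  have hm1 := (isLocal_connInd S).measurable_right φ x
  have hm2 := ((isLocal_count k V).comp h).measurable_right φ x
  have hd1 := (isLocal_connInd S).dependsOn φ x
  have hd2 := ((isLocal_count k V).comp h).dependsOn φ x
  rw [integral_prod_sepInd_mul φ hSV x b₀ b₁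
    (H := fun u => connInd (pointGraph φ x u) S * h (count k (pointGraph φ x u) V)) (hm1.mul hm2)
    (D := {e : Sym2 ℕ | ∀ i ∈ e, i ∈ S} ∪ {e : Sym2 ℕ | ∀ i ∈ e, i ∈ V})]
  · congr 1
    refine integral_mul_of_dependsOn hm1 hm2 hd1 hd2 ?_
    rw [Set.disjoint_left]
    intro e
    induction e with
    | h a b =>
      intro h1 h2
      exact Finset.disjoint_left.1 hSV (h1 a (by simp)) (h2 a (by simp))
  · intro u v huv
    have e1 := hd1 fun e he => huv e (Or.inl he)
    have e2 := hd2 fun e he => huv e (Or.inr he)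
    exact congrArg₂ (· * ·) e1 e2
  · rintro i hi z hz (h | h)
    · exact Finset.disjoint_left.1 hSV (h z (by simp)) hz
    · exact Finset.disjoint_left.1 hSV hi (h i (by simp))

variable (μ : Measure X) [IsProbabilityMeasure μ]

/-- The mean of `h` of the number of components with `k` vertices among the first `n` points,
weighted by the product of `β` over these points. -/
noncomputable def weightedMean (k : ℕ) (β : X → ℝ) (h : ℝ → ℝ) (n : ℕ) : ℝ :=
  ∫ x, (∏ i ∈ Finset.range n, β (x i)) * meanCount φ k (Finset.range n) h x ∂pointMeasure μ

lemma measurePreserving_sample_reindex (g : ℕ ↪ ℕ) :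
    MeasurePreserving (fun ω : (ℕ → X) × (Sym2 ℕ → unitInterval) =>
      ((fun i => ω.1 (g i) : ℕ → X), (fun e => ω.2 (Sym2.map g e) : Sym2 ℕ → unitInterval)))
      (sampleMeasure μ) (sampleMeasure μ) :=
  (measurePreserving_reindex μ g.injective).prod
    (measurePreserving_reindex (volume : Measure unitInterval) (sym2_map_injective g))

lemma weightedMean_eq_map (k : ℕ) {β : X → ℝ} (hβ : Measurable β) {h : ℝ → ℝ} (hh : Measurable h)
    (n : ℕ) (g : ℕ ↪ ℕ) :
    ∫ x, (∏ i ∈ (Finset.range n).map g, β (x i)) *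
        meanCount φ k ((Finset.range n).map g) h x ∂pointMeasure μ =
      weightedMean φ μ k β h n := by
  unfold weightedMean
  rw [← integral_comp_of_measurePreserving
    (F := fun x => (∏ i ∈ Finset.range n, β (x i)) * meanCount φ k (Finset.range n) h x)
    (measurePreserving_reindex μ g.injective)
    ((Finset.measurable_prod _ fun i _ => hβ.comp (measurable_pi_apply i)).mul
      (measurable_meanCount φ k _ h))]
  refine integral_congr_ae (Eventually.of_forall fun x => ?_)
  simp only [Finset.prod_map]
  rw [meanCount_reindex φ k _ h hh]

/-- For fixed positions `y` of the points of a block, integration over the other points. -/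
lemma integral_points_eq (k k₀ n : ℕ) {β : X → ℝ} (hβ : Measurable β) {h : ℝ → ℝ}
    (hh : Measurable h) :
    ∫ x, (∏ i ∈ Finset.Ico k₀ (k₀ + n), β (x i)) *
        meanCount φ k (Finset.Ico k₀ (k₀ + n)) h x ∂pointMeasure μ =
      weightedMean φ μ k β h n := by
  have : Finset.Ico k₀ (k₀ + n) = (Finset.range n).map (addLeftEmbedding k₀) := by
    rw [Finset.range_eq_Ico, Finset.map_add_left_Ico, add_zero]
  rw [this, weightedMean_eq_map φ μ k hβ hh n]

lemma prod_abs_le_one {ι : Type*} {s : Finset ι} {f : ι → ℝ} (h : ∀ i ∈ s, |f i| ≤ 1) :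
    |∏ i ∈ s, f i| ≤ 1 := by
  rw [Finset.abs_prod]
  exact Finset.prod_le_one (fun _ _ => abs_nonneg _) h

lemma abs_mul_le_of_le_one {a b C : ℝ} (ha : |a| ≤ 1) (hb : |b| ≤ C) : |a * b| ≤ C := by
  rw [abs_mul]
  exact (mul_le_of_le_one_left (abs_nonneg b) ha).trans hb

/-- The factorization formula: the mean of a product of a function of a prospective block `S`, of
its edges to the points of `V`, and of the number of components on `V`. -/
theorem integral_block_eq {S V : Finset ℕ} (hSV : Disjoint S V) (k : ℕ) {a b₀ b₁ : X → ℝ}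
    (ha : Measurable a) (hb₀ : Measurable b₀) (hb₁ : Measurable b₁) {h : ℝ → ℝ}
    (hh : Measurable h) (ha1 : ∀ z, |a z| ≤ 1) (hb : ∀ z, |b₀ z| + |b₁ z| ≤ 1) {C : ℝ}
    (hC : ∀ w, |h w| ≤ C) :
    ∫ ω, (∏ i ∈ S, a (ω.1 i)) *
        ((∏ z ∈ V, (b₀ (ω.1 z) + b₁ (ω.1 z) * sepInd (pointGraph φ ω.1 ω.2) S z)) *
        (connInd (pointGraph φ ω.1 ω.2) S *
          h (count k (pointGraph φ ω.1 ω.2) V))) ∂sampleMeasure μ =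
      ∫ y, (∏ i ∈ Finset.range S.card, a (y i)) * (connProb φ (Finset.range S.card) y *
        weightedMean φ μ k (fun z => b₀ z + b₁ z * avoid φ (Finset.range S.card) y z) h V.card)
        ∂pointMeasure μ := by
  have hC0 : 0 ≤ C := (abs_nonneg _).trans (hC 0)
  have hbt : ∀ z t, 0 ≤ t → t ≤ 1 → |b₀ z + b₁ z * t| ≤ 1 := fun z t h0 h1 =>
    calc |b₀ z + b₁ z * t| ≤ |b₀ z| + |b₁ z * t| := abs_add_le _ _
      _ ≤ |b₀ z| + |b₁ z| := by
          rw [abs_mul, abs_of_nonneg h0]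
          have := mul_le_of_le_one_right (abs_nonneg (b₁ z)) h1
          linarith
      _ ≤ 1 := hb z
  -- the integrand, as a function of the two sets of indices
  let F : Finset ℕ → Finset ℕ → (ℕ → X) × (Sym2 ℕ → unitInterval) → ℝ := fun S V ω =>
    (∏ i ∈ S, a (ω.1 i)) *
        ((∏ z ∈ V, (b₀ (ω.1 z) + b₁ (ω.1 z) * sepInd (pointGraph φ ω.1 ω.2) S z)) *
        (connInd (pointGraph φ ω.1 ω.2) S * h (count k (pointGraph φ ω.1 ω.2) V)))
  have hFm : ∀ S V, Measurable (F S V) := fun S V => by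
    refine Measurable.mul ?_ (Measurable.mul ?_ (Measurable.mul ?_ ?_))
    · exact Finset.measurable_prod _ fun i _ => ha.comp (by fun_prop)
    · exact Finset.measurable_prod _ fun i _ => (hb₀.comp (by fun_prop)).add
        ((hb₁.comp (by fun_prop)).mul ((isLocal_sepInd S i).measurable φ))
    · exact (isLocal_connInd S).measurable φ
    · exact ((isLocal_count k V).comp h).measurable φ
  obtain ⟨g, hgS, hgV⟩ := exists_embedding_map_range hSV
  set S₀ := Finset.range S.card with hS₀
  set V₀ := Finset.Ico S.card (S.card + V.card) with hV₀
  have hSV₀ : Disjoint S₀ V₀ := by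
    rw [Finset.disjoint_left]
    intro i hi hi'
    simp only [hS₀, hV₀, Finset.mem_range, Finset.mem_Ico] at hi hi'
    omega
  have step1 : ∫ ω, F S V ω ∂sampleMeasure μ = ∫ ω, F S₀ V₀ ω ∂sampleMeasure μ := by
    rw [← integral_comp_of_measurePreserving (measurePreserving_sample_reindex μ g)
      (hFm S₀ V₀)]
    refine integral_congr_ae (Eventually.of_forall fun ω => ?_)
    simp only [F, pointGraph_reindex, sepInd_comap, connInd_comap, count_comap, hgS, hgV]
    rw [← Finset.prod_map S₀ g (fun i => a (ω.1 i)), ← Finset.prod_map V₀ g (fun z =>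
      b₀ (ω.1 z) + b₁ (ω.1 z) * sepInd (pointGraph φ ω.1 ω.2) S z), hgS, hgV]
  change ∫ ω, F S V ω ∂sampleMeasure μ = _
  have hFle : ∀ ω, |F S₀ V₀ ω| ≤ C := fun ω => by
    refine abs_mul_le_of_le_one (prod_abs_le_one fun i _ => ha1 _) (abs_mul_le_of_le_one
      (prod_abs_le_one fun i _ => hbt _ _ (sepInd_nonneg _ _ _) (sepInd_le_one _ _ _))
      (abs_mul_le_of_le_one ?_ (hC _)))
    rw [abs_of_nonneg (connInd_nonneg _ _)]
    exact connInd_le_one _ _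
  rw [step1, sampleMeasure, integral_prod _ (integrable_of_abs_le (hFm S₀ V₀) C hFle)]
  -- integration over the marks
  let K : (ℕ → X) × (ℕ → X) → ℝ := fun p =>
    (∏ i ∈ S₀, a (p.1 i)) * (connProb φ S₀ p.1 *
      ((∏ z ∈ V₀, (b₀ (p.2 z) + b₁ (p.2 z) * avoid φ S₀ p.1 (p.2 z))) * meanCount φ k V₀ h p.2))
  have hKm : Measurable K := by
    refine Measurable.mul ?_ (Measurable.mul ?_ (Measurable.mul ?_ ?_))
    · exact Finset.measurable_prod _ fun i _ => ha.comp (by fun_prop)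
    · exact (measurable_connProb φ S₀).comp measurable_fst
    · exact Finset.measurable_prod _ fun i _ => (hb₀.comp (by fun_prop)).add
        ((hb₁.comp (by fun_prop)).mul (measurable_avoid_comp φ S₀ (by fun_prop) (by fun_prop)))
    · exact (measurable_meanCount φ k V₀ h).comp measurable_snd
  have hKle : ∀ p, |K p| ≤ C := fun p => by
    refine abs_mul_le_of_le_one (prod_abs_le_one fun i _ => ha1 _) (abs_mul_le_of_le_one ?_
      (abs_mul_le_of_le_one (prod_abs_le_one fun i _ =>
        hbt _ _ (avoid_nonneg _ _ _ _) (avoid_le_one _ _ _ _)) (abs_meanCount_le φ k V₀ hC _)))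
    rw [abs_of_nonneg (connProb_nonneg _ _ _)]
    exact connProb_le_one _ _ _
  have step2 : ∀ x, ∫ u, F S₀ V₀ (x, u) ∂markMeasure = K (x, x) := fun x => by
    simp only [F, K]
    rw [integral_const_mul, integral_marks φ hSV₀ k x (fun z => b₀ (x z)) (fun z => b₁ (x z)) h]
    ring
  have hdiag : Measurable fun x : ℕ → X => K (x, x) :=
    hKm.comp (f := fun x : ℕ → X => (x, x)) (by fun_prop)
  simp_rw [step2]
  -- the points of the block and the other points are independent
  rw [← integral_comp_of_measurePreserving (measurePreserving_merge μ (S₀ : Set ℕ)) hdiag]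
  have step3 : ∀ p, K (merge (S₀ : Set ℕ) p, merge (S₀ : Set ℕ) p) = K p := fun p => by
    have e1 : ∀ i ∈ S₀, merge (S₀ : Set ℕ) p i = p.1 i := fun i hi => merge_of_mem hi
    have e2 : ∀ i ∈ V₀, merge (S₀ : Set ℕ) p i = p.2 i := fun i hi =>
      merge_of_notMem (Finset.disjoint_right.1 hSV₀ hi)
    have e3 : ∀ z, avoid φ S₀ (merge (S₀ : Set ℕ) p) z = avoid φ S₀ p.1 z := fun z =>
      Finset.prod_congr rfl fun i hi => by rw [e1 i hi]
    simp only [K]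
    rw [Finset.prod_congr rfl fun i hi => by rw [e1 i hi], dependsOn_connProb φ S₀ e1,
      dependsOn_meanCount φ k V₀ h e2,
      Finset.prod_congr (s₁ := V₀) rfl fun i hi => by rw [e2 i hi, e3]]
  simp_rw [step3]
  rw [integral_prod _ (integrable_of_abs_le hKm C hKle)]
  refine integral_congr_ae (Eventually.of_forall fun y => ?_)
  simp only [K]
  rw [integral_const_mul, integral_const_mul,
    integral_points_eq φ μ k S.card V.card (β := fun z => b₀ z + b₁ z * avoid φ S₀ y z)
      (hb₀.add (hb₁.mul (measurable_avoid_comp φ S₀ (by fun_prop) (by fun_prop)))) hh]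

/-- Points that are deleted do not interact with those that are kept. -/
lemma integral_prod_mul_count {R D : Finset ℕ} (hRD : Disjoint R D) (k : ℕ) {β γ : X → ℝ}
    (hβ : Measurable β) (hγ : Measurable γ) {h : ℝ → ℝ} (hh : Measurable h)
    (hβ1 : ∀ z, |β z| ≤ 1) (hγ1 : ∀ z, |γ z| ≤ 1) {C : ℝ} (hC : ∀ w, |h w| ≤ C) :
    ∫ ω, ((∏ i ∈ R, β (ω.1 i)) * ∏ i ∈ D, γ (ω.1 i)) *
        h (count k (pointGraph φ ω.1 ω.2) R) ∂sampleMeasure μ =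
      (∫ z, γ z ∂μ) ^ D.card * weightedMean φ μ k β h R.card := by
  have hC0 : 0 ≤ C := (abs_nonneg _).trans (hC 0)
  have hmβ : Measurable fun x : ℕ → X => ∏ i ∈ R, β (x i) :=
    Finset.measurable_prod _ fun i _ => hβ.comp (by fun_prop)
  have hmγ : Measurable fun x : ℕ → X => ∏ i ∈ D, γ (x i) :=
    Finset.measurable_prod _ fun i _ => hγ.comp (by fun_prop)
  have hm : Measurable fun ω : (ℕ → X) × (Sym2 ℕ → unitInterval) =>
      ((∏ i ∈ R, β (ω.1 i)) * ∏ i ∈ D, γ (ω.1 i)) * h (count k (pointGraph φ ω.1 ω.2) R) :=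
    ((hmβ.comp measurable_fst).mul (hmγ.comp measurable_fst)).mul
      (((isLocal_count k R).comp h).measurable φ)
  rw [sampleMeasure, integral_prod _ (integrable_of_abs_le hm C fun ω => ?_)]
  swap
  · exact abs_mul_le_of_le_one (abs_mul_le_of_le_one (prod_abs_le_one fun i _ => hβ1 _)
      (prod_abs_le_one fun i _ => hγ1 _)) (hC _)
  have e1 : ∀ x : ℕ → X, ∫ u, ((∏ i ∈ R, β (x i)) * ∏ i ∈ D, γ (x i)) *
      h (count k (pointGraph φ x u) R) ∂markMeasure =
      (∏ i ∈ D, γ (x i)) * ((∏ i ∈ R, β (x i)) * meanCount φ k R h x) := fun x => by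
    rw [integral_const_mul, meanCount]; ring
  simp_rw [e1]
  rw [integral_mul_of_dependsOn (H := fun x => (∏ i ∈ R, β (x i)) * meanCount φ k R h x)
    hmγ (hmβ.mul (measurable_meanCount φ k R h))
    (A := (D : Set ℕ)) (B := (R : Set ℕ)), integral_prod_eval hγ]
  · obtain ⟨g, hg, -⟩ := exists_embedding_map_range hRD
    conv_lhs => rw [← hg]
    rw [weightedMean_eq_map φ μ k hβ hh]
  · exact fun x y hxy => Finset.prod_congr rfl fun i hi => congrArg γ (hxy i hi)
  · intro x y hxy
    exact congrArg₂ (· * ·) (Finset.prod_congr rfl fun i hi => congrArg β (hxy i hi))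
      (dependsOn_meanCount φ k R h hxy)
  · exact_mod_cast hRD.symm

end RandomGraph

end IRG

/-! ### Means over a Poisson number of points -/

namespace IRG

section PoissonSums

variable {r : ℝ≥0}

lemma integrable_pow_poisson (r : ℝ≥0) (c : ℝ) :
    Integrable (fun n : ℕ => c ^ n) (poissonMeasure r) := by
  rw [integrable_poissonMeasure_iff]
  have h := (Real.summable_pow_div_factorial (r * |c|)).mul_left (Real.exp (-r))
  refine h.congr fun n => ?_
  rw [norm_pow, Real.norm_eq_abs, mul_pow]; ring

lemma integral_pow_poisson (r : ℝ≥0) (c : ℝ) :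
    ∫ n, c ^ n ∂poissonMeasure r = Real.exp (-(r * (1 - c))) := by
  rw [integral_poissonMeasure]
  have h : ∀ n : ℕ, (Real.exp (-r) * (r : ℝ) ^ n / n.factorial) • c ^ n =
      Real.exp (-r) * ((r * c) ^ n / n.factorial) := fun n => by
    rw [smul_eq_mul, mul_pow]; ring
  simp_rw [h]
  rw [tsum_mul_left, (NormedSpace.expSeries_div_hasSum_exp (r * c : ℝ)).tsum_eq,
    ← Real.exp_eq_exp_ℝ, ← Real.exp_add]
  congr 1; ring

lemma poisson_weight_shift (r : ℝ≥0) (k m : ℕ) :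
    Real.exp (-r) * (r : ℝ) ^ (m + k) / (m + k).factorial * ((m + k).choose k : ℝ) =
      (r : ℝ) ^ k / k.factorial * (Real.exp (-r) * (r : ℝ) ^ m / m.factorial) := by
  have h : ((m + k).choose k : ℝ) * k.factorial * m.factorial = (m + k).factorial := by
    have := Nat.choose_mul_factorial_mul_factorial (Nat.le_add_left k m)
    rw [Nat.add_sub_cancel] at this
    exact_mod_cast this
  have h1 : ((m + k).factorial : ℝ) ≠ 0 := by positivity
  have h2 : (k.factorial : ℝ) ≠ 0 := by positivity
  have h3 : (m.factorial : ℝ) ≠ 0 := by positivity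
  rw [div_mul_eq_mul_div, div_mul_div_comm, div_eq_div_iff h1 (by positivity), ← h]
  ring

lemma hasSum_choose_poisson (r : ℝ≥0) (k : ℕ) {J : ℕ → ℝ} {C : ℝ} (hJ : ∀ n, |J n| ≤ C) :
    HasSum (fun n : ℕ => (Real.exp (-r) * (r : ℝ) ^ n / n.factorial) •
        ((n.choose k : ℝ) * J (n - k)))
      ((r : ℝ) ^ k / k.factorial * ∫ n, J n ∂poissonMeasure r) := by
  have hint : Integrable J (poissonMeasure r) := integrable_of_abs_le (by fun_prop) C hJ
  have h1 := (hasSum_integral_poissonMeasure hint).mul_left ((r : ℝ) ^ k / k.factorial)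
  rw [← hasSum_nat_add_iff' k]
  have hz : ∑ i ∈ Finset.range k, (Real.exp (-r) * (r : ℝ) ^ i / i.factorial) •
      ((i.choose k : ℝ) * J (i - k)) = 0 :=
    Finset.sum_eq_zero fun i hi => by
      rw [Nat.choose_eq_zero_of_lt (Finset.mem_range.1 hi)]; simp
  rw [hz, sub_zero]
  have hm : (fun m : ℕ => (Real.exp (-r) * (r : ℝ) ^ (m + k) / (m + k).factorial) •
      (((m + k).choose k : ℝ) * J (m + k - k))) = fun m : ℕ => (r : ℝ) ^ k / k.factorial *
        (Real.exp (-r) * (r : ℝ) ^ m / m.factorial) • J m := by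
    funext m
    simp only [smul_eq_mul, Nat.add_sub_cancel]
    rw [← mul_assoc, poisson_weight_shift]; ring
  rw [hm]
  exact h1

lemma integrable_choose_poisson (r : ℝ≥0) (k : ℕ) {J : ℕ → ℝ} {C : ℝ} (hJ : ∀ n, |J n| ≤ C) :
    Integrable (fun n : ℕ => (n.choose k : ℝ) * J (n - k)) (poissonMeasure r) := by
  rw [integrable_poissonMeasure_iff]
  have h := (hasSum_choose_poisson r k (J := fun n => |J n|) (C := C)
    (fun n => by rw [abs_abs]; exact hJ n)).summable
  refine h.congr fun n => ?_
  rw [smul_eq_mul, Real.norm_eq_abs, abs_mul, Nat.abs_cast]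

/-- The Mecke formula for the number of points. -/
lemma integral_choose_poisson (r : ℝ≥0) (k : ℕ) {J : ℕ → ℝ} {C : ℝ} (hJ : ∀ n, |J n| ≤ C) :
    ∫ n, (n.choose k : ℝ) * J (n - k) ∂poissonMeasure r =
      (r : ℝ) ^ k / k.factorial * ∫ n, J n ∂poissonMeasure r :=
  (hasSum_integral_poissonMeasure (integrable_choose_poisson r k hJ)).unique
    (hasSum_choose_poisson r k hJ)

lemma integrable_choose_poisson_const (r : ℝ≥0) (k : ℕ) :
    Integrable (fun n : ℕ => (n.choose k : ℝ)) (poissonMeasure r) := by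
  simpa using integrable_choose_poisson r k (J := fun _ => 1) (C := 1) (by simp)

/-- Splitting a Poisson number of points into kept and deleted ones. -/
lemma integral_sum_choose_poisson (r : ℝ≥0) (p : ℝ) {b : ℕ → ℝ} {C : ℝ}
    (hb : ∀ n, |b n| ≤ C) :
    ∫ n, ∑ j ∈ Finset.range (n + 1), (n.choose j : ℝ) * (p ^ (n - j) * b j) ∂poissonMeasure r =
      Real.exp (r * p) * ∫ n, b n ∂poissonMeasure r := by
  have hbint : Integrable b (poissonMeasure r) := integrable_of_abs_le (by fun_prop) C hb
  have hC : 0 ≤ C := (abs_nonneg _).trans (hb 0)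
  have h1 : Summable fun n : ℕ => ‖Real.exp (-r) * (r : ℝ) ^ n / n.factorial * b n‖ := by
    refine (integrable_poissonMeasure_iff.1 hbint).congr fun n => ?_
    rw [norm_mul, Real.norm_of_nonneg
      (show 0 ≤ Real.exp (-r) * (r : ℝ) ^ n / n.factorial by positivity)]
  have h2 : Summable fun n : ℕ => ‖(r * p) ^ n / n.factorial‖ :=
    (Real.summable_pow_div_factorial (r * p)).norm
  have hprod := tsum_mul_tsum_eq_tsum_sum_range_of_summable_norm h1 h2
  rw [integral_poissonMeasure, integral_poissonMeasure,
    ← (show (∑' n : ℕ, (r * p) ^ n / n.factorial) = Real.exp (r * p) by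
      rw [(NormedSpace.expSeries_div_hasSum_exp (r * p : ℝ)).tsum_eq, ← Real.exp_eq_exp_ℝ]),
    mul_comm]
  simp only [smul_eq_mul]
  rw [hprod]
  refine tsum_congr fun n => ?_
  rw [Finset.mul_sum]
  refine Finset.sum_congr rfl fun j hj => ?_
  have hjn : j ≤ n := Nat.lt_succ_iff.1 (Finset.mem_range.1 hj)
  obtain ⟨m, rfl⟩ := Nat.exists_eq_add_of_le' hjn
  have h := poisson_weight_shift r j m
  rw [Nat.add_sub_cancel, ← mul_assoc, h, mul_pow]
  field_simp

lemma integrable_sum_choose_poisson (r : ℝ≥0) {p : ℝ} (hp : 0 ≤ p) {b : ℕ → ℝ} {C : ℝ}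
    (hb : ∀ n, |b n| ≤ C) :
    Integrable (fun n => ∑ j ∈ Finset.range (n + 1), (n.choose j : ℝ) * (p ^ (n - j) * b j))
      (poissonMeasure r) := by
  refine ((integrable_pow_poisson r (1 + p)).mul_const C).mono'
    (by fun_prop) (Eventually.of_forall fun n => ?_)
  have hbin : (1 + p) ^ n = ∑ j ∈ Finset.range (n + 1), (n.choose j : ℝ) * p ^ (n - j) := by
    rw [add_pow]
    exact Finset.sum_congr rfl fun j _ => by rw [one_pow]; ring
  rw [hbin, Finset.sum_mul]
  refine (norm_sum_le _ _).trans (Finset.sum_le_sum fun j _ => ?_)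
  rw [Real.norm_eq_abs, abs_mul, abs_mul, Nat.abs_cast, abs_of_nonneg (pow_nonneg hp _), mul_assoc]
  gcongr
  exact hb j

end PoissonSums

end IRG

/-! ### The Stein identity for the number of components -/

namespace IRG

section Stein

variable {X : Type*} [MeasurableSpace X] (φ : ConnectionFunction X)
  (μ : Measure X)

/-- The probability that a random point is joined to none of the points `y i`, `i < k`. -/
noncomputable def avoidMean (k : ℕ) (y : ℕ → X) : ℝ := ∫ z, avoid φ (Finset.range k) y z ∂μ

lemma avoidMean_nonneg (k : ℕ) (y : ℕ → X) : 0 ≤ avoidMean φ μ k y :=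
  integral_nonneg fun _ => avoid_nonneg _ _ _ _

variable [IsProbabilityMeasure μ]

/-- The number of components with `k` vertices among the first `n` points. -/
noncomputable def sampleCount (k n : ℕ) (ω : (ℕ → X) × (Sym2 ℕ → unitInterval)) : ℝ :=
  count k (pointGraph φ ω.1 ω.2) (Finset.range n)

lemma measurable_sampleCount (k n : ℕ) : Measurable (sampleCount φ k n) :=
  (isLocal_count k _).measurable φ

lemma sampleCount_nonneg (k n : ℕ) (ω : (ℕ → X) × (Sym2 ℕ → unitInterval)) :
    0 ≤ sampleCount φ k n ω := count_nonneg _ _ _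

lemma sampleCount_le (k n : ℕ) (ω : (ℕ → X) × (Sym2 ℕ → unitInterval)) :
    sampleCount φ k n ω ≤ n.choose k := by
  have := count_le_choose k (pointGraph φ ω.1 ω.2) (Finset.range n)
  rwa [Finset.card_range] at this

lemma abs_sampleCount_le (k n : ℕ) (ω : (ℕ → X) × (Sym2 ℕ → unitInterval)) :
    |sampleCount φ k n ω| ≤ n.choose k := by
  rw [abs_of_nonneg (sampleCount_nonneg φ k n ω)]; exact sampleCount_le φ k n ω

lemma avoidMean_le_one (k : ℕ) (y : ℕ → X) : avoidMean φ μ k y ≤ 1 :=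
  (le_abs_self _).trans (abs_integral_le_of_abs_le fun z => by
    rw [abs_of_nonneg (avoid_nonneg _ _ _ _)]; exact avoid_le_one _ _ _ _)

lemma measurable_integral_right {A B : Type*} [MeasurableSpace A] [MeasurableSpace B]
    {P : Measure B} [SFinite P] {F : A → B → ℝ} (hF : Measurable (Function.uncurry F)) :
    Measurable fun a => ∫ b, F a b ∂P :=
  (hF.stronglyMeasurable.integral_prod_right (ν := P)).measurable

lemma measurable_avoidMean (k : ℕ) : Measurable (avoidMean φ μ k) :=
  measurable_integral_right (measurable_avoid φ (Finset.range k))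

lemma weightedMean_one (k : ℕ) {β : X → ℝ} (hβ : Measurable β) (n : ℕ) :
    weightedMean φ μ k β (fun _ => 1) n = (∫ z, β z ∂μ) ^ n := by
  unfold weightedMean meanCount
  simp [integral_prod_eval hβ]

lemma abs_weightedMean_le (k : ℕ) {β : X → ℝ} (hβ1 : ∀ z, |β z| ≤ 1) {h : ℝ → ℝ} {C : ℝ}
    (hC : ∀ w, |h w| ≤ C) (n : ℕ) : |weightedMean φ μ k β h n| ≤ C :=
  abs_integral_le_of_abs_le fun x => abs_mul_le_of_le_one (prod_abs_le_one fun _ _ => hβ1 _)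
    (abs_meanCount_le φ k _ hC x)

lemma measurable_weightedMean {Ω : Type*} [MeasurableSpace Ω] (k n : ℕ) {β : Ω → X → ℝ}
    (hβ : Measurable (Function.uncurry β)) (h : ℝ → ℝ) :
    Measurable fun y => weightedMean φ μ k (β y) h n := by
  refine measurable_integral_right (F := fun y x => (∏ i ∈ Finset.range n, β y (x i)) *
    meanCount φ k (Finset.range n) h x) ?_
  refine Measurable.mul (Finset.measurable_prod _ fun i _ => ?_)
    ((measurable_meanCount φ k _ h).comp measurable_snd)
  exact hβ.comp (f := fun p : Ω × (ℕ → X) => (p.1, p.2 i)) (by fun_prop)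

lemma abs_avoid_le_one (S : Finset ℕ) (y : ℕ → X) (z : X) : |avoid φ S y z| ≤ 1 := by
  rw [abs_of_nonneg (avoid_nonneg _ _ _ _)]; exact avoid_le_one _ _ _ _

/-- The factorization formula, summed over the prospective blocks among `n` points. -/
theorem integral_sum_block_eq (k n : ℕ) {a b₀ b₁ : X → ℝ} (ha : Measurable a)
    (hb₀ : Measurable b₀) (hb₁ : Measurable b₁) {h : ℝ → ℝ} (hh : Measurable h)
    (ha1 : ∀ z, |a z| ≤ 1) (hb : ∀ z, |b₀ z| + |b₁ z| ≤ 1) {C : ℝ} (hC : ∀ w, |h w| ≤ C) :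
    Integrable (fun ω : (ℕ → X) × (Sym2 ℕ → unitInterval) =>
      ∑ S ∈ (Finset.range n).powersetCard k, (∏ i ∈ S, a (ω.1 i)) *
        ((∏ z ∈ Finset.range n \ S,
          (b₀ (ω.1 z) + b₁ (ω.1 z) * sepInd (pointGraph φ ω.1 ω.2) S z)) *
        (connInd (pointGraph φ ω.1 ω.2) S *
          h (count k (pointGraph φ ω.1 ω.2) (Finset.range n \ S))))) (sampleMeasure μ) ∧
    ∫ ω, ∑ S ∈ (Finset.range n).powersetCard k, (∏ i ∈ S, a (ω.1 i)) *
        ((∏ z ∈ Finset.range n \ S,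
          (b₀ (ω.1 z) + b₁ (ω.1 z) * sepInd (pointGraph φ ω.1 ω.2) S z)) *
        (connInd (pointGraph φ ω.1 ω.2) S *
          h (count k (pointGraph φ ω.1 ω.2) (Finset.range n \ S)))) ∂sampleMeasure μ =
      n.choose k * ∫ y, (∏ i ∈ Finset.range k, a (y i)) * (connProb φ (Finset.range k) y *
        weightedMean φ μ k (fun z => b₀ z + b₁ z * avoid φ (Finset.range k) y z) h (n - k))
        ∂pointMeasure μ := by
  have hint : ∀ S ∈ (Finset.range n).powersetCard k,
      Integrable (fun ω : (ℕ → X) × (Sym2 ℕ → unitInterval) => (∏ i ∈ S, a (ω.1 i)) *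
        ((∏ z ∈ Finset.range n \ S,
          (b₀ (ω.1 z) + b₁ (ω.1 z) * sepInd (pointGraph φ ω.1 ω.2) S z)) *
        (connInd (pointGraph φ ω.1 ω.2) S *
          h (count k (pointGraph φ ω.1 ω.2) (Finset.range n \ S))))) (sampleMeasure μ) := by
    intro S _
    refine integrable_of_abs_le (Measurable.mul ?_ (Measurable.mul ?_ (Measurable.mul ?_ ?_))) C
      fun ω => ?_
    · exact Finset.measurable_prod _ fun i _ => ha.comp (by fun_prop)
    · exact Finset.measurable_prod _ fun i _ => (hb₀.comp (by fun_prop)).add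
        ((hb₁.comp (by fun_prop)).mul ((isLocal_sepInd S i).measurable φ))
    · exact (isLocal_connInd S).measurable φ
    · exact ((isLocal_count k _).comp h).measurable φ
    · refine abs_mul_le_of_le_one (prod_abs_le_one fun i _ => ha1 _) (abs_mul_le_of_le_one
        (prod_abs_le_one fun i _ => ?_) (abs_mul_le_of_le_one ?_ (hC _)))
      · refine (abs_add_le _ _).trans (le_trans ?_ (hb (ω.1 i)))
        rw [abs_mul, abs_of_nonneg (sepInd_nonneg _ _ _)]
        have := mul_le_of_le_one_right (abs_nonneg (b₁ (ω.1 i)))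
          (sepInd_le_one (pointGraph φ ω.1 ω.2) S i)
        linarith
      · rw [abs_of_nonneg (connInd_nonneg _ _)]
        exact connInd_le_one _ _
  refine ⟨integrable_finsetSum _ hint, ?_⟩
  rw [integral_finsetSum _ hint]
  have hterm : ∀ S ∈ (Finset.range n).powersetCard k, _ = _ := fun S hS =>
    integral_block_eq φ μ (S := S) (V := Finset.range n \ S) Finset.disjoint_sdiff k ha hb₀ hb₁ hh
      ha1 hb hC
  rw [Finset.sum_congr rfl hterm]
  have hcard : ∀ S ∈ (Finset.range n).powersetCard k,
      S.card = k ∧ (Finset.range n \ S).card = n - k := fun S hS => by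
    rw [Finset.mem_powersetCard] at hS
    rw [Finset.card_sdiff_of_subset hS.1, hS.2, Finset.card_range]
    exact ⟨rfl, rfl⟩
  rw [Finset.sum_congr rfl fun S hS => by rw [(hcard S hS).1, (hcard S hS).2], Finset.sum_const,
    Finset.card_powersetCard, Finset.card_range, nsmul_eq_mul]

/-- The Stein identity for a fixed number of points. -/
theorem integral_sampleCount_mul (k n : ℕ) {f : ℝ → ℝ} (hf : Measurable f) {C : ℝ}
    (hC : ∀ w, |f w| ≤ C) :
    ∫ ω, sampleCount φ k n ω * f (sampleCount φ k n ω) ∂sampleMeasure μ =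
      n.choose k * ∫ y, connProb φ (Finset.range k) y *
        weightedMean φ μ k (avoid φ (Finset.range k) y) (fun w => f (1 + w)) (n - k)
        ∂pointMeasure μ := by
  have h := (integral_sum_block_eq φ μ k n (a := fun _ => 1) (b₀ := fun _ => 0) (b₁ := fun _ => 1)
    measurable_const measurable_const measurable_const (h := fun w => f (1 + w))
    (hf.comp (measurable_const.add measurable_id)) (by simp) (by simp) (fun w => hC _)).2
  simp only [Finset.prod_const_one, one_mul, zero_add] at h
  rw [← h]
  refine integral_congr_ae (Eventually.of_forall fun ω => ?_)
  simp only [sampleCount]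
  rw [count_mul_eq_sum]
  exact Finset.sum_congr rfl fun S _ => by ring

lemma integral_sampleCount (k n : ℕ) :
    ∫ ω, sampleCount φ k n ω ∂sampleMeasure μ =
      n.choose k * ∫ y, connProb φ (Finset.range k) y * avoidMean φ μ k y ^ (n - k)
        ∂pointMeasure μ := by
  have h := integral_sampleCount_mul φ μ k n (f := fun _ => 1) measurable_const (C := 1) (by simp)
  simp only [mul_one] at h
  rw [h]
  congr 1
  refine integral_congr_ae (Eventually.of_forall fun y => ?_)
  simp only
  rw [weightedMean_one φ μ k (measurable_avoid_comp φ _ (by fun_prop) (by fun_prop)), avoidMean]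

lemma integrable_sub_two_mul_add {Ω : Type*} [MeasurableSpace Ω] {P : Measure Ω} {F G H : Ω → ℝ}
    (hF : Integrable F P) (hG : Integrable G P) (hH : Integrable H P) :
    Integrable (fun ω => F ω - 2 * G ω + H ω) P := (hF.sub (hG.const_mul 2)).add hH

lemma integral_sub_two_mul_add {Ω : Type*} [MeasurableSpace Ω] {P : Measure Ω} {F G H : Ω → ℝ}
    (hF : Integrable F P) (hG : Integrable G P) (hH : Integrable H P) :
    ∫ ω, (F ω - 2 * G ω + H ω) ∂P = ∫ ω, F ω ∂P - 2 * ∫ ω, G ω ∂P + ∫ ω, H ω ∂P := by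
  have h := integral_add (hF.sub (hG.const_mul 2)) hH
  have h' := integral_sub hF (hG.const_mul 2)
  rw [integral_const_mul] at h'
  rw [← h']
  exact h

/-- The mean effect of random deletions on a Lipschitz function of the number of components, for a
fixed number of points. -/
theorem abs_sum_choose_weightedMean_sub_le (k n : ℕ) {q : X → ℝ} (hq : Measurable q)
    (hq0 : ∀ z, 0 ≤ q z) (hq1 : ∀ z, q z ≤ 1) {h : ℝ → ℝ} (hh : Measurable h) {C : ℝ}
    (hC : ∀ w, |h w| ≤ C) {L : ℝ} (hL0 : 0 ≤ L) (hL : ∀ v w, |h v - h w| ≤ L * |v - w|) :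
    |∑ j ∈ Finset.range (n + 1), (n.choose j : ℝ) *
        ((1 - ∫ z, q z ∂μ) ^ (n - j) * weightedMean φ μ k q h j) -
      ∫ ω, h (sampleCount φ k n ω) ∂sampleMeasure μ| ≤
    L * (n.choose k * ∫ y, connProb φ (Finset.range k) y *
      ((1 - ∏ i ∈ Finset.range k, q (y i)) * avoidMean φ μ k y ^ (n - k) +
        (∏ i ∈ Finset.range k, q (y i)) *
          ((∫ z, (1 - q z * (1 - avoid φ (Finset.range k) y z)) ∂μ) ^ (n - k) -
            avoidMean φ μ k y ^ (n - k))) ∂pointMeasure μ) := by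
  have hqa : ∀ z, |q z| ≤ 1 := fun z => by rw [abs_of_nonneg (hq0 z)]; exact hq1 z
  have hqa' : ∀ z, |1 - q z| ≤ 1 := fun z => by
    rw [abs_of_nonneg (sub_nonneg.2 (hq1 z))]; linarith [hq0 z]
  have hqint : Integrable q μ := integrable_of_abs_le hq 1 hqa
  set V := Finset.range n with hV
  let w : Finset ℕ → (ℕ → X) × (Sym2 ℕ → unitInterval) → ℝ := fun R ω =>
    (∏ i ∈ R, q (ω.1 i)) * ∏ i ∈ V \ R, (1 - q (ω.1 i))
  have hwm : ∀ R, Measurable (w R) := fun R =>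
    (Finset.measurable_prod _ fun i _ => hq.comp (by fun_prop)).mul
      (Finset.measurable_prod _ fun i _ => measurable_const.sub (hq.comp (by fun_prop)))
  have hw1 : ∀ R ω, |w R ω| ≤ 1 := fun R ω =>
    abs_mul_le_of_le_one (prod_abs_le_one fun _ _ => hqa _) (prod_abs_le_one fun _ _ => hqa' _)
  have hw0 : ∀ R ω, 0 ≤ w R ω := fun R ω => mul_nonneg (Finset.prod_nonneg fun i _ => hq0 _)
    (Finset.prod_nonneg fun i _ => sub_nonneg.2 (hq1 _))
  have hwsum : ∀ ω, ∑ R ∈ V.powerset, w R ω = 1 := fun ω =>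
    sum_powerset_weight V (fun i => q (ω.1 i))
  have hhm : ∀ R, Measurable fun ω : (ℕ → X) × (Sym2 ℕ → unitInterval) =>
      h (count k (pointGraph φ ω.1 ω.2) R) := fun R => ((isLocal_count k R).comp h).measurable φ
  have hint1 : ∀ R ∈ V.powerset, Integrable (fun ω => w R ω *
      h (count k (pointGraph φ ω.1 ω.2) R)) (sampleMeasure μ) := fun R _ =>
    integrable_of_abs_le ((hwm R).mul (hhm R)) C fun ω => abs_mul_le_of_le_one (hw1 R ω) (hC _)
  -- the deleted graph has the claimed law
  have e1 : ∑ j ∈ Finset.range (n + 1), (n.choose j : ℝ) *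
        ((1 - ∫ z, q z ∂μ) ^ (n - j) * weightedMean φ μ k q h j) =
      ∫ ω, ∑ R ∈ V.powerset, w R ω * h (count k (pointGraph φ ω.1 ω.2) R) ∂sampleMeasure μ := by
    rw [integral_finsetSum _ hint1]
    have hR : ∀ R ∈ V.powerset, ∫ ω, w R ω * h (count k (pointGraph φ ω.1 ω.2) R)
        ∂sampleMeasure μ = (1 - ∫ z, q z ∂μ) ^ (n - R.card) * weightedMean φ μ k q h R.card := by
      intro R hR
      rw [Finset.mem_powerset] at hR
      have := integral_prod_mul_count φ μ (R := R) (D := V \ R) Finset.disjoint_sdiff k hq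
        (γ := fun z => 1 - q z) (measurable_const.sub hq) hh hqa hqa' hC
      rw [integral_sub (integrable_const _) hqint, Finset.card_sdiff_of_subset hR, hV,
        Finset.card_range] at this
      simpa using this
    rw [Finset.sum_congr rfl hR, Finset.sum_powerset_apply_card
      (fun j => (1 - ∫ z, q z ∂μ) ^ (n - j) * weightedMean φ μ k q h j), hV, Finset.card_range]
    simp only [nsmul_eq_mul]
  have e2 : ∫ ω, h (sampleCount φ k n ω) ∂sampleMeasure μ =
      ∫ ω, ∑ R ∈ V.powerset, w R ω * h (count k (pointGraph φ ω.1 ω.2) V) ∂sampleMeasure μ := by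
    refine integral_congr_ae (Eventually.of_forall fun ω => ?_)
    simp only
    rw [← Finset.sum_mul, hwsum, one_mul, sampleCount]
  have hint2 : Integrable (fun ω => ∑ R ∈ V.powerset, w R ω *
      h (count k (pointGraph φ ω.1 ω.2) V)) (sampleMeasure μ) :=
    integrable_finsetSum _ fun R _ =>
      integrable_of_abs_le ((hwm R).mul (hhm V)) C fun ω => abs_mul_le_of_le_one (hw1 R ω) (hC _)
  -- the three sums of blocks that bound the effect of the deletions
  have g1 := integral_sum_block_eq φ μ k n (a := fun _ => 1) (b₀ := fun _ => 0)
    (b₁ := fun _ => 1) measurable_const measurable_const measurable_const (h := fun _ => 1)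
    measurable_const (by simp) (by simp) (C := 1) (by simp)
  have g2 := integral_sum_block_eq φ μ k n (a := q) (b₀ := fun _ => 0)
    (b₁ := fun _ => 1) hq measurable_const measurable_const (h := fun _ => 1)
    measurable_const hqa (by simp) (C := 1) (by simp)
  have g3 := integral_sum_block_eq φ μ k n (a := q) (b₀ := fun z => 1 - q z)
    (b₁ := q) hq (measurable_const.sub hq) hq (h := fun _ => 1)
    measurable_const hqa (fun z => by
      rw [abs_of_nonneg (hq0 z), abs_of_nonneg (sub_nonneg.2 (hq1 z))]; linarith) (C := 1) (by simp)
  simp only [Finset.prod_const_one, one_mul, zero_add, mul_one, ← hV] at g1 g2 g3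
  have hav : ∀ y, Measurable (avoid φ (Finset.range k) y) := fun y =>
    measurable_avoid_comp φ _ (by fun_prop) (by fun_prop)
  have w1 : ∀ y, weightedMean φ μ k (fun z => avoid φ (Finset.range k) y z) (fun _ => 1) (n - k) =
      avoidMean φ μ k y ^ (n - k) := fun y => by
    rw [weightedMean_one φ μ k (hav y), avoidMean]
  have w3 : ∀ y, weightedMean φ μ k (fun z => 1 - q z + q z * avoid φ (Finset.range k) y z)
      (fun _ => 1) (n - k) =
      (∫ z, (1 - q z * (1 - avoid φ (Finset.range k) y z)) ∂μ) ^ (n - k) := fun y => by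
    rw [weightedMean_one φ μ k
      (β := fun z => 1 - q z + q z * avoid φ (Finset.range k) y z)
      ((measurable_const.sub hq).add (hq.mul (hav y)))]
    congr 2
    ext z; ring
  simp only [w1, w3] at g1 g2 g3
  have hκm := measurable_connProb φ (Finset.range k)
  have hAm := (measurable_avoidMean φ μ k).pow_const (n - k)
  have hQm : Measurable fun y : ℕ → X => ∏ i ∈ Finset.range k, q (y i) :=
    Finset.measurable_prod _ fun i _ => hq.comp (by fun_prop)
  have hκ1 : ∀ y, |connProb φ (Finset.range k) y| ≤ 1 := fun y => by
    rw [abs_of_nonneg (connProb_nonneg _ _ _)]; exact connProb_le_one _ _ _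
  have hA1 : ∀ y, |avoidMean φ μ k y ^ (n - k)| ≤ 1 := fun y => by
    rw [abs_of_nonneg (pow_nonneg (avoidMean_nonneg φ μ k y) _)]
    exact pow_le_one₀ (avoidMean_nonneg φ μ k y) (avoidMean_le_one φ μ k y)
  have hBm : Measurable fun y => (∫ z, (1 - q z * (1 - avoid φ (Finset.range k) y z)) ∂μ) :=
    measurable_integral_right (F := fun y z => (1 - q z * (1 - avoid φ (Finset.range k) y z)))
      (measurable_const.sub ((hq.comp measurable_snd).mul
        (measurable_const.sub (measurable_avoid φ _))))
  have hB1 : ∀ y, |(∫ z, (1 - q z * (1 - avoid φ (Finset.range k) y z)) ∂μ) ^ (n - k)| ≤ 1 := by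
    intro y
    rw [abs_pow]
    refine pow_le_one₀ (abs_nonneg _) (abs_integral_le_of_abs_le fun z => ?_)
    have h1 := avoid_nonneg φ (Finset.range k) y z
    have h2 := avoid_le_one φ (Finset.range k) y z
    have h3 : q z * (1 - avoid φ (Finset.range k) y z) ≤ 1 :=
      mul_le_one₀ (hq1 z) (by linarith) (by linarith)
    have h4 : 0 ≤ q z * (1 - avoid φ (Finset.range k) y z) := mul_nonneg (hq0 z) (by linarith)
    rw [abs_of_nonneg (by linarith)]; linarith
  have i1 : Integrable (fun y => connProb φ (Finset.range k) y * avoidMean φ μ k y ^ (n - k))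
      (pointMeasure μ) :=
    integrable_of_abs_le (hκm.mul hAm) 1 fun y => abs_mul_le_of_le_one (hκ1 y) (hA1 y)
  have i2 : Integrable (fun y => (∏ i ∈ Finset.range k, q (y i)) *
      (connProb φ (Finset.range k) y * avoidMean φ μ k y ^ (n - k))) (pointMeasure μ) :=
    integrable_of_abs_le (hQm.mul (hκm.mul hAm)) 1 fun y =>
      abs_mul_le_of_le_one (prod_abs_le_one fun _ _ => hqa _)
        (abs_mul_le_of_le_one (hκ1 y) (hA1 y))
  have i3 : Integrable (fun y => (∏ i ∈ Finset.range k, q (y i)) *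
      (connProb φ (Finset.range k) y *
        (∫ z, (1 - q z * (1 - avoid φ (Finset.range k) y z)) ∂μ) ^ (n - k))) (pointMeasure μ) :=
    integrable_of_abs_le (hQm.mul (hκm.mul (hBm.pow_const _))) 1 fun y =>
      abs_mul_le_of_le_one (prod_abs_le_one fun _ _ => hqa _)
        (abs_mul_le_of_le_one (hκ1 y) (hB1 y))
  have hbound : ∀ ω : (ℕ → X) × (Sym2 ℕ → unitInterval),
      |∑ R ∈ V.powerset, w R ω * h (count k (pointGraph φ ω.1 ω.2) R) -
        ∑ R ∈ V.powerset, w R ω * h (count k (pointGraph φ ω.1 ω.2) V)| ≤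
      L * ((∑ S ∈ V.powersetCard k, (∏ z ∈ V \ S, sepInd (pointGraph φ ω.1 ω.2) S z) *
          connInd (pointGraph φ ω.1 ω.2) S) -
        2 * (∑ S ∈ V.powersetCard k, (∏ i ∈ S, q (ω.1 i)) *
          ((∏ z ∈ V \ S, sepInd (pointGraph φ ω.1 ω.2) S z) *
          connInd (pointGraph φ ω.1 ω.2) S)) +
        ∑ S ∈ V.powersetCard k, (∏ i ∈ S, q (ω.1 i)) *
          ((∏ z ∈ V \ S, (1 - q (ω.1 z) + q (ω.1 z) * sepInd (pointGraph φ ω.1 ω.2) S z)) *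
          connInd (pointGraph φ ω.1 ω.2) S)) := fun ω => by
    have hthin := sum_weight_abs_count_sub_le k (pointGraph φ ω.1 ω.2) V (fun i => q (ω.1 i))
      (fun i => hq0 _) (fun i => hq1 _)
    rw [← Finset.sum_sub_distrib]
    calc _ ≤ ∑ R ∈ V.powerset, |w R ω * h (count k (pointGraph φ ω.1 ω.2) R) -
            w R ω * h (count k (pointGraph φ ω.1 ω.2) V)| := Finset.abs_sum_le_sum_abs _ _
      _ ≤ ∑ R ∈ V.powerset, L * (w R ω * |count k (pointGraph φ ω.1 ω.2) V -
            count k (pointGraph φ ω.1 ω.2) R|) := by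
          refine Finset.sum_le_sum fun R _ => ?_
          rw [← mul_sub, abs_mul, abs_of_nonneg (hw0 R ω), abs_sub_comm (count k _ V)]
          have := mul_le_mul_of_nonneg_left (hL (count k (pointGraph φ ω.1 ω.2) R)
            (count k (pointGraph φ ω.1 ω.2) V)) (hw0 R ω)
          linarith
      _ ≤ _ := by
          rw [← Finset.mul_sum]
          refine mul_le_mul_of_nonneg_left (hthin.trans (le_of_eq ?_)) hL0
          rw [Finset.mul_sum, ← Finset.sum_sub_distrib, ← Finset.sum_add_distrib]
          refine Finset.sum_congr rfl fun S _ => ?_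
          have : ∏ z ∈ V \ S, (1 - q (ω.1 z) + q (ω.1 z) * sepInd (pointGraph φ ω.1 ω.2) S z) =
              ∏ z ∈ V \ S, (1 - q (ω.1 z) * (1 - sepInd (pointGraph φ ω.1 ω.2) S z)) :=
            Finset.prod_congr rfl fun z _ => by ring
          rw [this]; ring
  rw [e1, e2, ← integral_sub (integrable_finsetSum _ hint1) hint2, ← Real.norm_eq_abs]
  have hdom := (integrable_sub_two_mul_add g1.1 g2.1 g3.1).const_mul L
  refine (norm_integral_le_of_norm_le hdom (Eventually.of_forall fun ω => hbound ω)).trans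
    (le_of_eq ?_)
  rw [integral_const_mul, integral_sub_two_mul_add g1.1 g2.1 g3.1, g1.2, g2.2, g3.2]
  congr 1
  have hsplit : ∫ y, connProb φ (Finset.range k) y *
      ((1 - ∏ i ∈ Finset.range k, q (y i)) * avoidMean φ μ k y ^ (n - k) +
        (∏ i ∈ Finset.range k, q (y i)) *
          ((∫ z, (1 - q z * (1 - avoid φ (Finset.range k) y z)) ∂μ) ^ (n - k) -
            avoidMean φ μ k y ^ (n - k))) ∂pointMeasure μ =
      ∫ y, (connProb φ (Finset.range k) y * avoidMean φ μ k y ^ (n - k) -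
        2 * ((∏ i ∈ Finset.range k, q (y i)) *
          (connProb φ (Finset.range k) y * avoidMean φ μ k y ^ (n - k))) +
        (∏ i ∈ Finset.range k, q (y i)) * (connProb φ (Finset.range k) y *
        (∫ z, (1 - q z * (1 - avoid φ (Finset.range k) y z)) ∂μ) ^ (n - k))) ∂pointMeasure μ :=
    integral_congr_ae (Eventually.of_forall fun y => by ring)
  rw [hsplit, integral_sub_two_mul_add i1 i2 i3]
  ring

end Stein

section PoissonStein

lemma measurable_uncurry_nat {Ω : Type*} [MeasurableSpace Ω] {F : ℕ → Ω → ℝ}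
    (hF : ∀ n, Measurable (F n)) : Measurable (Function.uncurry F) :=
  measurable_from_prod_countable_right fun n => hF n

lemma integral_swap_poisson {Ω : Type*} [MeasurableSpace Ω] {P : Measure Ω}
    [IsProbabilityMeasure P] (r : ℝ≥0) {F : ℕ → Ω → ℝ} (hF : ∀ n, Measurable (F n)) {C : ℝ}
    (hC : ∀ n ω, |F n ω| ≤ C) :
    ∫ n, ∫ ω, F n ω ∂P ∂poissonMeasure r = ∫ ω, ∫ n, F n ω ∂poissonMeasure r ∂P :=
  integral_integral_swap (integrable_of_abs_le (measurable_uncurry_nat hF) C fun p => hC p.1 p.2)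

lemma measurable_integral_poisson {Ω : Type*} [MeasurableSpace Ω] (r : ℝ≥0) {F : ℕ → Ω → ℝ}
    (hF : ∀ n, Measurable (F n)) : Measurable fun ω => ∫ n, F n ω ∂poissonMeasure r :=
  measurable_integral_right (F := fun ω n => F n ω)
    ((measurable_uncurry_nat hF).comp measurable_swap)

lemma integrable_prod_poisson {Ω : Type*} [MeasurableSpace Ω] {P : Measure Ω}
    [IsProbabilityMeasure P] (r : ℝ≥0) {F : ℕ → Ω → ℝ} (hF : ∀ n, Measurable (F n)) {g : ℕ → ℝ}
    (hg : Integrable g (poissonMeasure r)) (hFg : ∀ n ω, |F n ω| ≤ g n) :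
    Integrable (fun p : ℕ × Ω => F p.1 p.2) ((poissonMeasure r).prod P) :=
  Integrable.mono' (hg.comp_fst P) (measurable_uncurry_nat hF).aestronglyMeasurable
    (Eventually.of_forall fun p => hFg p.1 p.2)

variable {X : Type*} [MeasurableSpace X] (φ : ConnectionFunction X)
  (μ : Measure X)

/-- The mean number of points joined to some `y i` but to no `x i`, `i < k`, up to the factor `r`. -/
noncomputable def overlap (k : ℕ) (x y : ℕ → X) : ℝ :=
  ∫ z, avoid φ (Finset.range k) x z * (1 - avoid φ (Finset.range k) y z) ∂μ

lemma avoid_mul_nonneg (S T : Finset ℕ) (x y : ℕ → X) (z : X) :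
    0 ≤ avoid φ S x z * (1 - avoid φ T y z) :=
  mul_nonneg (avoid_nonneg _ _ _ _) (sub_nonneg.2 (avoid_le_one _ _ _ _))

lemma overlap_nonneg (k : ℕ) (x y : ℕ → X) : 0 ≤ overlap φ μ k x y :=
  integral_nonneg fun z => avoid_mul_nonneg φ _ _ x y z

variable [IsProbabilityMeasure μ]

/-- The rate at which a configuration `y` yields an error in the Stein identity next to a component
with vertices at `x`: the first term accounts for edges between `x` and `y`, the second one for
common neighbours. -/
noncomputable def steinKernel (k : ℕ) (r : ℝ≥0) (x y : ℕ → X) : ℝ :=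
  (1 - ∏ i ∈ Finset.range k, avoid φ (Finset.range k) x (y i)) *
      Real.exp (-(r * (1 - avoidMean φ μ k y))) +
    (∏ i ∈ Finset.range k, avoid φ (Finset.range k) x (y i)) *
      (Real.exp (-(r * overlap φ μ k x y)) - Real.exp (-(r * (1 - avoidMean φ μ k y))))

/-- The bound for the error in the Stein identity. -/
noncomputable def steinError (k : ℕ) (r : ℝ≥0) : ℝ :=
  ((r : ℝ) ^ k / k.factorial) ^ 2 * ∫ x, connProb φ (Finset.range k) x *
    (Real.exp (-(r * (1 - avoidMean φ μ k x))) *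
      ∫ y, connProb φ (Finset.range k) y * steinKernel φ μ k r x y ∂pointMeasure μ) ∂pointMeasure μ

/-- The mean number of components with `k` vertices for a Poisson number of points of mean `r`. -/
noncomputable def poissonMeanCount (k : ℕ) (r : ℝ≥0) : ℝ :=
  (r : ℝ) ^ k / k.factorial * ∫ y, connProb φ (Finset.range k) y *
    Real.exp (-(r * (1 - avoidMean φ μ k y))) ∂pointMeasure μ

lemma avoid_mul_le_one (S T : Finset ℕ) (x y : ℕ → X) (z : X) :
    avoid φ S x z * (1 - avoid φ T y z) ≤ 1 :=
  mul_le_one₀ (avoid_le_one _ _ _ _) (sub_nonneg.2 (avoid_le_one _ _ _ _))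
    (sub_le_self _ (avoid_nonneg _ _ _ _))

lemma measurable_avoid_right (S : Finset ℕ) (y : ℕ → X) : Measurable (avoid φ S y) :=
  measurable_avoid_comp φ S measurable_const measurable_id

lemma integrable_avoid (S : Finset ℕ) (y : ℕ → X) : Integrable (avoid φ S y) μ :=
  integrable_of_abs_le (measurable_avoid_right φ S y) 1 (abs_avoid_le_one φ S y)

lemma integrable_avoid_mul (S T : Finset ℕ) (x y : ℕ → X) :
    Integrable (fun z => avoid φ S x z * (1 - avoid φ T y z)) μ :=
  integrable_of_abs_le ((measurable_avoid_right φ S x).mul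
    (measurable_const.sub (measurable_avoid_right φ T y))) 1 fun z => by
      rw [abs_of_nonneg (avoid_mul_nonneg φ S T x y z)]; exact avoid_mul_le_one φ S T x y z

/-- The Stein identity for a Poisson number of points. -/
lemma integral_poisson_sampleCount_mul (k : ℕ) (r : ℝ≥0) {f : ℝ → ℝ} (hf : Measurable f) {C : ℝ}
    (hC : ∀ w, |f w| ≤ C) :
    ∫ p, sampleCount φ k p.1 p.2 * f (sampleCount φ k p.1 p.2)
        ∂((poissonMeasure r).prod (sampleMeasure μ)) =
      (r : ℝ) ^ k / k.factorial * ∫ y, connProb φ (Finset.range k) y *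
        ∫ n, weightedMean φ μ k (avoid φ (Finset.range k) y) (fun w => f (1 + w)) n
          ∂poissonMeasure r ∂pointMeasure μ := by
  have hκ1 : ∀ y, |connProb φ (Finset.range k) y| ≤ 1 := fun y => by
    rw [abs_of_nonneg (connProb_nonneg _ _ _)]; exact connProb_le_one _ _ _
  have hint := integrable_prod_poisson (P := sampleMeasure μ) r
    (F := fun n ω => sampleCount φ k n ω * f (sampleCount φ k n ω))
    (fun n => (measurable_sampleCount φ k n).mul (hf.comp (measurable_sampleCount φ k n)))
    ((integrable_choose_poisson_const r k).mul_const C) fun n ω => by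
      rw [abs_mul]
      exact mul_le_mul (abs_sampleCount_le φ k n ω) (hC _) (abs_nonneg _) (Nat.cast_nonneg _)
  rw [integral_prod _ hint]
  simp only [integral_sampleCount_mul φ μ k _ hf hC]
  have hb : ∀ n y, |connProb φ (Finset.range k) y * weightedMean φ μ k (avoid φ (Finset.range k) y)
      (fun w => f (1 + w)) n| ≤ C := fun n y =>
    abs_mul_le_of_le_one (hκ1 y)
      (abs_weightedMean_le φ μ k (abs_avoid_le_one φ _ y) (fun w => hC _) n)
  rw [integral_choose_poisson r k (J := fun n => ∫ y, connProb φ (Finset.range k) y *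
    weightedMean φ μ k (avoid φ (Finset.range k) y) (fun w => f (1 + w)) n ∂pointMeasure μ)
    (C := C) fun n => abs_integral_le_of_abs_le (hb n)]
  congr 1
  rw [integral_swap_poisson r (F := fun n y => connProb φ (Finset.range k) y *
    weightedMean φ μ k (avoid φ (Finset.range k) y) (fun w => f (1 + w)) n)
    (fun n => (measurable_connProb φ _).mul
    (measurable_weightedMean φ μ k n (measurable_avoid φ _) _)) hb]
  simp only [integral_const_mul]

lemma poissonMeanCount_eq_integral (k : ℕ) (r : ℝ≥0) :
    poissonMeanCount φ μ k r =
      ∫ p, sampleCount φ k p.1 p.2 ∂((poissonMeasure r).prod (sampleMeasure μ)) := by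
  have h := integral_poisson_sampleCount_mul φ μ k r (f := fun _ => 1) measurable_const (C := 1)
    (by simp)
  simp only [mul_one] at h
  rw [h, poissonMeanCount]
  simp only [weightedMean_one φ μ k (measurable_avoid_right φ _ _), integral_pow_poisson]
  rfl

/-- The mean effect of random deletions, for a Poisson number of points. -/
lemma abs_integral_weightedMean_sub_le (k : ℕ) (r : ℝ≥0) (x : ℕ → X) {h : ℝ → ℝ}
    (hh : Measurable h) {C : ℝ} (hC : ∀ w, |h w| ≤ C) {L : ℝ} (hL0 : 0 ≤ L)
    (hL : ∀ v w, |h v - h w| ≤ L * |v - w|) :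
    |∫ n, weightedMean φ μ k (avoid φ (Finset.range k) x) h n ∂poissonMeasure r -
      Real.exp (-(r * (1 - avoidMean φ μ k x))) *
        ∫ p, h (sampleCount φ k p.1 p.2) ∂((poissonMeasure r).prod (sampleMeasure μ))| ≤
    Real.exp (-(r * (1 - avoidMean φ μ k x))) * (L * ((r : ℝ) ^ k / k.factorial *
      ∫ y, connProb φ (Finset.range k) y * steinKernel φ μ k r x y ∂pointMeasure μ)) := by
  set q : X → ℝ := avoid φ (Finset.range k) x with hq
  have hqm : Measurable q := measurable_avoid_right φ _ x
  set p₀ : ℝ := 1 - avoidMean φ μ k x with hp₀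
  have hp : 0 ≤ p₀ := sub_nonneg.2 (avoidMean_le_one φ μ k x)
  have hwb := abs_weightedMean_le φ μ k (abs_avoid_le_one φ (Finset.range k) x) hC
  have hfix := fun n => abs_sum_choose_weightedMean_sub_le φ μ k n hqm (avoid_nonneg φ _ x)
    (avoid_le_one φ _ x) hh hC hL0 hL
  have hov : ∀ y, ∫ z, (1 - avoid φ (Finset.range k) x z * (1 - avoid φ (Finset.range k) y z)) ∂μ =
      1 - overlap φ μ k x y := fun y => by
    rw [integral_sub (integrable_const _) (integrable_avoid_mul φ μ _ _ x y)]
    simp [overlap]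
  have hov0 : ∀ y, 0 ≤ overlap φ μ k x y := fun y =>
    integral_nonneg fun z => avoid_mul_nonneg φ _ _ x y z
  have hov1 : ∀ y, overlap φ μ k x y ≤ 1 := fun y =>
    (le_abs_self _).trans (abs_integral_le_of_abs_le fun z => by
      rw [abs_of_nonneg (avoid_mul_nonneg φ _ _ x y z)]; exact avoid_mul_le_one φ _ _ x y z)
  simp only [hov, ← avoidMean.eq_1 φ μ k x, hq] at hfix
  rw [← hp₀] at hfix
  -- the error terms, as functions of the number of points
  let G : ℕ → (ℕ → X) → ℝ := fun n y => connProb φ (Finset.range k) y *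
      ((1 - ∏ i ∈ Finset.range k, q (y i)) * avoidMean φ μ k y ^ n +
        (∏ i ∈ Finset.range k, q (y i)) *
          ((1 - overlap φ μ k x y) ^ n - avoidMean φ μ k y ^ n))
  have hovm : Measurable (overlap φ μ k x) :=
    measurable_integral_right (F := fun y z => avoid φ (Finset.range k) x z *
      (1 - avoid φ (Finset.range k) y z)) ((hqm.comp measurable_snd).mul
        (measurable_const.sub (measurable_avoid φ _)))
  have hQm : Measurable fun y : ℕ → X => ∏ i ∈ Finset.range k, q (y i) :=
    Finset.measurable_prod _ fun i _ => hqm.comp (by fun_prop)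
  have hGm : ∀ n, Measurable (G n) := fun n => by
    refine (measurable_connProb φ _).mul (Measurable.add ?_ ?_)
    · exact (measurable_const.sub hQm).mul ((measurable_avoidMean φ μ k).pow_const n)
    · exact hQm.mul (((measurable_const.sub hovm).pow_const n).sub
        ((measurable_avoidMean φ μ k).pow_const n))
  have hQ0 : ∀ y : ℕ → X, 0 ≤ ∏ i ∈ Finset.range k, q (y i) := fun y =>
    Finset.prod_nonneg fun _ _ => avoid_nonneg φ _ x _
  have hQ1 : ∀ y : ℕ → X, ∏ i ∈ Finset.range k, q (y i) ≤ 1 := fun y =>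
    Finset.prod_le_one (fun _ _ => avoid_nonneg φ _ x _) fun _ _ => avoid_le_one φ _ x _
  have hGb : ∀ n y, |G n y| ≤ 2 := fun n y => by
    refine abs_mul_le_of_le_one (by
      rw [abs_of_nonneg (connProb_nonneg _ _ _)]; exact connProb_le_one _ _ _) ?_
    have a0 : 0 ≤ avoidMean φ μ k y ^ n := pow_nonneg (avoidMean_nonneg φ μ k y) n
    have a1 : avoidMean φ μ k y ^ n ≤ 1 :=
      pow_le_one₀ (avoidMean_nonneg φ μ k y) (avoidMean_le_one φ μ k y)
    have b0 : 0 ≤ (1 - overlap φ μ k x y) ^ n := pow_nonneg (sub_nonneg.2 (hov1 y)) n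
    have b1 : (1 - overlap φ μ k x y) ^ n ≤ 1 :=
      pow_le_one₀ (sub_nonneg.2 (hov1 y)) (by linarith [hov0 y])
    have q0 := hQ0 y
    have q1 := hQ1 y
    refine (abs_add_le _ _).trans ?_
    have t1 : |(1 - ∏ i ∈ Finset.range k, q (y i)) * avoidMean φ μ k y ^ n| ≤ 1 :=
      abs_mul_le_of_le_one (by rw [abs_le]; constructor <;> linarith)
        (by rw [abs_le]; constructor <;> linarith)
    have t2 : |(∏ i ∈ Finset.range k, q (y i)) *
        ((1 - overlap φ μ k x y) ^ n - avoidMean φ μ k y ^ n)| ≤ 1 :=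
      abs_mul_le_of_le_one (by rw [abs_le]; constructor <;> linarith)
        (by rw [abs_le]; constructor <;> linarith)
    linarith
  have hGint : ∀ y, ∫ n, G n y ∂poissonMeasure r =
      connProb φ (Finset.range k) y * steinKernel φ μ k r x y := fun y => by
    have ia := integrable_pow_poisson r (avoidMean φ μ k y)
    have io := integrable_pow_poisson r (1 - overlap φ μ k x y)
    have ioa : Integrable (fun n => (1 - overlap φ μ k x y) ^ n - avoidMean φ μ k y ^ n)
      (poissonMeasure r) := io.sub ia
    simp only [G]
    rw [integral_const_mul, integral_add (ia.const_mul _) (ioa.const_mul _),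
      integral_const_mul, integral_const_mul, integral_sub io ia, integral_pow_poisson, integral_pow_poisson, sub_sub_cancel]
    rfl
  have hEm : ∀ n, |∫ ω, h (sampleCount φ k n ω) ∂sampleMeasure μ| ≤ C := fun n =>
    abs_integral_le_of_abs_le fun ω => hC _
  have hEint : Integrable (fun n => ∫ ω, h (sampleCount φ k n ω) ∂sampleMeasure μ)
      (poissonMeasure r) := integrable_of_abs_le Measurable.of_discrete C hEm
  have hE : ∫ p, h (sampleCount φ k p.1 p.2) ∂((poissonMeasure r).prod (sampleMeasure μ)) =
      ∫ n, ∫ ω, h (sampleCount φ k n ω) ∂sampleMeasure μ ∂poissonMeasure r :=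
    integral_prod _ (integrable_prod_poisson r
      (fun n => hh.comp (measurable_sampleCount φ k n)) (integrable_const C) fun n ω => hC _)
  have hJb : ∀ n, |∫ y, G n y ∂pointMeasure μ| ≤ 2 := fun n => abs_integral_le_of_abs_le (hGb n)
  have hbin := integral_sum_choose_poisson r p₀ hwb
  have hbint := integrable_sum_choose_poisson r hp hwb
  have hmain : |Real.exp (r * p₀) * ∫ n, weightedMean φ μ k q h n ∂poissonMeasure r -
      ∫ p, h (sampleCount φ k p.1 p.2) ∂((poissonMeasure r).prod (sampleMeasure μ))| ≤
      L * ((r : ℝ) ^ k / k.factorial *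
        ∫ y, connProb φ (Finset.range k) y * steinKernel φ μ k r x y ∂pointMeasure μ) := by
    rw [← hbin, hE, ← integral_sub hbint hEint, ← Real.norm_eq_abs]
    refine (norm_integral_le_of_norm_le ((integrable_choose_poisson r k
      (J := fun n => ∫ y, G n y ∂pointMeasure μ) hJb).const_mul L)
      (Eventually.of_forall fun n => hfix n)).trans (le_of_eq ?_)
    rw [integral_const_mul, integral_choose_poisson r k
      (J := fun n => ∫ y, G n y ∂pointMeasure μ) hJb, integral_swap_poisson r hGm hGb]
    simp only [hGint]
  have hexp : Real.exp (-(r * p₀)) * Real.exp (r * p₀) = 1 := by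
    rw [← Real.exp_add]; simp
  have := mul_le_mul_of_nonneg_left hmain (Real.exp_pos (-(r * p₀))).le
  rw [← abs_of_pos (Real.exp_pos (-(r * p₀))), ← abs_mul, mul_sub, ← mul_assoc,
    abs_of_pos (Real.exp_pos (-(r * p₀))), hexp, one_mul] at this
  exact this

lemma overlap_le (k : ℕ) (x y : ℕ → X) : overlap φ μ k x y ≤ 1 - avoidMean φ μ k y := by
  have h1 : 1 - avoidMean φ μ k y = ∫ z, (1 - avoid φ (Finset.range k) y z) ∂μ := by
    rw [integral_sub (integrable_const _) (integrable_avoid φ μ _ y)]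
    simp [avoidMean]
  rw [h1]
  refine integral_mono (integrable_avoid_mul φ μ _ _ x y)
    ((integrable_const _).sub (integrable_avoid φ μ _ y)) fun z => ?_
  exact mul_le_of_le_one_left (sub_nonneg.2 (avoid_le_one _ _ _ _)) (avoid_le_one _ _ _ _)

lemma prod_avoid_nonneg (k : ℕ) (x y : ℕ → X) :
    0 ≤ ∏ i ∈ Finset.range k, avoid φ (Finset.range k) x (y i) :=
  Finset.prod_nonneg fun _ _ => avoid_nonneg φ _ x _

lemma prod_avoid_le_one (k : ℕ) (x y : ℕ → X) :
    ∏ i ∈ Finset.range k, avoid φ (Finset.range k) x (y i) ≤ 1 :=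
  Finset.prod_le_one (fun _ _ => avoid_nonneg φ _ x _) fun _ _ => avoid_le_one φ _ x _

lemma exp_overlap_sub_nonneg (k : ℕ) (r : ℝ≥0) (x y : ℕ → X) :
    0 ≤ Real.exp (-(r * overlap φ μ k x y)) - Real.exp (-(r * (1 - avoidMean φ μ k y))) := by
  rw [sub_nonneg, Real.exp_le_exp, neg_le_neg_iff]
  exact mul_le_mul_of_nonneg_left (overlap_le φ μ k x y) r.2

lemma steinKernel_nonneg (k : ℕ) (r : ℝ≥0) (x y : ℕ → X) : 0 ≤ steinKernel φ μ k r x y :=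
  add_nonneg (mul_nonneg (sub_nonneg.2 (prod_avoid_le_one φ k x y)) (Real.exp_pos _).le)
    (mul_nonneg (prod_avoid_nonneg φ k x y) (exp_overlap_sub_nonneg φ μ k r x y))

lemma exp_neg_mul_le_one (r : ℝ≥0) {t : ℝ} (ht : 0 ≤ t) : Real.exp (-(r * t)) ≤ 1 :=
  Real.exp_le_one_iff.2 (neg_nonpos.2 (mul_nonneg r.2 ht))

lemma steinKernel_le_two (k : ℕ) (r : ℝ≥0) (x y : ℕ → X) : steinKernel φ μ k r x y ≤ 2 := by
  have h1 := exp_neg_mul_le_one r (overlap_nonneg φ μ k x y)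
  have h2 := exp_neg_mul_le_one r (sub_nonneg.2 (avoidMean_le_one φ μ k y))
  have h3 := Real.exp_pos (-(r * (1 - avoidMean φ μ k y)))
  have h4 := exp_overlap_sub_nonneg φ μ k r x y
  have t1 : (1 - ∏ i ∈ Finset.range k, avoid φ (Finset.range k) x (y i)) *
      Real.exp (-(r * (1 - avoidMean φ μ k y))) ≤ 1 :=
    mul_le_one₀ (by linarith [prod_avoid_nonneg φ k x y]) h3.le h2
  have t2 : (∏ i ∈ Finset.range k, avoid φ (Finset.range k) x (y i)) *
      (Real.exp (-(r * overlap φ μ k x y)) - Real.exp (-(r * (1 - avoidMean φ μ k y)))) ≤ 1 :=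
    mul_le_one₀ (prod_avoid_le_one φ k x y) h4 (by linarith)
  unfold steinKernel
  linarith

lemma measurable_overlap (k : ℕ) :
    Measurable fun p : (ℕ → X) × (ℕ → X) => overlap φ μ k p.1 p.2 :=
  measurable_integral_right (F := fun (p : (ℕ → X) × (ℕ → X)) z =>
    avoid φ (Finset.range k) p.1 z * (1 - avoid φ (Finset.range k) p.2 z))
    ((measurable_avoid_comp φ _ (by fun_prop) (by fun_prop)).mul (measurable_const.sub
      (measurable_avoid_comp φ _ (by fun_prop) (by fun_prop))))

lemma measurable_steinKernel (k : ℕ) (r : ℝ≥0) :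
    Measurable fun p : (ℕ → X) × (ℕ → X) => steinKernel φ μ k r p.1 p.2 := by
  have h1 : Measurable fun p : (ℕ → X) × (ℕ → X) =>
      ∏ i ∈ Finset.range k, avoid φ (Finset.range k) p.1 (p.2 i) :=
    Finset.measurable_prod _ fun i _ => measurable_avoid_comp φ _ (by fun_prop) (by fun_prop)
  have h2 : Measurable fun p : (ℕ → X) × (ℕ → X) => avoidMean φ μ k p.2 :=
    (measurable_avoidMean φ μ k).comp measurable_snd
  have h3 := measurable_overlap φ μ k
  have h4 := (h2.const_sub 1).const_mul (r : ℝ) |>.neg.exp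
  exact ((h1.const_sub 1).mul h4).add (h1.mul ((h3.const_mul (r : ℝ)).neg.exp.sub h4))

lemma abs_connProb_le_one (S : Finset ℕ) (y : ℕ → X) : |connProb φ S y| ≤ 1 := by
  rw [abs_of_nonneg (connProb_nonneg _ _ _)]; exact connProb_le_one _ _ _

lemma abs_connProb_mul_steinKernel_le (k : ℕ) (r : ℝ≥0) (x y : ℕ → X) :
    |connProb φ (Finset.range k) y * steinKernel φ μ k r x y| ≤ 2 :=
  abs_mul_le_of_le_one (abs_connProb_le_one φ _ y) (by
    rw [abs_of_nonneg (steinKernel_nonneg φ μ k r x y)]; exact steinKernel_le_two φ μ k r x y)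

lemma abs_exp_le_one (k : ℕ) (r : ℝ≥0) (x : ℕ → X) :
    |Real.exp (-(r * (1 - avoidMean φ μ k x)))| ≤ 1 := by
  rw [abs_of_pos (Real.exp_pos _)]
  exact exp_neg_mul_le_one r (sub_nonneg.2 (avoidMean_le_one φ μ k x))

lemma measurable_exp_avoidMean (k : ℕ) (r : ℝ≥0) :
    Measurable fun x => Real.exp (-(r * (1 - avoidMean φ μ k x))) :=
  ((measurable_avoidMean φ μ k).const_sub 1).const_mul (r : ℝ) |>.neg.exp

lemma measurable_integral_steinKernel (k : ℕ) (r : ℝ≥0) :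
    Measurable fun x => ∫ y, connProb φ (Finset.range k) y * steinKernel φ μ k r x y
      ∂pointMeasure μ :=
  measurable_integral_right (F := fun x y =>
    connProb φ (Finset.range k) y * steinKernel φ μ k r x y)
    (((measurable_connProb φ _).comp measurable_snd).mul (measurable_steinKernel φ μ k r))

lemma integrable_steinError (k : ℕ) (r : ℝ≥0) :
    Integrable (fun x => connProb φ (Finset.range k) x *
      (Real.exp (-(r * (1 - avoidMean φ μ k x))) *
        ∫ y, connProb φ (Finset.range k) y * steinKernel φ μ k r x y ∂pointMeasure μ))
      (pointMeasure μ) :=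
  integrable_of_abs_le ((measurable_connProb φ _).mul ((measurable_exp_avoidMean φ μ k r).mul
    (measurable_integral_steinKernel φ μ k r))) 2 fun x =>
      abs_mul_le_of_le_one (abs_connProb_le_one φ _ x) (abs_mul_le_of_le_one
        (abs_exp_le_one φ μ k r x)
        (abs_integral_le_of_abs_le (abs_connProb_mul_steinKernel_le φ μ k r x)))

lemma integrable_connProb_mul_exp (k : ℕ) (r : ℝ≥0) :
    Integrable (fun y => connProb φ (Finset.range k) y *
      Real.exp (-(r * (1 - avoidMean φ μ k y)))) (pointMeasure μ) :=
  integrable_of_abs_le ((measurable_connProb φ _).mul (measurable_exp_avoidMean φ μ k r)) 1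
    fun y => abs_mul_le_of_le_one (abs_connProb_le_one φ _ y) (abs_exp_le_one φ μ k r y)

/-- The number of components satisfies the equation that characterizes the Poisson law, up to
`steinError`. -/
theorem abs_stein_le (k : ℕ) (r : ℝ≥0) {f : ℝ → ℝ} (hf : Measurable f) {C : ℝ}
    (hC : ∀ w, |f w| ≤ C) {L : ℝ} (hL0 : 0 ≤ L) (hL : ∀ v w, |f v - f w| ≤ L * |v - w|) :
    |∫ p, sampleCount φ k p.1 p.2 * f (sampleCount φ k p.1 p.2)
        ∂((poissonMeasure r).prod (sampleMeasure μ)) -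
      poissonMeanCount φ μ k r * ∫ p, f (1 + sampleCount φ k p.1 p.2)
        ∂((poissonMeasure r).prod (sampleMeasure μ))| ≤ L * steinError φ μ k r := by
  rw [integral_poisson_sampleCount_mul φ μ k r hf hC, poissonMeanCount]
  set E := ∫ p, f (1 + sampleCount φ k p.1 p.2) ∂((poissonMeasure r).prod (sampleMeasure μ))
  have hh : Measurable fun w : ℝ => f (1 + w) := hf.comp (measurable_const.add measurable_id)
  have hdel := fun x => abs_integral_weightedMean_sub_le φ μ k r x hh (fun w => hC (1 + w)) hL0
    fun v w => by simpa using hL (1 + v) (1 + w)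
  have hTm : Measurable fun y => ∫ n, weightedMean φ μ k (avoid φ (Finset.range k) y)
      (fun w => f (1 + w)) n ∂poissonMeasure r :=
    measurable_integral_poisson r fun n =>
      measurable_weightedMean φ μ k n (measurable_avoid φ _) _
  have hTi : Integrable (fun y => connProb φ (Finset.range k) y *
      ∫ n, weightedMean φ μ k (avoid φ (Finset.range k) y) (fun w => f (1 + w)) n
        ∂poissonMeasure r) (pointMeasure μ) :=
    integrable_of_abs_le ((measurable_connProb φ _).mul hTm) C fun y =>
      abs_mul_le_of_le_one (abs_connProb_le_one φ _ y) (abs_integral_le_of_abs_le fun n =>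
        abs_weightedMean_le φ μ k (abs_avoid_le_one φ _ y) (fun w => hC _) n)
  rw [mul_assoc, ← mul_sub, ← integral_mul_const, ← integral_sub hTi
    ((integrable_connProb_mul_exp φ μ k r).mul_const E), abs_mul,
    abs_of_nonneg (by positivity : (0 : ℝ) ≤ (r : ℝ) ^ k / k.factorial), steinError]
  have hle : |∫ y, (connProb φ (Finset.range k) y *
      ∫ n, weightedMean φ μ k (avoid φ (Finset.range k) y) (fun w => f (1 + w)) n
        ∂poissonMeasure r - connProb φ (Finset.range k) y *
      Real.exp (-(r * (1 - avoidMean φ μ k y))) * E) ∂pointMeasure μ| ≤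
      ∫ x, L * ((r : ℝ) ^ k / k.factorial) * (connProb φ (Finset.range k) x *
      (Real.exp (-(r * (1 - avoidMean φ μ k x))) *
        ∫ y, connProb φ (Finset.range k) y * steinKernel φ μ k r x y ∂pointMeasure μ))
        ∂pointMeasure μ := by
    rw [← Real.norm_eq_abs]
    refine norm_integral_le_of_norm_le ((integrable_steinError φ μ k r).const_mul _)
      (Eventually.of_forall fun x => ?_)
    rw [mul_assoc, ← mul_sub, norm_mul, Real.norm_of_nonneg (connProb_nonneg _ _ _)]
    refine (mul_le_mul_of_nonneg_left (hdel x) (connProb_nonneg φ _ x)).trans (le_of_eq ?_)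
    ring
  refine (mul_le_mul_of_nonneg_left hle (by positivity)).trans (le_of_eq ?_)
  rw [integral_const_mul]
  ring

end PoissonStein

/-! ### From the Stein identity to characteristic functions -/

section CharFun

variable {Ω : Type*} [MeasurableSpace Ω] {P : Measure Ω}

lemma norm_cexp_mul_I (t w : ℝ) : ‖Complex.exp (t * w * Complex.I)‖ = 1 := by
  have := Complex.norm_exp_ofReal_mul_I (t * w)
  rwa [Complex.ofReal_mul] at this

lemma cexp_mul_I (t w : ℝ) : Complex.exp (t * w * Complex.I)
    = (Real.cos (t * w) : ℂ) + (Real.sin (t * w) : ℂ) * Complex.I := by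
  rw [← Complex.ofReal_mul, Complex.exp_mul_I, Complex.ofReal_cos, Complex.ofReal_sin]

lemma measurable_cexp_mul_I (t : ℝ) {W : Ω → ℝ} (hW : Measurable W) :
    Measurable fun ω => Complex.exp (t * W ω * Complex.I) := by fun_prop

lemma integrable_cexp_mul_I [IsFiniteMeasure P] (t : ℝ) {W : Ω → ℝ} (hW : Measurable W) :
    Integrable (fun ω => Complex.exp (t * W ω * Complex.I)) P :=
  Integrable.of_bound (measurable_cexp_mul_I t hW).aestronglyMeasurable 1
    (Eventually.of_forall fun ω => (norm_cexp_mul_I t (W ω)).le)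

lemma hasDerivAt_integral_cexp [IsFiniteMeasure P] {W : Ω → ℝ} (hW : Measurable W)
    (hWi : Integrable W P) (t : ℝ) :
    HasDerivAt (fun t : ℝ => ∫ ω, Complex.exp (t * W ω * Complex.I) ∂P)
      (∫ ω, W ω * Complex.I * Complex.exp (t * W ω * Complex.I) ∂P) t := by
  refine (hasDerivAt_integral_of_dominated_loc_of_deriv_le (s := Set.univ)
    (bound := fun ω => |W ω|) (F' := fun (t : ℝ) ω => W ω * Complex.I *
      Complex.exp (t * W ω * Complex.I)) univ_mem
    (Eventually.of_forall fun t => (measurable_cexp_mul_I t hW).aestronglyMeasurable)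
    (integrable_cexp_mul_I t hW) ?_ ?_ hWi.abs ?_).2
  · exact Measurable.aestronglyMeasurable (by fun_prop)
  · refine Eventually.of_forall fun ω t _ => ?_
    rw [norm_mul, norm_cexp_mul_I, norm_mul, Complex.norm_I, Complex.norm_real]
    simp
  · refine Eventually.of_forall fun ω t _ => ?_
    have h : HasDerivAt (fun t : ℝ => (t : ℂ) * W ω * Complex.I) (1 * W ω * Complex.I) t :=
      ((Complex.ofRealCLM.hasDerivAt (x := t)).mul_const _).mul_const _
    refine h.cexp.congr_deriv ?_
    ring

/-- The Stein identity for `cos (t * ·)` and `sin (t * ·)` bounds the defect in the differential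
equation that characterizes the characteristic function of the Poisson law. -/
lemma norm_integral_mul_cexp_sub_le [IsFiniteMeasure P] {W : Ω → ℝ} (hW : Measurable W)
    (hWi : Integrable W P) {α B : ℝ}
    (hS : ∀ (f : ℝ → ℝ) (L : ℝ), Measurable f → (∀ w, |f w| ≤ 1) → 0 ≤ L →
      (∀ v w, |f v - f w| ≤ L * |v - w|) →
      |∫ ω, W ω * f (W ω) ∂P - α * ∫ ω, f (1 + W ω) ∂P| ≤ L * B) (t : ℝ) :
    ‖∫ ω, W ω * Complex.exp (t * W ω * Complex.I) ∂P -
      α * (Complex.exp (t * Complex.I) * ∫ ω, Complex.exp (t * W ω * Complex.I) ∂P)‖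
        ≤ 2 * (|t| * B) := by
  have hc := hS (fun w => Real.cos (t * w)) |t| (by fun_prop) (fun w => Real.abs_cos_le_one _)
    (abs_nonneg t) fun v w => by
      rw [← abs_mul, mul_sub]; exact Real.abs_cos_sub_cos_le _ _
  have hs := hS (fun w => Real.sin (t * w)) |t| (by fun_prop) (fun w => Real.abs_sin_le_one _)
    (abs_nonneg t) fun v w => by
      rw [← abs_mul, mul_sub]; exact Real.abs_sin_sub_sin_le _ _
  have hb : ∀ {g : ℝ → ℝ}, Measurable g → (∀ w, |g w| ≤ 1) →
      Integrable (fun ω => W ω * g (W ω)) P ∧ Integrable (fun ω => g (1 + W ω)) P := by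
    intro g hg hg1
    refine ⟨hWi.mono (hW.mul (hg.comp hW)).aestronglyMeasurable (Eventually.of_forall fun ω => ?_),
      Integrable.of_bound (hg.comp (hW.const_add 1)).aestronglyMeasurable 1
        (Eventually.of_forall fun ω => hg1 _)⟩
    rw [norm_mul]
    exact mul_le_of_le_one_right (norm_nonneg _) (hg1 _)
  obtain ⟨hc1, hc2⟩ := hb (g := fun w => Real.cos (t * w)) (by fun_prop)
    fun w => Real.abs_cos_le_one _
  obtain ⟨hs1, hs2⟩ := hb (g := fun w => Real.sin (t * w)) (by fun_prop)
    fun w => Real.abs_sin_le_one _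
  have h1 : ∫ ω, W ω * Complex.exp (t * W ω * Complex.I) ∂P
      = (∫ ω, W ω * Real.cos (t * W ω) ∂P : ℝ) + (∫ ω, W ω * Real.sin (t * W ω) ∂P : ℝ) *
        Complex.I := by
    rw [← integral_complex_ofReal, ← integral_complex_ofReal, ← integral_mul_const,
      ← integral_add hc1.ofReal (hs1.ofReal.mul_const _)]
    refine integral_congr_ae (Eventually.of_forall fun ω => ?_)
    simp only [cexp_mul_I]
    push_cast
    ring
  have h2 : Complex.exp (t * Complex.I) * ∫ ω, Complex.exp (t * W ω * Complex.I) ∂P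
      = (∫ ω, Real.cos (t * (1 + W ω)) ∂P : ℝ) + (∫ ω, Real.sin (t * (1 + W ω)) ∂P : ℝ) *
        Complex.I := by
    rw [← integral_complex_ofReal, ← integral_complex_ofReal, ← integral_mul_const, ← integral_const_mul,
      ← integral_add hc2.ofReal (hs2.ofReal.mul_const _)]
    refine integral_congr_ae (Eventually.of_forall fun ω => ?_)
    simp only [← Complex.exp_add]
    rw [← cexp_mul_I]
    congr 1
    push_cast
    ring
  rw [h1, h2]
  set a := ∫ ω, W ω * Real.cos (t * W ω) ∂P
  set b := ∫ ω, W ω * Real.sin (t * W ω) ∂P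
  set c := ∫ ω, Real.cos (t * (1 + W ω)) ∂P
  set d := ∫ ω, Real.sin (t * (1 + W ω)) ∂P
  have h3 : (a : ℂ) + b * Complex.I - α * (c + d * Complex.I)
      = ((a - α * c : ℝ) : ℂ) + ((b - α * d : ℝ) : ℂ) * Complex.I := by push_cast; ring
  rw [h3]
  refine (norm_add_le _ _).trans ?_
  rw [norm_mul, Complex.norm_I, mul_one, Complex.norm_real, Complex.norm_real]
  have := add_le_add hc hs
  simp only [Real.norm_eq_abs]
  linarith

/-- Integrating the approximate differential equation for the characteristic function `ψ` of `W`: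
the derivative of `ψ t * exp (-α (exp (it) - 1))` is small. -/
theorem norm_integral_cexp_sub_le [IsProbabilityMeasure P] {W : Ω → ℝ} (hW : Measurable W)
    (hWi : Integrable W P) {α B : ℝ} (hα : 0 ≤ α) (hB : 0 ≤ B)
    (hS : ∀ (f : ℝ → ℝ) (L : ℝ), Measurable f → (∀ w, |f w| ≤ 1) → 0 ≤ L →
      (∀ v w, |f v - f w| ≤ L * |v - w|) →
      |∫ ω, W ω * f (W ω) ∂P - α * ∫ ω, f (1 + W ω) ∂P| ≤ L * B) (t : ℝ) :
    ‖∫ ω, Complex.exp (t * W ω * Complex.I) ∂P -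
      Complex.exp (α * (Complex.exp (t * Complex.I) - 1))‖
        ≤ 2 * (t ^ 2 * B) * Real.exp (α * t ^ 2 / 2) := by
  set ψ : ℝ → ℂ := fun t => ∫ ω, Complex.exp (t * W ω * Complex.I) ∂P with hψ
  have hre : ∀ u : ℝ, (α * (Complex.exp (u * Complex.I) - 1) : ℂ).re = α * (Real.cos u - 1) := by
    intro u
    rw [Complex.re_ofReal_mul, Complex.sub_re, Complex.exp_ofReal_mul_I_re, Complex.one_re]
  have hd : ∀ u : ℝ, HasDerivAt
      (fun u : ℝ => ψ u * Complex.exp (-(α * (Complex.exp (u * Complex.I) - 1))))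
      (Complex.I * (∫ ω, W ω * Complex.exp (u * W ω * Complex.I) ∂P -
        α * (Complex.exp (u * Complex.I) * ψ u)) *
          Complex.exp (-(α * (Complex.exp (u * Complex.I) - 1)))) u := by
    intro u
    have h1 : HasDerivAt (fun u : ℝ => (u : ℂ) * Complex.I) (1 * Complex.I) u :=
      (Complex.ofRealCLM.hasDerivAt (x := u)).mul_const _
    have h2 : HasDerivAt
        (fun u : ℝ => Complex.exp (-(α * (Complex.exp (u * Complex.I) - 1))))
        (Complex.exp (-(α * (Complex.exp (u * Complex.I) - 1))) *
          -(α * (Complex.exp (u * Complex.I) * (1 * Complex.I)))) u :=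
      (((h1.cexp.sub_const 1).const_mul (α : ℂ)).neg).cexp
    refine ((hasDerivAt_integral_cexp hW hWi u).mul h2).congr_deriv ?_
    have h3 : ∫ ω, W ω * Complex.I * Complex.exp (u * W ω * Complex.I) ∂P
        = Complex.I * ∫ ω, W ω * Complex.exp (u * W ω * Complex.I) ∂P := by
      rw [← integral_const_mul]
      refine integral_congr_ae (Eventually.of_forall fun ω => ?_)
      ring
    rw [h3]
    simp only [hψ]
    ring
  have hbd : ∀ u ∈ Set.uIcc 0 t,
      ‖Complex.I * (∫ ω, W ω * Complex.exp (u * W ω * Complex.I) ∂P -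
        α * (Complex.exp (u * Complex.I) * ψ u)) *
          Complex.exp (-(α * (Complex.exp (u * Complex.I) - 1)))‖
        ≤ 2 * (|t| * B) * Real.exp (α * t ^ 2 / 2) := by
    intro u hu
    have hut : |u| ≤ |t| := by
      have := Set.abs_sub_left_of_mem_uIcc hu
      simpa using this
    rw [norm_mul, norm_mul, Complex.norm_I, one_mul, Complex.norm_exp, Complex.neg_re, hre]
    refine mul_le_mul ((norm_integral_mul_cexp_sub_le hW hWi hS u).trans (by gcongr))
      (Real.exp_le_exp.2 ?_) (Real.exp_pos _).le (by positivity)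
    have h1 := Real.one_sub_sq_div_two_le_cos (x := u)
    have h2 : u ^ 2 ≤ t ^ 2 := sq_le_sq.2 hut
    nlinarith
  have hmv := (convex_uIcc 0 t).norm_image_sub_le_of_norm_hasDerivWithin_le
    (fun u _ => (hd u).hasDerivWithinAt) hbd Set.left_mem_uIcc Set.right_mem_uIcc
  have h0 : ψ 0 = 1 := by simp [hψ]
  simp only [h0, Complex.ofReal_zero, zero_mul, Complex.exp_zero, sub_self, mul_zero, neg_zero,
    mul_one, sub_zero] at hmv
  have hfac : ψ t - Complex.exp (α * (Complex.exp (t * Complex.I) - 1))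
      = (ψ t * Complex.exp (-(α * (Complex.exp (t * Complex.I) - 1))) - 1) *
        Complex.exp (α * (Complex.exp (t * Complex.I) - 1)) := by
    rw [sub_mul, mul_assoc, ← Complex.exp_add, neg_add_cancel, Complex.exp_zero, mul_one, one_mul]
  have hle : ‖Complex.exp (α * (Complex.exp (t * Complex.I) - 1))‖ ≤ 1 := by
    rw [Complex.norm_exp, hre, Real.exp_le_one_iff]
    exact mul_nonpos_of_nonneg_of_nonpos hα (sub_nonpos.2 (Real.cos_le_one t))
  rw [hfac, norm_mul]
  refine (mul_le_of_le_one_right (norm_nonneg _) hle).trans (hmv.trans (le_of_eq ?_))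
  rw [Real.norm_eq_abs, ← sq_abs t]
  ring

end CharFun

section Levy

variable {ι : Type*} {l : Filter ι} [l.IsCountablyGenerated] {Ω : ι → Type*}
  [∀ i, MeasurableSpace (Ω i)] {P : (i : ι) → Measure (Ω i)} [∀ i, IsProbabilityMeasure (P i)]

/-- Lévy's continuity theorem along a countably generated filter. -/
theorem tendstoInDistribution_of_charFun {Y : (i : ι) → Ω i → ℝ} (hY : ∀ i, Measurable (Y i))
    (ν : Measure ℝ) [IsProbabilityMeasure ν]
    (h : ∀ t : ℝ, Tendsto (fun i => ∫ ω, Complex.exp (t * Y i ω * Complex.I) ∂P i) l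
      (𝓝 (charFun ν t))) :
    TendstoInDistribution Y l (id : ℝ → ℝ) P ν where
  forall_aemeasurable i := (hY i).aemeasurable
  aemeasurable_limit := aemeasurable_id
  tendsto := by
    refine tendsto_of_seq_tendsto fun u hu => ?_
    refine ProbabilityMeasure.tendsto_of_tendsto_charFun fun t => ?_
    have hlim : charFun (ν.map id) t = charFun ν t := by rw [Measure.map_id]
    have hseq : ∀ i, ∫ ω, Complex.exp (t * Y i ω * Complex.I) ∂P i
        = charFun ((P i).map (Y i)) t := fun i => by
      rw [charFun_apply_real, integral_map (hY i).aemeasurable (by fun_prop)]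
    have := (h t).comp hu
    rw [← hlim] at this
    exact this.congr fun n => hseq (u n)

/-- Convergence in distribution of integer variables follows from that of the corresponding real
variables, as a bounded function on `ℕ` is the restriction of a bounded continuous function
on `ℝ`. -/
theorem tendstoInDistribution_nat_of_charFun {Y : (i : ι) → Ω i → ℕ}
    (hY : ∀ i, Measurable (Y i)) (ν : Measure ℕ) [IsProbabilityMeasure ν]
    (h : ∀ t : ℝ, Tendsto (fun i => ∫ ω, Complex.exp (t * (Y i ω : ℝ) * Complex.I) ∂P i) l
      (𝓝 (charFun (ν.map (Nat.cast : ℕ → ℝ)) t))) :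
    TendstoInDistribution Y l (id : ℕ → ℕ) P ν where
  forall_aemeasurable i := (hY i).aemeasurable
  aemeasurable_limit := aemeasurable_id
  tendsto := by
    have hc : Measurable (Nat.cast : ℕ → ℝ) := Measurable.of_discrete
    have : IsProbabilityMeasure (ν.map (Nat.cast : ℕ → ℝ)) :=
      Measure.isProbabilityMeasure_map hc.aemeasurable
    have hR := (tendstoInDistribution_of_charFun (Y := fun i ω => (Y i ω : ℝ))
      (fun i => hc.comp (hY i)) (ν.map (Nat.cast : ℕ → ℝ)) h).tendsto
    refine ProbabilityMeasure.tendsto_iff_forall_integral_tendsto.2 fun f => ?_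
    obtain ⟨g, -, hg⟩ := f.exists_extension_norm_eq_of_isClosedEmbedding
      Nat.isClosedEmbedding_coe_real
    have hgf : ∀ n : ℕ, g n = f n := fun n => congrFun hg n
    have hg' := ProbabilityMeasure.tendsto_iff_forall_integral_tendsto.1 hR g
    have hlim : ∫ x, g x ∂((ν.map (Nat.cast : ℕ → ℝ)).map id) = ∫ n, f n ∂(ν.map id) := by
      rw [Measure.map_id, Measure.map_id,
        integral_map hc.aemeasurable g.continuous.measurable.aestronglyMeasurable]
      simp only [hgf]
    have hseq : ∀ i, ∫ x, g x ∂((P i).map fun ω => (Y i ω : ℝ)) = ∫ n, f n ∂((P i).map (Y i)) := by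
      intro i
      rw [integral_map (φ := fun ω => (Y i ω : ℝ)) (hc.comp (hY i)).aemeasurable
          g.continuous.measurable.aestronglyMeasurable,
        integral_map (hY i).aemeasurable f.continuous.measurable.aestronglyMeasurable]
      simp only [hgf]
    exact (hg'.congr hseq).trans (le_of_eq (congrArg 𝓝 hlim))

end Levy

/-! ### Limit theorems under a small Stein error -/

section LimitTheorems

variable {X : Type*} [MeasurableSpace X]

lemma measurable_of_measurable_natCast {Ω : Type*} [MeasurableSpace Ω] {Y : Ω → ℕ}
    (h : Measurable fun ω => (Y ω : ℝ)) : Measurable Y :=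
  (Nat.isClosedEmbedding_coe_real.measurableEmbedding.measurable_comp_iff).1 h

lemma componentCount_poissonGraph (φ : ConnectionFunction X) (k : ℕ)
    (ω : ℕ × (ℕ → X) × (Sym2 ℕ → unitInterval)) :
    (componentCount k (poissonGraph φ ω) : ℝ) = sampleCount φ k ω.1 ω.2 :=
  componentCount_markedGraph φ k ω.1 ω.2.1 ω.2.2

lemma componentCount_binomialGraph (φ : ConnectionFunction X) (k n : ℕ)
    (ω : (ℕ → X) × (Sym2 ℕ → unitInterval)) :
    (componentCount k (binomialGraph φ n ω) : ℝ) = sampleCount φ k n ω :=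
  componentCount_markedGraph φ k n ω.1 ω.2

lemma measurable_componentCount_poissonGraph (φ : ConnectionFunction X) (k : ℕ) :
    Measurable fun ω => componentCount k (poissonGraph φ ω) :=
  measurable_of_measurable_natCast (by
    simp only [componentCount_poissonGraph]
    exact measurable_uncurry_nat (measurable_sampleCount φ k))

lemma measurable_componentCount_binomialGraph (φ : ConnectionFunction X) (k n : ℕ) :
    Measurable fun ω => componentCount k (binomialGraph φ n ω) :=
  measurable_of_measurable_natCast (by
    simp only [componentCount_binomialGraph]
    exact measurable_sampleCount φ k n)

variable (μ : Measure X) [IsProbabilityMeasure μ]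

lemma expectedCount_eq (φ : ConnectionFunction X) (k : ℕ) (s : ℝ) :
    expectedCount μ k s φ = poissonMeanCount φ μ k s.toNNReal := by
  rw [poissonMeanCount_eq_integral, expectedCount]
  simp only [componentCount_poissonGraph]
  rfl

lemma poissonMeanCount_nonneg (φ : ConnectionFunction X) (k : ℕ) (r : ℝ≥0) :
    0 ≤ poissonMeanCount φ μ k r :=
  mul_nonneg (by positivity) (integral_nonneg fun y =>
    mul_nonneg (connProb_nonneg φ _ y) (Real.exp_pos _).le)

lemma steinError_nonneg (φ : ConnectionFunction X) (k : ℕ) (r : ℝ≥0) :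
    0 ≤ steinError φ μ k r :=
  mul_nonneg (by positivity) (integral_nonneg fun x => mul_nonneg (connProb_nonneg φ _ x)
    (mul_nonneg (Real.exp_pos _).le (integral_nonneg fun y =>
      mul_nonneg (connProb_nonneg φ _ y) (steinKernel_nonneg φ μ k r x y))))

/-- The characteristic function of the number of components is close to that of a Poisson law. -/
theorem norm_integral_cexp_sampleCount_sub_le (φ : ConnectionFunction X) (k : ℕ) (r : ℝ≥0)
    (t : ℝ) :
    ‖∫ p, Complex.exp (t * sampleCount φ k p.1 p.2 * Complex.I)
        ∂((poissonMeasure r).prod (sampleMeasure μ)) -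
      Complex.exp (poissonMeanCount φ μ k r * (Complex.exp (t * Complex.I) - 1))‖
        ≤ 2 * (t ^ 2 * steinError φ μ k r) * Real.exp (poissonMeanCount φ μ k r * t ^ 2 / 2) :=
  norm_integral_cexp_sub_le (P := (poissonMeasure r).prod (sampleMeasure μ))
    (W := fun p => sampleCount φ k p.1 p.2)
    (measurable_uncurry_nat (measurable_sampleCount φ k))
    (integrable_prod_poisson r (measurable_sampleCount φ k) (integrable_choose_poisson_const r k)
      (abs_sampleCount_le φ k))
    (poissonMeanCount_nonneg μ φ k r) (steinError_nonneg μ φ k r)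
    (fun _ _ hf h1 hL hLip => abs_stein_le φ μ k r hf h1 hL hLip) t

variable {φ : ℝ → ConnectionFunction X} {k : ℕ}

lemma tendsto_integral_cexp_sampleCount {α : ℝ≥0}
    (hα : Tendsto (fun s : ℝ => expectedCount μ k s (φ s)) atTop (𝓝 (α : ℝ)))
    (hB : Tendsto (fun s : ℝ => steinError (φ s) μ k s.toNNReal) atTop (𝓝 0)) (t : ℝ) :
    Tendsto (fun s : ℝ => ∫ ω, Complex.exp (t * sampleCount (φ s) k ω.1 ω.2 * Complex.I)
        ∂poissonSampleMeasure μ s) atTop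
      (𝓝 (charFun ((poissonMeasure α).map (Nat.cast : ℕ → ℝ)) t)) := by
  rw [charFun_map_cast_poissonMeasure]
  simp only [expectedCount_eq] at hα
  have h1 : Tendsto (fun s : ℝ => Complex.exp (poissonMeanCount (φ s) μ k s.toNNReal *
      (Complex.exp (t * Complex.I) - 1))) atTop
      (𝓝 (Complex.exp (α * (Complex.exp (t * Complex.I) - 1)))) :=
    (Complex.continuous_exp.tendsto _).comp
      (((Complex.continuous_ofReal.tendsto _).comp hα).mul_const _)
  have h2 : Tendsto (fun s : ℝ => 2 * (t ^ 2 * steinError (φ s) μ k s.toNNReal) *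
      Real.exp (poissonMeanCount (φ s) μ k s.toNNReal * t ^ 2 / 2)) atTop
      (𝓝 (2 * (t ^ 2 * 0) * Real.exp (α * t ^ 2 / 2))) :=
    ((hB.const_mul _).const_mul 2).mul
      ((Real.continuous_exp.tendsto _).comp ((hα.mul_const _).div_const 2))
  simp only [mul_zero, zero_mul] at h2
  have h3 := squeeze_zero_norm
    (fun s : ℝ => norm_integral_cexp_sampleCount_sub_le μ (φ s) k s.toNNReal t) h2
  have h4 := h3.add h1
  rw [zero_add] at h4
  exact h4.congr fun s => sub_add_cancel _ _

theorem tendstoInDistribution_poisson {α : ℝ≥0}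
    (hα : Tendsto (fun s : ℝ => expectedCount μ k s (φ s)) atTop (𝓝 (α : ℝ)))
    (hB : Tendsto (fun s : ℝ => steinError (φ s) μ k s.toNNReal) atTop (𝓝 0)) :
    TendstoInDistribution
      (fun (s : ℝ) ω => componentCount k (poissonGraph (φ s) ω))
      atTop (id : ℕ → ℕ) (fun s : ℝ => poissonSampleMeasure μ s) (poissonMeasure α) :=
  tendstoInDistribution_nat_of_charFun
    (fun s => measurable_componentCount_poissonGraph (φ s) k) _ fun t => by
      simp only [componentCount_poissonGraph]
      exact tendsto_integral_cexp_sampleCount μ hα hB t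

/-- The characteristic function of a standardized Poisson variable tends to that of the standard
normal law. -/
lemma tendsto_mul_cexp_sub {ι : Type*} {l : Filter ι} {a : ι → ℝ} (ha : Tendsto a l atTop)
    (t : ℝ) :
    Tendsto (fun i => Complex.exp (a i * (Complex.exp ((t / √(a i) : ℝ) * Complex.I) - 1) -
      (t * √(a i) : ℝ) * Complex.I)) l (𝓝 (Complex.exp (-(t ^ 2 / 2)))) := by
  refine (Complex.continuous_exp.tendsto _).comp ?_
  have hsq : Tendsto (fun i => √(a i)) l atTop := Real.tendsto_sqrt_atTop.comp ha
  have h0 : Tendsto (fun i => |t| / √(a i)) l (𝓝 0) := tendsto_const_nhds.div_atTop hsq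
  have hbd : ∀ᶠ i in l, ‖(a i * (Complex.exp ((t / √(a i) : ℝ) * Complex.I) - 1) -
      (t * √(a i) : ℝ) * Complex.I) - (-(t ^ 2 / 2) : ℂ)‖ ≤
        t ^ 2 * (|t| / √(a i) * Real.exp (|t| / √(a i))) := by
    filter_upwards [ha.eventually_gt_atTop 0] with i hi
    have hs : 0 < √(a i) := Real.sqrt_pos.2 hi
    have hsa : √(a i) ^ 2 = a i := Real.sq_sqrt hi.le
    have hb := Complex.norm_exp_sub_sum_le_norm_mul_exp ((t / √(a i) : ℝ) * Complex.I) 3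
    have hz : ‖((t / √(a i) : ℝ) : ℂ) * Complex.I‖ = |t| / √(a i) := by
      rw [norm_mul, Complex.norm_I, mul_one, Complex.norm_real, Real.norm_eq_abs, abs_div,
        abs_of_pos hs]
    rw [hz] at hb
    have hid : (a i * (Complex.exp ((t / √(a i) : ℝ) * Complex.I) - 1) -
        (t * √(a i) : ℝ) * Complex.I) - (-(t ^ 2 / 2) : ℂ) =
        (a i : ℂ) * (Complex.exp ((t / √(a i) : ℝ) * Complex.I) -
          ∑ m ∈ Finset.range 3, ((t / √(a i) : ℝ) * Complex.I) ^ m / (m.factorial : ℂ)) := by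
      have hs' : ((√(a i) : ℝ) : ℂ) ≠ 0 := Complex.ofReal_ne_zero.2 hs.ne'
      have hI := Complex.I_sq
      have ha' : (a i : ℂ) = ((√(a i) : ℝ) : ℂ) ^ 2 := by rw [← Complex.ofReal_pow, hsa]
      rw [ha']
      simp only [Finset.sum_range_succ, Finset.sum_range_zero, Nat.factorial]
      push_cast
      field_simp
      rw [hI]
      ring
    rw [hid, norm_mul, Complex.norm_real, Real.norm_eq_abs, abs_of_pos hi]
    refine (mul_le_mul_of_nonneg_left hb hi.le).trans (le_of_eq ?_)
    rw [← hsa, Real.sqrt_sq hs.le, ← sq_abs t]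
    field_simp
  have h1 : Tendsto (fun i => t ^ 2 * (|t| / √(a i) * Real.exp (|t| / √(a i)))) l (𝓝 0) := by
    simpa using (h0.mul ((Real.continuous_exp.tendsto _).comp h0)).const_mul (t ^ 2)
  have h2 := squeeze_zero_norm' hbd h1
  have h3 := h2.add_const (-(t ^ 2 / 2) : ℂ)
  rw [zero_add] at h3
  exact h3.congr fun i => sub_add_cancel _ _

theorem tendstoInDistribution_gaussian
    (hα : Tendsto (fun s : ℝ => expectedCount μ k s (φ s)) atTop atTop)
    (hB : Tendsto (fun s : ℝ => steinError (φ s) μ k s.toNNReal / expectedCount μ k s (φ s))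
      atTop (𝓝 0)) :
    TendstoInDistribution
      (fun (s : ℝ) ω => ((componentCount k (poissonGraph (φ s) ω) : ℝ) -
        expectedCount μ k s (φ s)) / √(expectedCount μ k s (φ s)))
      atTop (id : ℝ → ℝ) (fun s : ℝ => poissonSampleMeasure μ s) (gaussianReal 0 1) := by
  have hmeas : ∀ s : ℝ, Measurable fun ω : ℕ × (ℕ → X) × (Sym2 ℕ → unitInterval) =>
      sampleCount (φ s) k ω.1 ω.2 := fun s => measurable_uncurry_nat (measurable_sampleCount (φ s) k)
  refine tendstoInDistribution_of_charFun (fun s => ?_) _ fun t => ?_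
  · simp only [componentCount_poissonGraph]
    exact ((hmeas s).sub_const _).div_const _
  simp only [componentCount_poissonGraph, charFun_gaussianReal]
  have hlim := tendsto_mul_cexp_sub hα t
  have hbd : ∀ᶠ s : ℝ in atTop, ‖(∫ ω, Complex.exp (t *
      ((sampleCount (φ s) k ω.1 ω.2 - expectedCount μ k s (φ s)) /
        √(expectedCount μ k s (φ s)) : ℝ) * Complex.I) ∂poissonSampleMeasure μ s) -
      Complex.exp (expectedCount μ k s (φ s) *
        (Complex.exp ((t / √(expectedCount μ k s (φ s)) : ℝ) * Complex.I) - 1) -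
      (t * √(expectedCount μ k s (φ s)) : ℝ) * Complex.I)‖ ≤
      2 * t ^ 2 * Real.exp (t ^ 2 / 2) *
        (steinError (φ s) μ k s.toNNReal / expectedCount μ k s (φ s)) := by
    filter_upwards [hα.eventually_gt_atTop 0] with s hs
    set a := expectedCount μ k s (φ s) with ha
    have hsq : 0 < √a := Real.sqrt_pos.2 hs
    have hsa : √a ^ 2 = a := Real.sq_sqrt hs.le
    have hb := norm_integral_cexp_sampleCount_sub_le μ (φ s) k s.toNNReal (t / √a)
    rw [← expectedCount_eq, ← ha] at hb
    have h1 : ∀ w : ℝ, Complex.exp (t * ((w - a) / √a : ℝ) * Complex.I) =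
        Complex.exp (-(t * √a : ℝ) * Complex.I) *
          Complex.exp ((t / √a : ℝ) * w * Complex.I) := by
      intro w
      rw [← Complex.exp_add]
      congr 1
      have hs' : ((√a : ℝ) : ℂ) ≠ 0 := Complex.ofReal_ne_zero.2 hsq.ne'
      have ha' : (a : ℂ) = ((√a : ℝ) : ℂ) ^ 2 := by rw [← Complex.ofReal_pow, hsa]
      push_cast
      rw [ha']
      field_simp
      ring
    simp only [h1]
    rw [integral_const_mul, sub_eq_add_neg _ (((t * √a : ℝ) : ℂ) * Complex.I), add_comm _ (-_),
      Complex.exp_add, ← neg_mul, ← mul_sub, norm_mul]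
    have h2 : ‖Complex.exp (-(t * √a : ℝ) * Complex.I)‖ = 1 := by
      rw [← Complex.ofReal_neg, Complex.norm_exp_ofReal_mul_I]
    rw [h2, one_mul]
    refine hb.trans (le_of_eq ?_)
    rw [div_pow, hsa]
    field_simp
  have h0 : Tendsto (fun s : ℝ => 2 * t ^ 2 * Real.exp (t ^ 2 / 2) *
      (steinError (φ s) μ k s.toNNReal / expectedCount μ k s (φ s))) atTop (𝓝 0) := by
    simpa using hB.const_mul (2 * t ^ 2 * Real.exp (t ^ 2 / 2))
  have h := (squeeze_zero_norm' hbd h0).add hlim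
  have hg : Complex.exp (t * (0 : ℝ) * Complex.I - (1 : ℝ≥0) * t ^ 2 / 2)
      = 0 + Complex.exp (-(t ^ 2 / 2)) := by
    rw [zero_add]
    congr 1
    push_cast
    ring
  rw [show Complex.exp (t * (0 : ℝ) * Complex.I - ((1 : ℝ≥0) : ℝ) * t ^ 2 / 2)
      = 0 + Complex.exp (-(t ^ 2 / 2)) from hg]
  exact h.congr fun s => sub_add_cancel _ _

end LimitTheorems

/-! ### Bounds for the connection and avoidance probabilities -/

section Bounds

variable {X : Type*} [MeasurableSpace X] (φ : ConnectionFunction X)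

lemma one_sub_prod_one_sub_le {ι : Type*} (s : Finset ι) {f : ι → ℝ} (h0 : ∀ i, 0 ≤ f i)
    (h1 : ∀ i, f i ≤ 1) : 1 - ∏ i ∈ s, (1 - f i) ≤ ∑ i ∈ s, f i := by
  classical
  induction s using Finset.induction_on with
  | empty => simp
  | insert a s ha ih =>
    rw [Finset.prod_insert ha, Finset.sum_insert ha]
    have hp : ∏ i ∈ s, (1 - f i) ≤ 1 :=
      Finset.prod_le_one (fun i _ => sub_nonneg.2 (h1 i)) fun i _ => sub_le_self _ (h0 i)
    nlinarith [h0 a, mul_le_of_le_one_right (h0 a) hp]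

lemma one_sub_avoid_le (S : Finset ℕ) (y : ℕ → X) (z : X) :
    1 - avoid φ S y z ≤ ∑ i ∈ S, φ (y i) z :=
  one_sub_prod_one_sub_le S (fun _ => φ.nonneg' _ _) fun _ => φ.le_one' _ _

lemma one_sub_prod_avoid_le (k : ℕ) (x y : ℕ → X) :
    1 - ∏ i ∈ Finset.range k, avoid φ (Finset.range k) x (y i) ≤
      ∑ i ∈ Finset.range k, ∑ j ∈ Finset.range k, φ (x j) (y i) := by
  have h := one_sub_prod_one_sub_le (Finset.range k)
    (f := fun i => 1 - avoid φ (Finset.range k) x (y i))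
    (fun i => sub_nonneg.2 (avoid_le_one φ _ x _)) fun i => sub_le_self _ (avoid_nonneg φ _ x _)
  simp only [sub_sub_cancel] at h
  exact h.trans (Finset.sum_le_sum fun i _ => one_sub_avoid_le φ _ x (y i))

lemma le_one_sub_avoid {S : Finset ℕ} {i : ℕ} (hi : i ∈ S) (y : ℕ → X) (z : X) :
    φ (y i) z ≤ 1 - avoid φ S y z := by
  have h : avoid φ S y z ≤ 1 - φ (y i) z := by
    unfold avoid
    rw [← Finset.mul_prod_erase S _ hi]
    exact mul_le_of_le_one_right (sub_nonneg.2 (φ.le_one' _ _))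
      (Finset.prod_le_one (fun _ _ => sub_nonneg.2 (φ.le_one' _ _))
        fun _ _ => sub_le_self _ (φ.nonneg' _ _))
  linarith

lemma le_avoid {δ : ℝ} (hδ0 : 0 ≤ δ) (hδ : ∀ x y, φ x y ≤ 1 - δ) (S : Finset ℕ) (y : ℕ → X)
    (z : X) : δ ^ S.card ≤ avoid φ S y z := by
  rw [← Finset.prod_const]
  exact Finset.prod_le_prod (fun _ _ => hδ0) fun i _ => by linarith [hδ (y i) z]

variable (μ : Measure X) [IsProbabilityMeasure μ]

lemma measurable_connection_right (x : X) : Measurable fun z => φ x z :=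
  φ.measurable_comp measurable_const measurable_id

lemma abs_connection_le_one (x z : X) : |φ x z| ≤ 1 := by
  rw [abs_of_nonneg (φ.nonneg' x z)]; exact φ.le_one' x z

lemma integrable_connection (x : X) : Integrable (fun z => φ x z) μ :=
  integrable_of_abs_le (measurable_connection_right φ x) 1 (abs_connection_le_one φ x)

lemma measurable_integral_connection : Measurable fun x => ∫ z, φ x z ∂μ :=
  measurable_integral_right φ.measurable'

lemma integrable_one_sub_avoid (S : Finset ℕ) (y : ℕ → X) :
    Integrable (fun z => 1 - avoid φ S y z) μ :=
  (integrable_const 1).sub (integrable_avoid φ μ S y)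

lemma one_sub_avoidMean_eq (k : ℕ) (y : ℕ → X) :
    1 - avoidMean φ μ k y = ∫ z, (1 - avoid φ (Finset.range k) y z) ∂μ := by
  rw [integral_sub (integrable_const 1) (integrable_avoid φ μ _ y)]
  simp [avoidMean]

lemma one_sub_avoidMean_le_sum (k : ℕ) (y : ℕ → X) :
    1 - avoidMean φ μ k y ≤ ∑ i ∈ Finset.range k, ∫ z, φ (y i) z ∂μ := by
  rw [one_sub_avoidMean_eq, ← integral_finsetSum _ fun i _ => integrable_connection φ μ (y i)]
  exact integral_mono (integrable_one_sub_avoid φ μ _ y)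
    (integrable_finsetSum _ fun i _ => integrable_connection φ μ (y i))
    fun z => one_sub_avoid_le φ _ y z

lemma one_sub_avoidMean_le {M : ℝ} (hM : ∀ x, ∫ z, φ x z ∂μ ≤ M) (k : ℕ) (y : ℕ → X) :
    1 - avoidMean φ μ k y ≤ k * M := by
  refine (one_sub_avoidMean_le_sum φ μ k y).trans ((Finset.sum_le_sum fun i _ => hM (y i)).trans ?_)
  simp

lemma le_one_sub_avoidMean {m : ℝ} (hm : ∀ x, m ≤ ∫ z, φ x z ∂μ) {k : ℕ} (hk : 1 ≤ k)
    (y : ℕ → X) : m ≤ 1 - avoidMean φ μ k y := by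
  rw [one_sub_avoidMean_eq]
  exact (hm (y 0)).trans (integral_mono (integrable_connection φ μ _)
    (integrable_one_sub_avoid φ μ _ y)
    fun z => le_one_sub_avoid φ (Finset.mem_range.2 hk) y z)

lemma mul_le_overlap {δ : ℝ} (hδ0 : 0 ≤ δ) (hδ : ∀ x y, φ x y ≤ 1 - δ) (k : ℕ) (x y : ℕ → X) :
    δ ^ k * (1 - avoidMean φ μ k y) ≤ overlap φ μ k x y := by
  rw [one_sub_avoidMean_eq, ← integral_const_mul]
  refine integral_mono ((integrable_one_sub_avoid φ μ _ y).const_mul _)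
    (integrable_avoid_mul φ μ _ _ x y) fun z => ?_
  have h := le_avoid φ hδ0 hδ (Finset.range k) x z
  rw [Finset.card_range] at h
  exact mul_le_mul_of_nonneg_right h (sub_nonneg.2 (avoid_le_one φ _ y z))

lemma one_sub_avoidMean_sub_overlap (k : ℕ) (x y : ℕ → X) :
    1 - avoidMean φ μ k y - overlap φ μ k x y =
      ∫ z, (1 - avoid φ (Finset.range k) x z) * (1 - avoid φ (Finset.range k) y z) ∂μ := by
  rw [one_sub_avoidMean_eq, overlap, ← integral_sub (integrable_one_sub_avoid φ μ _ y)
    (integrable_avoid_mul φ μ _ _ x y)]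
  refine integral_congr_ae (Eventually.of_forall fun z => ?_)
  ring

/-- Integrating out the point `v`. -/
lemma integral_eq_integral_update {F : (ℕ → X) → ℝ} (hF : Measurable F) {C : ℝ}
    (hC : ∀ y, |F y| ≤ C) (v : ℕ) :
    ∫ y, F y ∂pointMeasure μ = ∫ y, ∫ z, F (Function.update y v z) ∂μ ∂pointMeasure μ := by
  have hT := measurePreserving_update (ν := μ) v
  rw [← integral_comp_of_measurePreserving hT hF, integral_prod_symm]
  exact integrable_of_abs_le (hF.comp hT.measurable) C fun p => hC _

lemma connProb_le_sum_erase {S : Finset ℕ} (hS : 2 ≤ S.card) (y : ℕ → X) :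
    connProb φ S y ≤ ∑ v ∈ S, ∑ w ∈ S.erase v, connProb φ (S.erase v) y * φ (y v) (y w) := by
  have hconn : ∀ T : Finset ℕ, Measurable fun u => connInd (pointGraph φ y u) T := fun T =>
    (isLocal_connInd T).measurable_right φ y
  have hadj : ∀ v w, Measurable fun u => adjInd (pointGraph φ y u) v w := fun v w =>
    (isLocal_adjInd v w).measurable_right φ y
  have hint : ∀ v w, Integrable (fun u => connInd (pointGraph φ y u) (S.erase v) *
      adjInd (pointGraph φ y u) v w) markMeasure := fun v w =>
    integrable_of_abs_le ((hconn _).mul (hadj v w)) 1 fun u => by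
      rw [abs_of_nonneg (mul_nonneg (connInd_nonneg _ _) (adjInd_nonneg _ _ _))]
      exact mul_le_one₀ (connInd_le_one _ _) (adjInd_nonneg _ _ _) (adjInd_le_one _ _ _)
  have heq : ∀ v ∈ S, ∀ w ∈ S.erase v, ∫ u, connInd (pointGraph φ y u) (S.erase v) *
      adjInd (pointGraph φ y u) v w ∂markMeasure = connProb φ (S.erase v) y * φ (y v) (y w) := by
    intro v _ w hw
    rw [integral_mul_of_dependsOn (F := fun u => connInd (pointGraph φ y u) (S.erase v))
      (H := fun u => adjInd (pointGraph φ y u) v w) (hconn _) (hadj v w)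
      ((isLocal_connInd (S.erase v)).dependsOn φ y) (dependsOn_adjInd φ v w y) ?_,
      integral_adjInd φ (Finset.ne_of_mem_erase hw).symm, connProb]
    rw [Set.disjoint_singleton_right]
    intro h
    exact absurd (h v (Sym2.mem_mk_left v w)) (Finset.notMem_erase v S)
  rw [← Finset.sum_congr rfl fun v hv => Finset.sum_congr rfl (heq v hv),
    ← Finset.sum_congr rfl fun v _ => integral_finsetSum (S.erase v) fun w _ => hint v w,
    ← integral_finsetSum _ fun v _ => integrable_finsetSum _ fun w _ => hint v w]
  exact integral_mono (integrable_of_abs_le (hconn S) 1 fun u => by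
      rw [abs_of_nonneg (connInd_nonneg _ _)]; exact connInd_le_one _ _)
    (integrable_finsetSum _ fun v _ => integrable_finsetSum _ fun w _ => hint v w)
    fun u => connInd_le_sum_erase _ hS

/-- The number of ways to remove the vertices of a set of `n` vertices one by one, until a single one
is left, while recording one of the remaining vertices at each step. -/
def treeConst (n : ℕ) : ℕ := n.factorial * (n - 1).factorial

/-- The probability that `n` random points form a connected graph is at most of order `M ^ (n - 1)`
if `M` bounds the mean degree. The weight `ψ` at one of the points is needed for the induction, in
which a non-cut vertex is integrated out. -/
theorem integral_connProb_mul_le {M : ℝ} (hM : ∀ x, ∫ z, φ x z ∂μ ≤ M) (n : ℕ) :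
    ∀ (S : Finset ℕ), S.card = n + 1 → ∀ j ∈ S, ∀ ψ : X → ℝ, Measurable ψ → (∀ z, 0 ≤ ψ z) →
      ∀ C : ℝ, (∀ z, ψ z ≤ C) →
      ∫ y, connProb φ S y * ψ (y j) ∂pointMeasure μ ≤
        treeConst (n + 1) * M ^ n * ∫ z, ψ z ∂μ := by
  have hM0 : 0 ≤ M := by
    obtain ⟨x⟩ : Nonempty X := nonempty_of_isProbabilityMeasure μ
    exact (integral_nonneg fun z => φ.nonneg' x z).trans (hM x)
  induction n with
  | zero =>
    intro S hS j hj ψ hψ hψ0 C hC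
    have hψa : ∀ z, |ψ z| ≤ C := fun z => by rw [abs_of_nonneg (hψ0 z)]; exact hC z
    have hψj : Measurable fun y : ℕ → X => ψ (y j) := hψ.comp (measurable_pi_apply j)
    simp only [treeConst, zero_add, Nat.factorial, pow_zero, Nat.sub_self, mul_one, Nat.cast_one,
      one_mul]
    rw [← integral_eval (ν := μ) hψ j]
    exact integral_mono (integrable_of_abs_le ((measurable_connProb φ S).mul hψj) C fun y =>
        abs_mul_le_of_le_one (abs_connProb_le_one φ S y) (hψa _))
      (integrable_of_abs_le hψj C fun y => hψa _)
      fun y => mul_le_of_le_one_left (hψ0 _) (connProb_le_one φ S y)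
  | succ n ih =>
    intro S hS j hj ψ hψ hψ0 C hC
    have hC0 : 0 ≤ C := by
      obtain ⟨x⟩ : Nonempty X := nonempty_of_isProbabilityMeasure μ
      exact (hψ0 x).trans (hC x)
    have hψa : ∀ z, |ψ z| ≤ C := fun z => by rw [abs_of_nonneg (hψ0 z)]; exact hC z
    have hψI : 0 ≤ ∫ z, ψ z ∂μ := integral_nonneg hψ0
    have hψj : Measurable fun y : ℕ → X => ψ (y j) := hψ.comp (measurable_pi_apply j)
    have hφm : ∀ v w : ℕ, Measurable fun y : ℕ → X => φ (y v) (y w) := fun v w =>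
      φ.measurable_comp (measurable_pi_apply v) (measurable_pi_apply w)
    have hmeas : ∀ v w, Measurable fun y : ℕ → X =>
        connProb φ (S.erase v) y * φ (y v) (y w) * ψ (y j) := fun v w =>
      ((measurable_connProb φ _).mul (hφm v w)).mul hψj
    have habs : ∀ v w y, |connProb φ (S.erase v) y * φ (y v) (y w) * ψ (y j)| ≤ C :=
      fun v w y => abs_mul_le_of_le_one
        (abs_mul_le_of_le_one (abs_connProb_le_one φ _ y) (abs_connection_le_one φ _ _)) (hψa _)
    have hint : ∀ v w, Integrable (fun y : ℕ → X =>
        connProb φ (S.erase v) y * φ (y v) (y w) * ψ (y j)) (pointMeasure μ) := fun v w =>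
      integrable_of_abs_le (hmeas v w) C (habs v w)
    have hcard : ∀ v ∈ S, (S.erase v).card = n + 1 := fun v hv => by
      rw [Finset.card_erase_of_mem hv, hS]; rfl
    have hterm : ∀ v ∈ S, ∀ w ∈ S.erase v,
        ∫ y, connProb φ (S.erase v) y * φ (y v) (y w) * ψ (y j) ∂pointMeasure μ ≤
          treeConst (n + 1) * M ^ (n + 1) * ∫ z, ψ z ∂μ := by
      intro v hv w hw
      have hwv : w ≠ v := Finset.ne_of_mem_erase hw
      have hconst : ∀ (y : ℕ → X) z,
          connProb φ (S.erase v) (Function.update y v z) = connProb φ (S.erase v) y := fun y z =>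
        dependsOn_connProb φ (S.erase v) fun i hi =>
          Function.update_of_ne (Finset.ne_of_mem_erase hi) _ _
      rw [integral_eq_integral_update μ (hmeas v w) (habs v w) v]
      simp only [hconst, Function.update_self, Function.update_of_ne hwv]
      by_cases hvj : j = v
      · -- the weighted point itself is removed: its neighbour `w` inherits the weight
        subst hvj
        simp only [Function.update_self]
        have hψ'm : Measurable fun x => ∫ z, φ z x * ψ z ∂μ :=
          measurable_integral_right (F := fun x z => φ z x * ψ z)
            ((φ.measurable_comp measurable_snd measurable_fst).mul (hψ.comp measurable_snd))
        have h := ih (S.erase j) (hcard j hj) w hw (fun x => ∫ z, φ z x * ψ z ∂μ) hψ'm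
          (fun x => integral_nonneg fun z => mul_nonneg (φ.nonneg' _ _) (hψ0 z)) C
          (fun x => (le_abs_self _).trans (abs_integral_le_of_abs_le fun z =>
            abs_mul_le_of_le_one (abs_connection_le_one φ _ _) (hψa z)))
        have h2 : ∫ x, ∫ z, φ z x * ψ z ∂μ ∂μ ≤ M * ∫ z, ψ z ∂μ := by
          rw [integral_integral_swap (integrable_of_abs_le (F := Function.uncurry
            fun x z => φ z x * ψ z) ((φ.measurable_comp measurable_snd measurable_fst).mul
              (hψ.comp measurable_snd)) C fun p =>
                abs_mul_le_of_le_one (abs_connection_le_one φ _ _) (hψa _)),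
            ← integral_const_mul]
          refine integral_mono (integrable_of_abs_le (measurable_integral_right
            (F := fun z x => φ z x * ψ z) (φ.measurable'.mul (hψ.comp measurable_fst))) C fun z =>
              abs_integral_le_of_abs_le fun x => abs_mul_le_of_le_one
                (abs_connection_le_one φ _ _) (hψa _))
            ((integrable_of_abs_le hψ C hψa).const_mul M) fun z => ?_
          simp only [integral_mul_const]
          exact mul_le_mul_of_nonneg_right (hM z) (hψ0 z)
        refine le_trans (le_of_eq ?_) (h.trans ((mul_le_mul_of_nonneg_left h2
          (by positivity)).trans (le_of_eq (by ring))))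
        refine integral_congr_ae (Eventually.of_forall fun y => ?_)
        simp only [mul_assoc]
        rw [integral_const_mul]
      · simp only [Function.update_of_ne hvj]
        have hjv : j ∈ S.erase v := Finset.mem_erase.2 ⟨hvj, hj⟩
        have h := ih (S.erase v) (hcard v hv) j hjv ψ hψ hψ0 C hC
        have h2 : ∀ y : ℕ → X, ∫ z, connProb φ (S.erase v) y * φ z (y w) * ψ (y j) ∂μ ≤
            M * (connProb φ (S.erase v) y * ψ (y j)) := by
          intro y
          rw [integral_mul_const, integral_const_mul]
          have h3 : ∫ z, φ z (y w) ∂μ ≤ M := by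
            simp only [fun z => φ.symm' z (y w)]; exact hM (y w)
          have h4 := mul_le_mul_of_nonneg_left h3
            (mul_nonneg (connProb_nonneg φ (S.erase v) y) (hψ0 (y j)))
          linarith
        have hmI : Measurable fun y : ℕ → X =>
            ∫ z, connProb φ (S.erase v) y * φ z (y w) * ψ (y j) ∂μ :=
          measurable_integral_right (F := fun (y : ℕ → X) z =>
            connProb φ (S.erase v) y * φ z (y w) * ψ (y j))
            ((((measurable_connProb φ _).comp measurable_fst).mul
              (φ.measurable_comp measurable_snd ((measurable_pi_apply w).comp measurable_fst))).mul
                (hψj.comp measurable_fst))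
        refine (integral_mono (integrable_of_abs_le hmI C fun y => abs_integral_le_of_abs_le fun z =>
            abs_mul_le_of_le_one (abs_mul_le_of_le_one (abs_connProb_le_one φ _ y)
              (abs_connection_le_one φ _ _)) (hψa _))
          ((integrable_of_abs_le ((measurable_connProb φ _).mul hψj) C fun y =>
            abs_mul_le_of_le_one (abs_connProb_le_one φ _ y) (hψa _)).const_mul M) h2).trans ?_
        rw [integral_const_mul]
        exact (mul_le_mul_of_nonneg_left h hM0).trans (le_of_eq (by ring))
    have hmono : ∫ y, connProb φ S y * ψ (y j) ∂pointMeasure μ ≤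
        ∫ y, ∑ v ∈ S, ∑ w ∈ S.erase v,
          connProb φ (S.erase v) y * φ (y v) (y w) * ψ (y j) ∂pointMeasure μ := by
      refine integral_mono (integrable_of_abs_le ((measurable_connProb φ S).mul hψj) C fun y =>
        abs_mul_le_of_le_one (abs_connProb_le_one φ S y) (hψa _))
        (integrable_finsetSum _ fun v _ => integrable_finsetSum _ fun w _ => hint v w) fun y => ?_
      refine (mul_le_mul_of_nonneg_right (connProb_le_sum_erase φ (by omega) y) (hψ0 _)).trans
        (le_of_eq ?_)
      simp only [Finset.sum_mul]
    refine hmono.trans ?_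
    rw [integral_finsetSum _ fun v _ => integrable_finsetSum _ fun w _ => hint v w,
      Finset.sum_congr rfl fun v _ => integral_finsetSum (S.erase v) fun w _ => hint v w]
    refine (Finset.sum_le_sum fun v hv => Finset.sum_le_sum (hterm v hv)).trans (le_of_eq ?_)
    rw [Finset.sum_congr rfl fun v hv => by rw [Finset.sum_const, hcard v hv], Finset.sum_const, hS]
    simp only [treeConst, nsmul_eq_mul, Nat.add_sub_cancel, Nat.factorial_succ]
    push_cast
    ring

/-- A star is connected. -/
theorem pow_le_integral_connProb {m : ℝ} (hm0 : 0 ≤ m) (hm : ∀ x, m ≤ ∫ z, φ x z ∂μ) {k : ℕ}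
    (hk : 1 ≤ k) : m ^ (k - 1) ≤ ∫ y, connProb φ (Finset.range k) y ∂pointMeasure μ := by
  have hadj : ∀ (y : ℕ → X) v w, Measurable fun u => adjInd (pointGraph φ y u) v w :=
    fun y v w => (isLocal_adjInd v w).measurable_right φ y
  have h1 : ∀ y : ℕ → X, ∏ j ∈ Finset.Ico 1 k, φ (y 0) (y j) ≤ connProb φ (Finset.range k) y := by
    intro y
    have hprod : ∫ u, ∏ j ∈ Finset.Ico 1 k, adjInd (pointGraph φ y u) 0 j ∂markMeasure =
        ∏ j ∈ Finset.Ico 1 k, φ (y 0) (y j) := by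
      rw [integral_prod_of_dependsOn (F := fun j u => adjInd (pointGraph φ y u) 0 j)
        (A := fun j => {s(0, j)}) (fun j => hadj y 0 j) _ (fun j _ => dependsOn_adjInd φ 0 j y)]
      · refine Finset.prod_congr rfl fun j hj => integral_adjInd φ ?_ y
        have := (Finset.mem_Ico.1 hj).1
        omega
      · intro i _ j _ hij
        simp only [Set.disjoint_singleton, ne_eq, Sym2.eq_iff]
        omega
    rw [← hprod]
    exact integral_mono (integrable_of_abs_le (Finset.measurable_prod _ fun j _ => hadj y 0 j) 1
        fun u => prod_abs_le_one fun j _ => by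
          rw [abs_of_nonneg (adjInd_nonneg _ _ _)]; exact adjInd_le_one _ _ _)
      (integrable_of_abs_le ((isLocal_connInd _).measurable_right φ y) 1 fun u => by
        rw [abs_of_nonneg (connInd_nonneg _ _)]; exact connInd_le_one _ _)
      fun u => prod_adjInd_le_connInd _ hk
  have hm1 : Measurable fun y : ℕ → X => ∏ j ∈ Finset.Ico 1 k, φ (y 0) (y j) :=
    Finset.measurable_prod _ fun j _ =>
      φ.measurable_comp (measurable_pi_apply 0) (measurable_pi_apply j)
  have ha1 : ∀ y : ℕ → X, |∏ j ∈ Finset.Ico 1 k, φ (y 0) (y j)| ≤ 1 := fun y =>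
    prod_abs_le_one fun j _ => abs_connection_le_one φ _ _
  refine le_trans ?_ (integral_mono (integrable_of_abs_le hm1 1 ha1)
    (integrable_of_abs_le (measurable_connProb φ _) 1 (abs_connProb_le_one φ _)) h1)
  have hT := measurePreserving_update (ν := μ) 0
  rw [← integral_comp_of_measurePreserving hT hm1,
    integral_prod (f := fun p : X × (ℕ → X) =>
      ∏ j ∈ Finset.Ico 1 k, φ (Function.update p.2 0 p.1 0) (Function.update p.2 0 p.1 j))
      (integrable_of_abs_le (hm1.comp hT.measurable) 1 fun p => ha1 _)]
  have h2 : ∀ x : X, ∫ y, ∏ j ∈ Finset.Ico 1 k,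
      φ (Function.update y 0 x 0) (Function.update y 0 x j) ∂pointMeasure μ =
        (∫ z, φ x z ∂μ) ^ (k - 1) := by
    intro x
    rw [← Nat.card_Ico 1 k, ← integral_prod_eval (measurable_connection_right φ x)]
    refine integral_congr_ae (Eventually.of_forall fun y => Finset.prod_congr rfl fun j hj => ?_)
    have hj0 : j ≠ 0 := by have := (Finset.mem_Ico.1 hj).1; omega
    rw [Function.update_self, Function.update_of_ne hj0]
  simp only [h2]
  calc m ^ (k - 1) = ∫ _, m ^ (k - 1) ∂μ := by simp
    _ ≤ _ := integral_mono (integrable_const _) (integrable_of_abs_le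
        ((measurable_integral_connection φ μ).pow_const _) 1 fun x => by
          rw [abs_pow]
          exact pow_le_one₀ (abs_nonneg _) (abs_integral_le_of_abs_le (abs_connection_le_one φ x)))
        fun x => pow_le_pow_left₀ hm0 (hm x) _

end Bounds

/-! ### Bounds for the Stein error -/

section SteinBounds

variable {X : Type*} [MeasurableSpace X] (φ : ConnectionFunction X) (μ : Measure X)
  [IsProbabilityMeasure μ]

lemma integrable_connProb_mul_steinKernel (k : ℕ) (r : ℝ≥0) (x : ℕ → X) :
    Integrable (fun y => connProb φ (Finset.range k) y * steinKernel φ μ k r x y)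
      (pointMeasure μ) := by
  have h : Measurable fun y => steinKernel φ μ k r x y :=
    (measurable_steinKernel φ μ k r).comp (g := fun p : (ℕ → X) × (ℕ → X) =>
      steinKernel φ μ k r p.1 p.2) (f := fun y => (x, y)) measurable_prodMk_left
  exact integrable_of_abs_le ((measurable_connProb φ _).mul h) 2
    (abs_connProb_mul_steinKernel_le φ μ k r x)

lemma integrable_one_sub_avoid_mul (S T : Finset ℕ) (x y : ℕ → X) :
    Integrable (fun z => (1 - avoid φ S x z) * (1 - avoid φ T y z)) μ :=
  integrable_of_abs_le ((measurable_const.sub (measurable_avoid_right φ S x)).mul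
    (measurable_const.sub (measurable_avoid_right φ T y))) 1 fun z => by
    rw [abs_of_nonneg (mul_nonneg (sub_nonneg.2 (avoid_le_one φ _ x z))
      (sub_nonneg.2 (avoid_le_one φ _ y z)))]
    exact mul_le_one₀ (sub_le_self _ (avoid_nonneg φ _ x z)) (sub_nonneg.2 (avoid_le_one φ _ y z))
      (sub_le_self _ (avoid_nonneg φ _ y z))

/-- If `φ ≤ p`, the mean number of common neighbours of `x` and `y` is small compared to the mean
number of neighbours of `x`. -/
lemma exp_neg_overlap_le {p : ℝ} (hp : ∀ x y, φ x y ≤ p) (k : ℕ) (r : ℝ≥0) (x y : ℕ → X) :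
    Real.exp (-(r * overlap φ μ k x y)) ≤ Real.exp (-(r * (1 - avoidMean φ μ k y))) *
      Real.exp (k * p * (r * (1 - avoidMean φ μ k x))) := by
  rw [← Real.exp_add, Real.exp_le_exp]
  have h1 : 1 - avoidMean φ μ k y - overlap φ μ k x y ≤ k * p * (1 - avoidMean φ μ k x) := by
    rw [one_sub_avoidMean_sub_overlap, one_sub_avoidMean_eq φ μ k x, ← integral_const_mul]
    refine integral_mono (integrable_one_sub_avoid_mul φ μ _ _ x y)
      ((integrable_one_sub_avoid φ μ _ x).const_mul _) fun z => ?_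
    have h2 : 1 - avoid φ (Finset.range k) y z ≤ k * p :=
      (one_sub_avoid_le φ _ y z).trans ((Finset.sum_le_sum fun i _ => hp (y i) z).trans (by simp))
    have h3 := mul_le_mul_of_nonneg_left h2 (sub_nonneg.2 (avoid_le_one φ (Finset.range k) x z))
    simp only
    linarith
  have h4 := mul_le_mul_of_nonneg_left h1 r.2
  simp only [NNReal.val_eq_coe] at h4
  linarith

/-- If `φ ≤ p` with `p` small then the kernel is small, except if `x` has many neighbours in the
mean, which is unlikely for an isolated block. -/
lemma exp_mul_steinKernel_le {p : ℝ} (hp0 : 0 ≤ p) (hp : ∀ x y, φ x y ≤ p) (k : ℕ) (r : ℝ≥0)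
    {Λ : ℝ} (hΛ : 0 ≤ Λ) (x y : ℕ → X) :
    Real.exp (-(r * (1 - avoidMean φ μ k x))) * steinKernel φ μ k r x y ≤
      (k ^ 2 * p + (Real.exp (k * p * Λ) - 1)) * Real.exp (-(r * (1 - avoidMean φ μ k x))) *
        Real.exp (-(r * (1 - avoidMean φ μ k y))) + Real.exp (-Λ) := by
  set ex := Real.exp (-(r * (1 - avoidMean φ μ k x))) with hex
  set ey := Real.exp (-(r * (1 - avoidMean φ μ k y))) with hey
  have hex0 : 0 < ex := Real.exp_pos _
  have hey0 : 0 < ey := Real.exp_pos _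
  have hpi := prod_avoid_le_one φ k x y
  have hpi0 := prod_avoid_nonneg φ k x y
  have hpi1 : 1 - ∏ i ∈ Finset.range k, avoid φ (Finset.range k) x (y i) ≤ k ^ 2 * p := by
    refine (one_sub_prod_avoid_le φ k x y).trans ((Finset.sum_le_sum fun i _ =>
      Finset.sum_le_sum fun j _ => hp (x j) (y i)).trans (le_of_eq ?_))
    simp only [Finset.sum_const, Finset.card_range, nsmul_eq_mul]
    ring
  have hdiff := exp_overlap_sub_nonneg φ μ k r x y
  have hK : steinKernel φ μ k r x y ≤ k ^ 2 * p * ey +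
      (Real.exp (-(r * overlap φ μ k x y)) - ey) :=
    add_le_add (mul_le_mul_of_nonneg_right hpi1 hey0.le) (mul_le_of_le_one_left hdiff hpi)
  have h1 : ex * (Real.exp (-(r * overlap φ μ k x y)) - ey) ≤
      (Real.exp (k * p * Λ) - 1) * ex * ey + Real.exp (-Λ) := by
    have hE : 1 ≤ Real.exp (k * p * Λ) := Real.one_le_exp (by positivity)
    rcases le_total (r * (1 - avoidMean φ μ k x)) Λ with h | h
    · have h2 := exp_neg_overlap_le φ μ hp k r x y
      have h3 : Real.exp (k * p * (r * (1 - avoidMean φ μ k x))) ≤ Real.exp (k * p * Λ) :=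
        Real.exp_le_exp.2 (mul_le_mul_of_nonneg_left h (by positivity))
      have h4 : Real.exp (-(r * overlap φ μ k x y)) ≤ ey * Real.exp (k * p * Λ) :=
        h2.trans (mul_le_mul_of_nonneg_left h3 hey0.le)
      have h5 := mul_le_mul_of_nonneg_left (sub_le_sub_right h4 ey) hex0.le
      have h6 := Real.exp_pos (-Λ)
      linarith
    · have h2 : ex ≤ Real.exp (-Λ) := Real.exp_le_exp.2 (neg_le_neg h)
      have h3 := exp_neg_mul_le_one r (overlap_nonneg φ μ k x y)
      have h4 : ex * (Real.exp (-(r * overlap φ μ k x y)) - ey) ≤ ex :=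
        mul_le_of_le_one_right hex0.le (by linarith)
      have h5 : 0 ≤ (Real.exp (k * p * Λ) - 1) * ex * ey :=
        mul_nonneg (mul_nonneg (sub_nonneg.2 hE) hex0.le) hey0.le
      linarith
  have h2 := mul_le_mul_of_nonneg_left hK hex0.le
  linarith

theorem steinError_le_of_le {p : ℝ} (hp0 : 0 ≤ p) (hp : ∀ x y, φ x y ≤ p) (k : ℕ) (r : ℝ≥0)
    {Λ : ℝ} (hΛ : 0 ≤ Λ) :
    steinError φ μ k r ≤
      poissonMeanCount φ μ k r ^ 2 * (k ^ 2 * p + (Real.exp (k * p * Λ) - 1)) +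
        ((r : ℝ) ^ k / k.factorial) ^ 2 * Real.exp (-Λ) := by
  set c := k ^ 2 * p + (Real.exp (k * p * Λ) - 1)
  set A := ∫ y, connProb φ (Finset.range k) y *
    Real.exp (-(r * (1 - avoidMean φ μ k y))) ∂pointMeasure μ with hA
  have hAi := integrable_connProb_mul_exp φ μ k r
  have hinner : ∀ x, Real.exp (-(r * (1 - avoidMean φ μ k x))) *
      ∫ y, connProb φ (Finset.range k) y * steinKernel φ μ k r x y ∂pointMeasure μ ≤
        c * A * Real.exp (-(r * (1 - avoidMean φ μ k x))) + Real.exp (-Λ) := by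
    intro x
    rw [← integral_const_mul]
    have h1 : ∫ y, ((c * Real.exp (-(r * (1 - avoidMean φ μ k x)))) *
        (connProb φ (Finset.range k) y * Real.exp (-(r * (1 - avoidMean φ μ k y)))) +
          Real.exp (-Λ)) ∂pointMeasure μ =
        c * A * Real.exp (-(r * (1 - avoidMean φ μ k x))) + Real.exp (-Λ) := by
      rw [integral_add (hAi.const_mul _) (integrable_const _), integral_const_mul, ← hA]
      simp only [integral_const, probReal_univ, one_smul]
      ring
    rw [← h1]
    refine integral_mono ((integrable_connProb_mul_steinKernel φ μ k r x).const_mul _)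
      ((hAi.const_mul _).add (integrable_const _)) fun y => ?_
    have h2 := mul_le_mul_of_nonneg_left (exp_mul_steinKernel_le φ μ hp0 hp k r hΛ x y)
      (connProb_nonneg φ (Finset.range k) y)
    have h3 := mul_le_of_le_one_left (Real.exp_pos (-Λ)).le (connProb_le_one φ (Finset.range k) y)
    simp only
    linarith
  have houter : ∫ x, connProb φ (Finset.range k) x *
      (Real.exp (-(r * (1 - avoidMean φ μ k x))) *
        ∫ y, connProb φ (Finset.range k) y * steinKernel φ μ k r x y ∂pointMeasure μ)
          ∂pointMeasure μ ≤ c * A ^ 2 + Real.exp (-Λ) := by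
    have h1 : ∫ x, (c * A * (connProb φ (Finset.range k) x *
        Real.exp (-(r * (1 - avoidMean φ μ k x)))) + Real.exp (-Λ)) ∂pointMeasure μ =
        c * A ^ 2 + Real.exp (-Λ) := by
      rw [integral_add (hAi.const_mul _) (integrable_const _), integral_const_mul, ← hA]
      simp only [integral_const, probReal_univ, one_smul]
      ring
    rw [← h1]
    refine integral_mono (integrable_steinError φ μ k r)
      ((hAi.const_mul _).add (integrable_const _)) fun x => ?_
    have h2 := mul_le_mul_of_nonneg_left (hinner x) (connProb_nonneg φ (Finset.range k) x)
    have h3 := mul_le_of_le_one_left (Real.exp_pos (-Λ)).le (connProb_le_one φ (Finset.range k) x)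
    simp only
    linarith
  rw [steinError, poissonMeanCount, ← hA]
  refine (mul_le_mul_of_nonneg_left houter (by positivity)).trans (le_of_eq ?_)
  ring

variable {φ μ} {ε M : ℝ}

/-- In the homogeneous case a block is isolated with a probability that is exponentially small in
`r M`, and so is the kernel. -/
lemma steinKernel_le_of_homogeneous (hε0 : 0 ≤ ε) (hδ : ∀ x y, φ x y ≤ 1 - ε)
    (hm : ∀ x, ε * M ≤ ∫ z, φ x z ∂μ) {k : ℕ} (hk : 1 ≤ k) (r : ℝ≥0) (x y : ℕ → X) :
    steinKernel φ μ k r x y ≤ Real.exp (-(ε ^ (k + 1) * (r * M))) *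
      ∑ i ∈ Finset.range k, ∑ j ∈ Finset.range k,
        (φ (x j) (y i) + r * ∫ z, φ (x j) z * φ (y i) z ∂μ) := by
  have hov : ε ^ (k + 1) * (r * M) ≤ r * overlap φ μ k x y := by
    have h1 := mul_le_mul_of_nonneg_left (le_one_sub_avoidMean φ μ hm hk y) (pow_nonneg hε0 k)
    have h2 := mul_le_mul_of_nonneg_left (h1.trans (mul_le_overlap φ μ hε0 hδ k x y)) r.2
    simp only [NNReal.val_eq_coe] at h2
    refine le_trans (le_of_eq ?_) h2
    ring
  have hD : r * overlap φ μ k x y ≤ r * (1 - avoidMean φ μ k y) :=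
    mul_le_mul_of_nonneg_left (overlap_le φ μ k x y) r.2
  set E := Real.exp (-(ε ^ (k + 1) * (r * M)))
  have hE1 : Real.exp (-(r * overlap φ μ k x y)) ≤ E := Real.exp_le_exp.2 (neg_le_neg hov)
  have hE2 : Real.exp (-(r * (1 - avoidMean φ μ k y))) ≤ E :=
    Real.exp_le_exp.2 (neg_le_neg (hov.trans hD))
  have hE0 : 0 < E := Real.exp_pos _
  have hcommon : 1 - avoidMean φ μ k y - overlap φ μ k x y ≤
      ∑ i ∈ Finset.range k, ∑ j ∈ Finset.range k, ∫ z, φ (x j) z * φ (y i) z ∂μ := by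
    have hi : ∀ i j, Integrable (fun z => φ (x j) z * φ (y i) z) μ := fun i j =>
      integrable_of_abs_le ((measurable_connection_right φ _).mul (measurable_connection_right φ _))
        1 fun z => abs_mul_le_of_le_one (abs_connection_le_one φ _ _) (abs_connection_le_one φ _ _)
    rw [one_sub_avoidMean_sub_overlap]
    rw [Finset.sum_congr rfl fun i _ => (integral_finsetSum (Finset.range k) fun j _ => hi i j).symm,
      ← integral_finsetSum _ fun i _ => integrable_finsetSum _ fun j _ => hi i j]
    refine integral_mono (integrable_one_sub_avoid_mul φ μ _ _ x y)
      (integrable_finsetSum _ fun i _ => integrable_finsetSum _ fun j _ => hi i j) fun z => ?_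
    refine (mul_le_mul (one_sub_avoid_le φ _ x z) (one_sub_avoid_le φ _ y z)
      (sub_nonneg.2 (avoid_le_one φ _ y z)) (Finset.sum_nonneg fun i _ => φ.nonneg' _ _)).trans
      (le_of_eq ?_)
    simp only [Finset.sum_mul_sum]
    exact Finset.sum_comm
  -- `exp (-a) - exp (-b) ≤ exp (-a) * (b - a)`
  have hexp : Real.exp (-(r * overlap φ μ k x y)) - Real.exp (-(r * (1 - avoidMean φ μ k y))) ≤
      E * (r * (1 - avoidMean φ μ k y - overlap φ μ k x y)) := by
    have h1 : Real.exp (-(r * (1 - avoidMean φ μ k y))) = Real.exp (-(r * overlap φ μ k x y)) *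
        Real.exp (-(r * (1 - avoidMean φ μ k y - overlap φ μ k x y))) := by
      rw [← Real.exp_add]; congr 1; ring
    have h2 := Real.one_sub_le_exp_neg (r * (1 - avoidMean φ μ k y - overlap φ μ k x y))
    have h3 : Real.exp (-(r * overlap φ μ k x y)) - Real.exp (-(r * (1 - avoidMean φ μ k y))) =
        Real.exp (-(r * overlap φ μ k x y)) *
          (1 - Real.exp (-(r * (1 - avoidMean φ μ k y - overlap φ μ k x y)))) := by
      rw [h1]; ring
    rw [h3]
    exact (mul_le_mul_of_nonneg_left (by linarith) (Real.exp_pos _).le).trans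
      (mul_le_mul_of_nonneg_right hE1 (by linarith))
  have hA : (1 - ∏ i ∈ Finset.range k, avoid φ (Finset.range k) x (y i)) *
      Real.exp (-(r * (1 - avoidMean φ μ k y))) ≤
      (∑ i ∈ Finset.range k, ∑ j ∈ Finset.range k, φ (x j) (y i)) * E :=
    mul_le_mul (one_sub_prod_avoid_le φ k x y) hE2 (Real.exp_pos _).le
      (Finset.sum_nonneg fun i _ => Finset.sum_nonneg fun j _ => φ.nonneg' _ _)
  have hB : (∏ i ∈ Finset.range k, avoid φ (Finset.range k) x (y i)) *
      (Real.exp (-(r * overlap φ μ k x y)) - Real.exp (-(r * (1 - avoidMean φ μ k y)))) ≤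
      E * (r * ∑ i ∈ Finset.range k, ∑ j ∈ Finset.range k, ∫ z, φ (x j) z * φ (y i) z ∂μ) :=
    (mul_le_of_le_one_left (exp_overlap_sub_nonneg φ μ k r x y) (prod_avoid_le_one φ k x y)).trans
      (hexp.trans (mul_le_mul_of_nonneg_left (mul_le_mul_of_nonneg_left hcommon r.2) hE0.le))
  refine (add_le_add hA hB).trans (le_of_eq ?_)
  simp only [Finset.sum_add_distrib, ← Finset.mul_sum]
  ring

theorem integral_connProb_mul_steinKernel_le (hε0 : 0 ≤ ε)
    (hδ : ∀ x y, φ x y ≤ 1 - ε) (hM : ∀ x, ∫ z, φ x z ∂μ ≤ M)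
    (hm : ∀ x, ε * M ≤ ∫ z, φ x z ∂μ) {k : ℕ} (hk : 1 ≤ k) (r : ℝ≥0) (x : ℕ → X) :
    ∫ y, connProb φ (Finset.range k) y * steinKernel φ μ k r x y ∂pointMeasure μ ≤
      Real.exp (-(ε ^ (k + 1) * (r * M))) * (k ^ 2 * treeConst k * M ^ k * (1 + r * M)) := by
  have hM0 : 0 ≤ M := (integral_nonneg fun z => φ.nonneg' (x 0) z).trans (hM (x 0))
  set ψ : ℕ → X → ℝ := fun j w => φ (x j) w + r * ∫ z, φ (x j) z * φ w z ∂μ with hψ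
  have hcm : ∀ j, Measurable fun w => ∫ z, φ (x j) z * φ w z ∂μ := fun j =>
    measurable_integral_right (F := fun w z => φ (x j) z * φ w z)
      (((measurable_connection_right φ (x j)).comp measurable_snd).mul φ.measurable')
  have hca : ∀ j w, |∫ z, φ (x j) z * φ w z ∂μ| ≤ 1 := fun j w =>
    abs_integral_le_of_abs_le fun z =>
      abs_mul_le_of_le_one (abs_connection_le_one φ _ _) (abs_connection_le_one φ _ _)
  have hψm : ∀ j, Measurable (ψ j) := fun j =>
    (measurable_connection_right φ (x j)).add ((hcm j).const_mul _)
  have hψ0 : ∀ j w, 0 ≤ ψ j w := fun j w => add_nonneg (φ.nonneg' _ _)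
    (mul_nonneg r.2 (integral_nonneg fun z => mul_nonneg (φ.nonneg' _ _) (φ.nonneg' _ _)))
  have hψC : ∀ j w, ψ j w ≤ 1 + r := fun j w => by
    have h1 := mul_le_mul_of_nonneg_left ((le_abs_self _).trans (hca j w)) r.2
    simp only [NNReal.val_eq_coe, mul_one] at h1
    exact add_le_add (φ.le_one' _ _) h1
  have hψI : ∀ j, ∫ w, ψ j w ∂μ ≤ M * (1 + r * M) := by
    intro j
    have hsw : ∫ w, ∫ z, φ (x j) z * φ w z ∂μ ∂μ ≤ M * M := by
      rw [integral_integral_swap (integrable_of_abs_le (F := Function.uncurry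
        fun w z => φ (x j) z * φ w z)
        (((measurable_connection_right φ (x j)).comp measurable_snd).mul φ.measurable') 1
          fun p => abs_mul_le_of_le_one (abs_connection_le_one φ _ _) (abs_connection_le_one φ _ _))]
      have h1 : ∀ z, ∫ w, φ (x j) z * φ w z ∂μ ≤ φ (x j) z * M := by
        intro z
        rw [integral_const_mul]
        refine mul_le_mul_of_nonneg_left ?_ (φ.nonneg' _ _)
        simp only [fun w => φ.symm' w z]
        exact hM z
      refine (integral_mono (integrable_of_abs_le (measurable_integral_right
        (F := fun z w => φ (x j) z * φ w z) (((measurable_connection_right φ (x j)).comp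
          measurable_fst).mul (φ.measurable'.comp measurable_swap))) 1 fun z =>
            abs_integral_le_of_abs_le fun w => abs_mul_le_of_le_one (abs_connection_le_one φ _ _)
              (abs_connection_le_one φ _ _)) ((integrable_connection φ μ _).mul_const M) h1).trans ?_
      rw [integral_mul_const]
      exact mul_le_mul_of_nonneg_right (hM _) hM0
    rw [integral_add (integrable_connection φ μ _)
      ((integrable_of_abs_le (hcm j) 1 (hca j)).const_mul _), integral_const_mul]
    have h1 := mul_le_mul_of_nonneg_left hsw r.2
    simp only [NNReal.val_eq_coe] at h1
    linarith [hM (x j)]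
  have hmeas : ∀ i j, Measurable fun y : ℕ → X => connProb φ (Finset.range k) y * ψ j (y i) :=
    fun i j => (measurable_connProb φ _).mul ((hψm j).comp (measurable_pi_apply i))
  have hint : ∀ i j, Integrable (fun y : ℕ → X => connProb φ (Finset.range k) y * ψ j (y i))
      (pointMeasure μ) := fun i j =>
    integrable_of_abs_le (hmeas i j) (1 + r) fun y =>
      abs_mul_le_of_le_one (abs_connProb_le_one φ _ y) (by
        rw [abs_of_nonneg (hψ0 _ _)]; exact hψC _ _)
  have hterm : ∀ i ∈ Finset.range k, ∀ j ∈ Finset.range k,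
      ∫ y, connProb φ (Finset.range k) y * ψ j (y i) ∂pointMeasure μ ≤
        treeConst k * M ^ (k - 1) * (M * (1 + r * M)) := by
    intro i hi j _
    have h := integral_connProb_mul_le φ μ hM (k - 1) (Finset.range k)
      (by rw [Finset.card_range]; omega) i hi (ψ j) (hψm j) (hψ0 j) _ (hψC j)
    rw [Nat.sub_add_cancel hk] at h
    exact h.trans (mul_le_mul_of_nonneg_left (hψI j) (by positivity))
  set E := Real.exp (-(ε ^ (k + 1) * (r * M)))
  have hbound : ∫ y, connProb φ (Finset.range k) y * steinKernel φ μ k r x y ∂pointMeasure μ ≤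
      ∫ y, E * ∑ i ∈ Finset.range k, ∑ j ∈ Finset.range k,
        connProb φ (Finset.range k) y * ψ j (y i) ∂pointMeasure μ := by
    refine integral_mono (integrable_connProb_mul_steinKernel φ μ k r x)
      ((integrable_finsetSum _ fun i _ => integrable_finsetSum _ fun j _ => hint i j).const_mul E)
      fun y => ?_
    refine (mul_le_mul_of_nonneg_left (steinKernel_le_of_homogeneous hε0 hδ hm hk r x y)
      (connProb_nonneg φ (Finset.range k) y)).trans (le_of_eq ?_)
    simp only [hψ, ← Finset.mul_sum]
    ring
  refine hbound.trans ?_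
  rw [integral_const_mul, integral_finsetSum _ fun i _ => integrable_finsetSum _ fun j _ => hint i j,
    Finset.sum_congr rfl fun i _ => integral_finsetSum (Finset.range k) fun j _ => hint i j]
  refine mul_le_mul_of_nonneg_left ((Finset.sum_le_sum fun i hi => Finset.sum_le_sum
    (hterm i hi)).trans (le_of_eq ?_)) (Real.exp_pos _).le
  have hpow : M ^ k = M ^ (k - 1) * M := by rw [← pow_succ, Nat.sub_add_cancel hk]
  simp only [Finset.sum_const, Finset.card_range, nsmul_eq_mul]
  rw [hpow]
  ring

theorem steinError_le_of_homogeneous (hε0 : 0 ≤ ε)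
    (hδ : ∀ x y, φ x y ≤ 1 - ε) (hM : ∀ x, ∫ z, φ x z ∂μ ≤ M)
    (hm : ∀ x, ε * M ≤ ∫ z, φ x z ∂μ) {k : ℕ} (hk : 1 ≤ k) (r : ℝ≥0) :
    steinError φ μ k r ≤ poissonMeanCount φ μ k r * (k ^ 2 * treeConst k / k.factorial *
      ((r * M) ^ k * (1 + r * M) * Real.exp (-(ε ^ (k + 1) * (r * M))))) := by
  have h : ∫ x, connProb φ (Finset.range k) x *
      (Real.exp (-(r * (1 - avoidMean φ μ k x))) *
        ∫ y, connProb φ (Finset.range k) y * steinKernel φ μ k r x y ∂pointMeasure μ)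
          ∂pointMeasure μ ≤
      (∫ x, connProb φ (Finset.range k) x *
        Real.exp (-(r * (1 - avoidMean φ μ k x))) ∂pointMeasure μ) *
      (Real.exp (-(ε ^ (k + 1) * (r * M))) * (k ^ 2 * treeConst k * M ^ k * (1 + r * M))) := by
    rw [← integral_mul_const]
    refine integral_mono (integrable_steinError φ μ k r)
      ((integrable_connProb_mul_exp φ μ k r).mul_const _) fun x => ?_
    simp only [mul_assoc]
    refine mul_le_mul_of_nonneg_left (mul_le_mul_of_nonneg_left ?_ (Real.exp_pos _).le)
      (connProb_nonneg φ _ x)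
    simpa only [mul_assoc] using
      integral_connProb_mul_steinKernel_le hε0 hδ hM hm hk r x
  rw [steinError, poissonMeanCount]
  refine (mul_le_mul_of_nonneg_left h (by positivity)).trans (le_of_eq ?_)
  rw [mul_pow]
  ring

/-- The mean number of components is at least that of isolated stars. -/
theorem le_poissonMeanCount (hε0 : 0 ≤ ε) (hM : ∀ x, ∫ z, φ x z ∂μ ≤ M)
    (hm : ∀ x, ε * M ≤ ∫ z, φ x z ∂μ) {k : ℕ} (hk : 1 ≤ k) (r : ℝ≥0) :
    (r : ℝ) * (ε ^ (k - 1) / k.factorial * ((r * M) ^ (k - 1) * Real.exp (-(k * (r * M))))) ≤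
      poissonMeanCount φ μ k r := by
  have hM0 : 0 ≤ M := by
    obtain ⟨x⟩ : Nonempty X := nonempty_of_isProbabilityMeasure μ
    exact (integral_nonneg fun z => φ.nonneg' x z).trans (hM x)
  have h1 : Real.exp (-(k * (r * M))) * (ε * M) ^ (k - 1) ≤ ∫ y, connProb φ (Finset.range k) y *
      Real.exp (-(r * (1 - avoidMean φ μ k y))) ∂pointMeasure μ := by
    refine (mul_le_mul_of_nonneg_left (pow_le_integral_connProb φ μ (mul_nonneg hε0 hM0) hm hk)
      (Real.exp_pos _).le).trans ?_
    rw [← integral_const_mul]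
    refine integral_mono ((integrable_of_abs_le (measurable_connProb φ _) 1
      (abs_connProb_le_one φ _)).const_mul _) (integrable_connProb_mul_exp φ μ k r) fun y => ?_
    simp only
    rw [mul_comm]
    refine mul_le_mul_of_nonneg_left (Real.exp_le_exp.2 (neg_le_neg ?_)) (connProb_nonneg φ _ y)
    have h2 := mul_le_mul_of_nonneg_left (one_sub_avoidMean_le φ μ hM k y) r.2
    simp only [NNReal.val_eq_coe] at h2
    linarith
  rw [poissonMeanCount]
  refine le_trans (le_of_eq ?_) (mul_le_mul_of_nonneg_left h1
    (by positivity : (0 : ℝ) ≤ (r : ℝ) ^ k / k.factorial))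
  have hpow : (r : ℝ) ^ k = r ^ (k - 1) * r := by rw [← pow_succ, Nat.sub_add_cancel hk]
  rw [hpow, mul_pow, mul_pow]
  ring

theorem poissonMeanCount_le (hM : ∀ x, ∫ z, φ x z ∂μ ≤ M)
    (hm : ∀ x, ε * M ≤ ∫ z, φ x z ∂μ) {k : ℕ} (hk : 1 ≤ k) (r : ℝ≥0) :
    poissonMeanCount φ μ k r ≤ r * (treeConst k / k.factorial *
      ((r * M) ^ (k - 1) * Real.exp (-(ε * (r * M))))) := by
  have h0 := integral_connProb_mul_le φ μ hM (k - 1) (Finset.range k)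
      (by rw [Finset.card_range]; omega) 0 (Finset.mem_range.2 hk) (fun _ => 1) measurable_const
      (fun _ => zero_le_one) 1 (fun _ => le_rfl)
  simp only [mul_one, integral_const, probReal_univ, smul_eq_mul,
    Nat.sub_add_cancel hk] at h0
  have h1 : ∫ y, connProb φ (Finset.range k) y *
      Real.exp (-(r * (1 - avoidMean φ μ k y))) ∂pointMeasure μ ≤
      Real.exp (-(ε * (r * M))) * (treeConst k * M ^ (k - 1)) := by
    refine le_trans ?_ (mul_le_mul_of_nonneg_left h0 (Real.exp_pos _).le)
    rw [← integral_const_mul]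
    refine integral_mono (integrable_connProb_mul_exp φ μ k r) ((integrable_of_abs_le
      (measurable_connProb φ _) 1 (abs_connProb_le_one φ _)).const_mul _) fun y => ?_
    simp only
    rw [mul_comm]
    refine mul_le_mul_of_nonneg_right (Real.exp_le_exp.2 (neg_le_neg ?_)) (connProb_nonneg φ _ y)
    have h2 := mul_le_mul_of_nonneg_left (le_one_sub_avoidMean φ μ hm hk y) r.2
    simp only [NNReal.val_eq_coe] at h2
    linarith
  rw [poissonMeanCount]
  refine (mul_le_mul_of_nonneg_left h1
    (by positivity : (0 : ℝ) ≤ (r : ℝ) ^ k / k.factorial)).trans (le_of_eq ?_)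
  have hpow : (r : ℝ) ^ k = r ^ (k - 1) * r := by rw [← pow_succ, Nat.sub_add_cancel hk]
  rw [hpow, mul_pow]
  ring

end SteinBounds

/-! ### Vanishing of the Stein error -/

section Vanishing

variable {X : Type*} [MeasurableSpace X]

lemma ConnectionFunction.le_supValue (φ : ConnectionFunction X) (x y : X) :
    φ x y ≤ φ.supValue :=
  le_ciSup (f := fun p : X × X => φ p.1 p.2) ⟨1, by rintro _ ⟨p, rfl⟩; exact φ.le_one' _ _⟩ (x, y)

lemma ConnectionFunction.supValue_nonneg (φ : ConnectionFunction X) : 0 ≤ φ.supValue :=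
  Real.iSup_nonneg fun p => φ.nonneg' p.1 p.2

/-- The maximal mean degree, up to the intensity. -/
noncomputable def maxDegree (φ : ConnectionFunction X) (μ : Measure X) : ℝ :=
  ⨆ x, ∫ z, φ x z ∂μ

variable (φ : ConnectionFunction X) (μ : Measure X)

lemma maxDegree_nonneg : 0 ≤ maxDegree φ μ :=
  Real.iSup_nonneg fun x => integral_nonneg fun z => φ.nonneg' x z

lemma ConnectionFunction.Homogeneous.le_integral {φ : ConnectionFunction X} {μ : Measure X} {ε : ℝ}
    (h : φ.Homogeneous μ ε) (x : X) :
    ε * maxDegree φ μ ≤ ∫ z, φ x z ∂μ :=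
  h.trans (ciInf_le (f := fun x => ∫ z, φ x z ∂μ)
    ⟨0, by rintro _ ⟨x, rfl⟩; exact integral_nonneg fun z => φ.nonneg' x z⟩ x)

variable [IsProbabilityMeasure μ]

lemma integral_connection_le_one (x : X) : ∫ z, φ x z ∂μ ≤ 1 :=
  (le_abs_self _).trans (abs_integral_le_of_abs_le (abs_connection_le_one φ x))

lemma integral_le_maxDegree (x : X) : ∫ z, φ x z ∂μ ≤ maxDegree φ μ :=
  le_ciSup (f := fun x => ∫ z, φ x z ∂μ)
    ⟨1, by rintro _ ⟨x, rfl⟩; exact integral_connection_le_one φ μ x⟩ x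

lemma maxDegree_le_supValue : maxDegree φ μ ≤ φ.supValue := by
  refine Real.iSup_le (fun x => ?_) φ.supValue_nonneg
  calc ∫ z, φ x z ∂μ ≤ ∫ _, φ.supValue ∂μ :=
        integral_mono (integrable_connection φ μ x) (integrable_const _) (φ.le_supValue x)
    _ = φ.supValue := by simp

variable {φ : ℝ → ConnectionFunction X} {k : ℕ}

/-- The regime of small connection functions: the cut-off `(2 k + 1) log s` for the mean number of
neighbours of a block makes the exceptional blocks negligible. -/
theorem tendsto_steinError_of_isLittleO {α : ℝ}
    (hα : Tendsto (fun s : ℝ => expectedCount μ k s (φ s)) atTop (𝓝 α))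
    (hφ : (fun s : ℝ => (φ s).supValue) =o[atTop] (fun s : ℝ => 1 / Real.log s)) :
    Tendsto (fun s : ℝ => steinError (φ s) μ k s.toNNReal) atTop (𝓝 0) := by
  have hlog : Tendsto (fun s : ℝ => (φ s).supValue * Real.log s) atTop (𝓝 0) := by
    refine hφ.tendsto_div_nhds_zero.congr fun s => ?_
    rw [one_div, div_inv_eq_mul]
  have hsup : Tendsto (fun s : ℝ => (φ s).supValue) atTop (𝓝 0) := by
    refine squeeze_zero' (Eventually.of_forall fun s => (φ s).supValue_nonneg) ?_ hlog
    filter_upwards [Real.tendsto_log_atTop.eventually_ge_atTop 1] with s hs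
    exact le_mul_of_one_le_right (φ s).supValue_nonneg hs
  have hinv : Tendsto (fun s : ℝ => s⁻¹) atTop (𝓝 0) := tendsto_inv_atTop_zero
  have hexp : Tendsto (fun s : ℝ => Real.exp (k * (2 * k + 1) * ((φ s).supValue * Real.log s)))
      atTop (𝓝 1) := by
    have := (Real.continuous_exp.tendsto _).comp (hlog.const_mul (k * (2 * k + 1) : ℝ))
    rw [mul_zero, Real.exp_zero] at this
    exact this
  have hlim : Tendsto (fun s : ℝ => expectedCount μ k s (φ s) ^ 2 * (k ^ 2 * (φ s).supValue +
      (Real.exp (k * (2 * k + 1) * ((φ s).supValue * Real.log s)) - 1)) + s⁻¹) atTop (𝓝 0) := by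
    have := ((hα.pow 2).mul ((hsup.const_mul ((k : ℝ) ^ 2)).add (hexp.sub_const 1))).add hinv
    simpa using this
  refine squeeze_zero' (Eventually.of_forall fun s => steinError_nonneg μ (φ s) k _) ?_ hlim
  filter_upwards [eventually_ge_atTop 1] with s hs
  have hs0 : 0 < s := by linarith
  have h := steinError_le_of_le (φ s) μ (φ s).supValue_nonneg (φ s).le_supValue k s.toNNReal
    (Λ := (2 * k + 1) * Real.log s) (mul_nonneg (by positivity) (Real.log_nonneg hs))
  rw [← expectedCount_eq, Real.coe_toNNReal s hs0.le] at h
  refine h.trans (add_le_add (le_of_eq ?_) ?_)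
  · congr 4; ring
  · have h1 : Real.exp (-((2 * k + 1) * Real.log s)) = (s ^ (2 * k + 1))⁻¹ := by
      rw [Real.exp_neg, ← Real.exp_log (pow_pos hs0 (2 * k + 1)), Real.log_pow]
      push_cast
      rfl
    rw [h1, div_pow, div_mul_eq_mul_div]
    refine div_le_of_le_mul₀ (by positivity) (by positivity) ?_
    have h2 : (s ^ k) ^ 2 * (s ^ (2 * k + 1))⁻¹ = s⁻¹ := by
      field_simp
      ring
    rw [h2]
    refine le_mul_of_one_le_right (by positivity) ?_
    have : (1 : ℝ) ≤ k.factorial := by exact_mod_cast Nat.factorial_pos k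
    exact one_le_pow₀ this

/-- A power of the bound for the relative Stein error is dominated by the bound for the mean number
of components per point. -/
lemma exists_pow_le_mul (hk : 1 ≤ k) {c : ℝ} (hc : 0 < c) : ∃ N : ℕ, N ≠ 0 ∧ ∃ C : ℝ, 0 ≤ C ∧
    ∀ x : ℝ, 0 ≤ x → (x ^ k * (1 + x) * Real.exp (-(c * x))) ^ N ≤
      C * (x ^ (k - 1) * Real.exp (-(k * x))) := by
  obtain ⟨N, hN⟩ := exists_nat_gt (2 * k / c)
  have hN0 : N ≠ 0 := by
    rintro rfl
    have : (0 : ℝ) ≤ 2 * k / c := by positivity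
    simp only [Nat.cast_zero] at hN
    linarith
  refine ⟨N, hN0, ((k + 1) * N).factorial * Real.exp 1, by positivity, fun x hx => ?_⟩
  have hk1 : (1 : ℝ) ≤ k := by exact_mod_cast hk
  have h1 : x ^ (k * N) ≤ x ^ (k - 1) * (1 + x) ^ (k * N) := by
    have hle : k - 1 ≤ k * N := (Nat.sub_le k 1).trans (Nat.le_mul_of_pos_right k (by omega))
    calc x ^ (k * N) = x ^ (k - 1) * x ^ (k * N - (k - 1)) := by
          rw [← pow_add, Nat.add_sub_cancel' hle]
      _ ≤ x ^ (k - 1) * (1 + x) ^ (k * N - (k - 1)) := by gcongr; linarith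
      _ ≤ x ^ (k - 1) * (1 + x) ^ (k * N) :=
          mul_le_mul_of_nonneg_left (pow_le_pow_right₀ (by linarith) (Nat.sub_le _ _))
            (by positivity)
  have h2 : (1 + x) ^ ((k + 1) * N) ≤ ((k + 1) * N).factorial * (Real.exp 1 * Real.exp (k * x)) := by
    have h3 := Real.pow_div_factorial_le_exp (1 + x) (by linarith) ((k + 1) * N)
    rw [div_le_iff₀ (by positivity), Real.exp_add, mul_comm (_ * _)] at h3
    refine h3.trans ?_
    gcongr
    nlinarith
  have h4 : Real.exp (-(c * x)) ^ N ≤ Real.exp (-(k * x)) * Real.exp (-(k * x)) := by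
    rw [← Real.exp_nat_mul, ← Real.exp_add, Real.exp_le_exp]
    have h5 : 2 * k ≤ N * c := by rw [div_lt_iff₀ hc] at hN; exact hN.le
    nlinarith [mul_le_mul_of_nonneg_right h5 hx]
  calc (x ^ k * (1 + x) * Real.exp (-(c * x))) ^ N
      = x ^ (k * N) * (1 + x) ^ N * Real.exp (-(c * x)) ^ N := by
        rw [mul_pow, mul_pow, ← pow_mul]
    _ ≤ x ^ (k - 1) * (1 + x) ^ (k * N) * (1 + x) ^ N *
          (Real.exp (-(k * x)) * Real.exp (-(k * x))) := by gcongr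
    _ = x ^ (k - 1) * (1 + x) ^ ((k + 1) * N) * (Real.exp (-(k * x)) * Real.exp (-(k * x))) := by
        rw [mul_assoc (x ^ (k - 1)), ← pow_add, add_mul, one_mul]
    _ ≤ x ^ (k - 1) * (((k + 1) * N).factorial * (Real.exp 1 * Real.exp (k * x))) *
          (Real.exp (-(k * x)) * Real.exp (-(k * x))) := by gcongr
    _ = _ := by
        have h6 : Real.exp (k * x) * Real.exp (-(k * x)) = 1 := by rw [← Real.exp_add]; simp
        linear_combination x ^ (k - 1) * ((k + 1) * N).factorial * Real.exp 1 *
          Real.exp (-(k * x)) * h6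

/-- In the homogeneous regime the relative Stein error vanishes as soon as the mean number of
components is of smaller order than the number of points. -/
theorem tendsto_steinError_of_homogeneous (hk : 1 ≤ k)
    (hα : (fun s : ℝ => expectedCount μ k s (φ s)) =o[atTop] (fun s : ℝ => s)) {ε : ℝ}
    (hε : 0 < ε) (hφ : ∀ s : ℝ, 0 < s → (φ s).Homogeneous μ ε ∧ (φ s).supValue ≤ 1 - ε) :
    ∃ η : ℝ → ℝ, Tendsto η atTop (𝓝 0) ∧ ∀ᶠ s : ℝ in atTop,
      steinError (φ s) μ k s.toNNReal ≤ expectedCount μ k s (φ s) * η s := by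
  obtain ⟨N, hN, C, hC, hNC⟩ := exists_pow_le_mul hk (pow_pos hε (k + 1))
  set x : ℝ → ℝ := fun s => s * maxDegree (φ s) μ with hx
  set F : ℝ → ℝ := fun s => x s ^ k * (1 + x s) * Real.exp (-(ε ^ (k + 1) * x s)) with hF
  have hx0 : ∀ᶠ s : ℝ in atTop, 0 ≤ x s := by
    filter_upwards [eventually_ge_atTop 0] with s hs
    exact mul_nonneg hs (maxDegree_nonneg _ _)
  have hc0 : 0 < ε ^ (k - 1) / k.factorial := by positivity
  have hFN : Tendsto (fun s => F s ^ N) atTop (𝓝 0) := by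
    have hlim : Tendsto (fun s : ℝ => C * (ε ^ (k - 1) / k.factorial)⁻¹ *
        (expectedCount μ k s (φ s) / s)) atTop (𝓝 0) := by
      simpa using hα.tendsto_div_nhds_zero.const_mul (C * (ε ^ (k - 1) / k.factorial)⁻¹)
    refine squeeze_zero' ?_ ?_ hlim
    · filter_upwards [hx0] with s hs
      positivity
    · filter_upwards [hx0, eventually_gt_atTop 0] with s hs hs0
      have h1 := le_poissonMeanCount hε.le (integral_le_maxDegree (φ s) μ)
        (hφ s hs0).1.le_integral hk s.toNNReal
      rw [← expectedCount_eq, Real.coe_toNNReal s hs0.le] at h1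
      refine (hNC (x s) hs).trans ?_
      rw [mul_assoc]
      refine mul_le_mul_of_nonneg_left ?_ hC
      rw [inv_mul_eq_div, le_div_iff₀ hc0, le_div_iff₀ hs0]
      linarith
  have hF0 : Tendsto F atTop (𝓝 0) := by
    have hN' : (N : ℝ)⁻¹ ≠ 0 := inv_ne_zero (Nat.cast_ne_zero.2 hN)
    have h1 := hFN.rpow_const (p := (N : ℝ)⁻¹) (Or.inr (by positivity))
    rw [Real.zero_rpow hN'] at h1
    refine h1.congr' ?_
    filter_upwards [hx0] with s hs
    exact Real.pow_rpow_inv_natCast (by positivity) hN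
  refine ⟨fun s => k ^ 2 * treeConst k / k.factorial * F s, by simpa using hF0.const_mul _, ?_⟩
  filter_upwards [eventually_gt_atTop 0] with s hs0
  have h1 := steinError_le_of_homogeneous hε.le
    (fun x y => ((φ s).le_supValue x y).trans (hφ s hs0).2) (integral_le_maxDegree (φ s) μ)
    (hφ s hs0).1.le_integral hk s.toNNReal
  rwa [← expectedCount_eq, Real.coe_toNNReal s hs0.le] at h1

end Vanishing

/-! ### Passing from a Poisson to a fixed number of points -/

section DePoissonization

variable {X : Type*} [MeasurableSpace X] (φ : ConnectionFunction X) (μ : Measure X)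
  [IsProbabilityMeasure μ]

/-- The probability that `k` given points among `n` are the vertices of a component. -/
noncomputable def blockProb (k n : ℕ) : ℝ :=
  ∫ y, connProb φ (Finset.range k) y * avoidMean φ μ k y ^ (n - k) ∂pointMeasure μ

lemma abs_avoidMean_pow_le_one (k n : ℕ) (y : ℕ → X) : |avoidMean φ μ k y ^ n| ≤ 1 := by
  rw [abs_of_nonneg (pow_nonneg (avoidMean_nonneg φ μ k y) n)]
  exact pow_le_one₀ (avoidMean_nonneg φ μ k y) (avoidMean_le_one φ μ k y)

lemma integrable_connProb_mul_pow (k n : ℕ) :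
    Integrable (fun y => connProb φ (Finset.range k) y * avoidMean φ μ k y ^ n)
      (pointMeasure μ) :=
  integrable_of_abs_le ((measurable_connProb φ _).mul ((measurable_avoidMean φ μ k).pow_const n)) 1
    fun y => abs_mul_le_of_le_one (abs_connProb_le_one φ _ y) (abs_avoidMean_pow_le_one φ μ k n y)

lemma blockProb_nonneg (k n : ℕ) : 0 ≤ blockProb φ μ k n :=
  integral_nonneg fun y =>
    mul_nonneg (connProb_nonneg φ _ y) (pow_nonneg (avoidMean_nonneg φ μ k y) _)

lemma isLocal_blockInd {V S : Finset ℕ} (hS : S ⊆ V) : IsLocal (fun G => blockInd G V S) V :=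
  fun G H hGH => by
    have h1 := (isLocal_connInd S).mono hS G H hGH
    have h2 : ∀ z ∈ V \ S, sepInd G S z = sepInd H S z := fun z hz =>
      (isLocal_sepInd S z).mono (Finset.insert_subset (Finset.mem_sdiff.1 hz).1 hS) G H hGH
    simp only [blockInd]
    rw [show connInd G S = connInd H S from h1, Finset.prod_congr rfl h2]

lemma integrable_blockInd {V S : Finset ℕ} (hS : S ⊆ V) :
    Integrable (fun ω : (ℕ → X) × (Sym2 ℕ → unitInterval) => blockInd (pointGraph φ ω.1 ω.2) V S)
      (sampleMeasure μ) :=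
  integrable_of_abs_le ((isLocal_blockInd hS).measurable φ) 1 fun ω => by
    rw [abs_of_nonneg (blockInd_nonneg _ _ _)]; exact blockInd_le_one _ _ _

lemma integral_blockInd {V S : Finset ℕ} (hS : S ⊆ V) :
    ∫ ω, blockInd (pointGraph φ ω.1 ω.2) V S ∂sampleMeasure μ =
      blockProb φ μ S.card V.card := by
  have h := integral_block_eq φ μ (S := S) (V := V \ S) Finset.disjoint_sdiff 0 (a := fun _ => 1)
    (b₀ := fun _ => 0) (b₁ := fun _ => 1) (h := fun _ => 1) measurable_const measurable_const
    measurable_const measurable_const (by simp) (by simp) (C := 1) (by simp)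
  simp only [Finset.prod_const_one, one_mul, zero_add, mul_one] at h
  rw [Finset.card_sdiff_of_subset hS] at h
  rw [blockProb]
  refine Eq.trans (integral_congr_ae (Eventually.of_forall fun ω => ?_)) (h.trans
    (integral_congr_ae (Eventually.of_forall fun y => ?_)))
  · exact mul_comm _ _
  · simp only
    rw [weightedMean_one φ μ 0 (measurable_avoid_comp φ _ (by fun_prop) (by fun_prop)), avoidMean]

lemma integral_sampleCount_eq (k n : ℕ) :
    ∫ ω, sampleCount φ k n ω ∂sampleMeasure μ = n.choose k * blockProb φ μ k n :=
  integral_sampleCount φ μ k n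

lemma integrable_sampleCount (k n : ℕ) : Integrable (sampleCount φ k n) (sampleMeasure μ) :=
  integrable_of_abs_le (measurable_sampleCount φ k n) _ (abs_sampleCount_le φ k n)

variable {φ μ} {M : ℝ}

lemma blockProb_sub_le (hM : ∀ x, ∫ z, φ x z ∂μ ≤ M) {k n : ℕ} (hkn : k ≤ n) :
    blockProb φ μ k n - blockProb φ μ k (n + 1) ≤ k * M * blockProb φ μ k n := by
  simp only [blockProb]
  rw [← integral_sub (integrable_connProb_mul_pow φ μ k _) (integrable_connProb_mul_pow φ μ k _),
    ← integral_const_mul]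
  refine integral_mono ((integrable_connProb_mul_pow φ μ k _).sub
    (integrable_connProb_mul_pow φ μ k _)) ((integrable_connProb_mul_pow φ μ k _).const_mul _)
    fun y => ?_
  have h1 : avoidMean φ μ k y ^ (n + 1 - k) = avoidMean φ μ k y ^ (n - k) * avoidMean φ μ k y := by
    rw [← pow_succ]; congr 1; omega
  have h2 := mul_le_mul_of_nonneg_right (one_sub_avoidMean_le φ μ hM k y)
    (mul_nonneg (connProb_nonneg φ (Finset.range k) y)
      (pow_nonneg (avoidMean_nonneg φ μ k y) (n - k)))
  simp only
  rw [h1]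
  linarith

/-- Adding one point changes the number of components with `k` vertices only if the new point
belongs to such a component, or is joined to one. -/
theorem integral_abs_sampleCount_sub_le (hM : ∀ x, ∫ z, φ x z ∂μ ≤ M) {k : ℕ} (hk : 1 ≤ k)
    (n : ℕ) :
    ∫ ω, |sampleCount φ k (n + 1) ω - sampleCount φ k n ω| ∂sampleMeasure μ ≤
      k / (n + 1) * ∫ ω, sampleCount φ k (n + 1) ω ∂sampleMeasure μ +
        k * M * ∫ ω, sampleCount φ k n ω ∂sampleMeasure μ := by
  have hins : insert n (Finset.range n) = Finset.range (n + 1) := Finset.range_add_one.symm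
  have hsub : Finset.range n ⊆ Finset.range (n + 1) := Finset.range_subset_range.2 (Nat.le_succ n)
  set T := {S ∈ (Finset.range (n + 1)).powersetCard k | n ∈ S} with hT
  have hTm : ∀ S ∈ T, S ⊆ Finset.range (n + 1) ∧ S.card = k := fun S hS =>
    Finset.mem_powersetCard.1 (Finset.mem_filter.1 hS).1
  have hUm : ∀ S ∈ (Finset.range n).powersetCard k, S ⊆ Finset.range n ∧ S.card = k := fun S hS =>
    Finset.mem_powersetCard.1 hS
  have hi1 : ∀ S ∈ T, Integrable (fun ω : (ℕ → X) × (Sym2 ℕ → unitInterval) =>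
      blockInd (pointGraph φ ω.1 ω.2) (Finset.range (n + 1)) S) (sampleMeasure μ) := fun S hS =>
    integrable_blockInd φ μ (hTm S hS).1
  have hi2 : ∀ S ∈ (Finset.range n).powersetCard k,
      Integrable (fun ω : (ℕ → X) × (Sym2 ℕ → unitInterval) =>
        blockInd (pointGraph φ ω.1 ω.2) (Finset.range n) S -
          blockInd (pointGraph φ ω.1 ω.2) (Finset.range (n + 1)) S) (sampleMeasure μ) :=
    fun S hS => (integrable_blockInd φ μ (hUm S hS).1).sub
      (integrable_blockInd φ μ ((hUm S hS).1.trans hsub))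
  have hTc : (T.card : ℝ) * (n + 1) = k * (n + 1).choose k := by
    have h1 : T.card + ((Finset.range n).powersetCard k).card =
        ((Finset.range (n + 1)).powersetCard k).card := by
      rw [hT, ← Finset.card_filter_add_card_filter_not (s := (Finset.range (n + 1)).powersetCard k)
        (p := fun S => n ∈ S)]
      congr 2
      ext S
      simp only [Finset.mem_filter, Finset.mem_powersetCard, ← hins]
      constructor
      · rintro ⟨h, h'⟩
        exact ⟨⟨h.trans (Finset.subset_insert _ _), h'⟩, fun hn => by simpa using h hn⟩
      · rintro ⟨⟨h, h'⟩, hn⟩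
        exact ⟨(Finset.subset_insert_iff_of_notMem hn).1 h, h'⟩
    simp only [Finset.card_powersetCard, Finset.card_range] at h1
    obtain ⟨j, rfl⟩ : ∃ j, k = j + 1 := ⟨k - 1, by omega⟩
    have h2 := Nat.add_one_mul_choose_eq n j
    have h3 := Nat.choose_succ_succ n j
    have h4 : T.card = n.choose j := by simp only [Nat.succ_eq_add_one] at h3; omega
    rw [h4]
    have h5 : ((n.choose j * (n + 1) : ℕ) : ℝ) = ((j + 1) * (n + 1).choose (j + 1) : ℕ) := by
      congr 1
      linarith
    push_cast at h5 ⊢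
    exact h5
  have hle : ∫ ω, |sampleCount φ k (n + 1) ω - sampleCount φ k n ω| ∂sampleMeasure μ ≤
      ∫ ω, ((∑ S ∈ T, blockInd (pointGraph φ ω.1 ω.2) (Finset.range (n + 1)) S) +
        ∑ S ∈ (Finset.range n).powersetCard k, (blockInd (pointGraph φ ω.1 ω.2) (Finset.range n) S -
          blockInd (pointGraph φ ω.1 ω.2) (Finset.range (n + 1)) S)) ∂sampleMeasure μ := by
    refine integral_mono ((integrable_sampleCount φ μ k _).sub (integrable_sampleCount φ μ k n)).abs
      ((integrable_finsetSum _ hi1).add (integrable_finsetSum _ hi2)) fun ω => ?_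
    have h := abs_count_insert_sub_le (k := k) (G := pointGraph φ ω.1 ω.2) (V := Finset.range n)
      (m := n) Finset.notMem_range_self
    rw [hins] at h
    exact h
  refine hle.trans ?_
  rw [integral_add (integrable_finsetSum _ hi1) (integrable_finsetSum _ hi2),
    integral_finsetSum _ hi1, integral_finsetSum _ hi2]
  refine add_le_add (le_of_eq ?_) ?_
  · rw [Finset.sum_congr rfl fun S hS => by
      rw [integral_blockInd φ μ (hTm S hS).1, (hTm S hS).2], Finset.sum_const,
      integral_sampleCount_eq, Finset.card_range, nsmul_eq_mul]
    have hn : (n : ℝ) + 1 ≠ 0 := by positivity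
    field_simp
    linear_combination blockProb φ μ k (n + 1) * hTc
  · rw [Finset.sum_congr rfl fun S hS => by
      rw [integral_sub (integrable_blockInd φ μ (hUm S hS).1)
        (integrable_blockInd φ μ ((hUm S hS).1.trans hsub)), integral_blockInd φ μ (hUm S hS).1,
        integral_blockInd φ μ ((hUm S hS).1.trans hsub), (hUm S hS).2, Finset.card_range,
        Finset.card_range], Finset.sum_const, integral_sampleCount_eq, nsmul_eq_mul,
      Finset.card_powersetCard, Finset.card_range]
    rcases le_or_gt k n with hkn | hkn
    · have := mul_le_mul_of_nonneg_left (blockProb_sub_le hM hkn)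
        (Nat.cast_nonneg (α := ℝ) (n.choose k))
      linarith
    · rw [Nat.choose_eq_zero_of_lt hkn]
      simp

/-- The mean number of components among `m` points is comparable to that of a Poisson number of
points of mean `n` if `m` is close to `n`. -/
lemma integral_sampleCount_le (hM : ∀ x, ∫ z, φ x z ∂μ ≤ M) {k m n : ℕ} (hmn : m ≤ 2 * n) {w : ℝ}
    (hw0 : 0 ≤ w) (hw : (n : ℝ) - w ≤ m) :
    ∫ ω, sampleCount φ k m ω ∂sampleMeasure μ ≤
      2 ^ k * Real.exp ((w + k) * (k * M)) * poissonMeanCount φ μ k n := by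
  rw [integral_sampleCount_eq, poissonMeanCount]
  have hM0 : 0 ≤ M := by
    obtain ⟨x⟩ : Nonempty X := nonempty_of_isProbabilityMeasure μ
    exact (integral_nonneg fun z => φ.nonneg' x z).trans (hM x)
  set A := ∫ y, connProb φ (Finset.range k) y *
    Real.exp (-((n : ℝ≥0) * (1 - avoidMean φ μ k y))) ∂pointMeasure μ with hA
  have hA0 : 0 ≤ A := integral_nonneg fun y =>
    mul_nonneg (connProb_nonneg φ _ y) (Real.exp_pos _).le
  rcases lt_or_ge m k with hmk | hkm
  · rw [Nat.choose_eq_zero_of_lt hmk, Nat.cast_zero, zero_mul]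
    positivity
  have hblock : blockProb φ μ k m ≤ Real.exp ((w + k) * (k * M)) * A := by
    rw [blockProb, hA, ← integral_const_mul]
    refine integral_mono (integrable_connProb_mul_pow φ μ k _)
      ((integrable_connProb_mul_exp φ μ k n).const_mul _) fun y => ?_
    have hD0 : 0 ≤ 1 - avoidMean φ μ k y := sub_nonneg.2 (avoidMean_le_one φ μ k y)
    have h1 : avoidMean φ μ k y ^ (m - k) ≤ Real.exp ((w + k) * (k * M)) *
        Real.exp (-((n : ℝ≥0) * (1 - avoidMean φ μ k y))) := by
      have h2 : avoidMean φ μ k y ≤ Real.exp (-(1 - avoidMean φ μ k y)) := by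
        have := Real.one_sub_le_exp_neg (1 - avoidMean φ μ k y)
        linarith
      refine (pow_le_pow_left₀ (avoidMean_nonneg φ μ k y) h2 _).trans ?_
      rw [← Real.exp_nat_mul, ← Real.exp_add, Real.exp_le_exp, Nat.cast_sub hkm]
      have h3 : ((n : ℝ) - m + k) * (1 - avoidMean φ μ k y) ≤ (w + k) * (k * M) :=
        (mul_le_mul_of_nonneg_right (by linarith) hD0).trans
          (mul_le_mul_of_nonneg_left (one_sub_avoidMean_le φ μ hM k y) (by positivity))
      simp only [NNReal.coe_natCast]
      linarith
    have h4 := mul_le_mul_of_nonneg_left h1 (connProb_nonneg φ (Finset.range k) y)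
    simp only
    linarith
  have hch : (m.choose k : ℝ) ≤ 2 ^ k * (n ^ k / k.factorial) := by
    refine (Nat.choose_le_pow_div k m).trans ?_
    rw [← mul_div_assoc, ← mul_pow]
    have : (m : ℝ) ≤ 2 * n := by exact_mod_cast hmn
    gcongr
  refine (mul_le_mul hch hblock (blockProb_nonneg φ μ k m) (by positivity)).trans (le_of_eq ?_)
  simp only [NNReal.coe_natCast]
  ring

/-- The characteristic function of the number of components among `n` points. -/
noncomputable def sampleCharFun (φ : ConnectionFunction X) (μ : Measure X)
    [IsProbabilityMeasure μ] (k n : ℕ) (t : ℝ) : ℂ :=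
  ∫ ω, Complex.exp (t * sampleCount φ k n ω * Complex.I) ∂sampleMeasure μ

lemma norm_sampleCharFun_le_one (k n : ℕ) (t : ℝ) : ‖sampleCharFun φ μ k n t‖ ≤ 1 := by
  refine (norm_integral_le_integral_norm _).trans (le_of_eq ?_)
  simp only [norm_cexp_mul_I]
  simp

lemma norm_cexp_sub_cexp_le (t v w : ℝ) :
    ‖Complex.exp (t * v * Complex.I) - Complex.exp (t * w * Complex.I)‖ ≤ |t| * |v - w| := by
  have h1 : Complex.exp (t * v * Complex.I) - Complex.exp (t * w * Complex.I) =
      Complex.exp (t * w * Complex.I) * (Complex.exp (Complex.I * (t * (v - w) : ℝ)) - 1) := by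
    rw [mul_sub, ← Complex.exp_add, mul_one]
    congr 2
    push_cast
    ring
  rw [h1, norm_mul, norm_cexp_mul_I, one_mul, ← abs_mul]
  exact Real.norm_exp_I_mul_ofReal_sub_one_le

lemma dist_sampleCharFun_succ_le (hM : ∀ x, ∫ z, φ x z ∂μ ≤ M) {k : ℕ} (hk : 1 ≤ k) (n : ℕ)
    (t : ℝ) :
    dist (sampleCharFun φ μ k n t) (sampleCharFun φ μ k (n + 1) t) ≤
      |t| * (k / (n + 1) * ∫ ω, sampleCount φ k (n + 1) ω ∂sampleMeasure μ +
        k * M * ∫ ω, sampleCount φ k n ω ∂sampleMeasure μ) := by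
  rw [dist_comm, dist_eq_norm, sampleCharFun, sampleCharFun,
    ← integral_sub (integrable_cexp_mul_I t (measurable_sampleCount φ k _))
      (integrable_cexp_mul_I t (measurable_sampleCount φ k n))]
  have hi := ((integrable_sampleCount φ μ k (n + 1)).sub (integrable_sampleCount φ μ k n)).abs
  refine (norm_integral_le_of_norm_le (hi.const_mul |t|) (Eventually.of_forall fun ω =>
    norm_cexp_sub_cexp_le t _ _)).trans ?_
  rw [integral_const_mul]
  exact mul_le_mul_of_nonneg_left (integral_abs_sampleCount_sub_le hM hk n) (abs_nonneg t)

lemma integral_sq_sub_poisson (n : ℕ) :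
    Integrable (fun m : ℕ => ((m : ℝ) - n) ^ 2) (poissonMeasure n) ∧
      ∫ m : ℕ, ((m : ℝ) - n) ^ 2 ∂poissonMeasure n = n := by
  have h1 := integrable_choose_poisson_const n 1
  have h2 := integrable_choose_poisson_const n 2
  have e1 := integral_choose_poisson n 1 (J := fun _ => 1) (C := 1) (by simp)
  have e2 := integral_choose_poisson n 2 (J := fun _ => 1) (C := 1) (by simp)
  have hid : ∀ m : ℕ, ((m : ℝ) - n) ^ 2 =
      2 * (m.choose 2 : ℝ) + (1 - 2 * n) * (m.choose 1 : ℝ) + n ^ 2 := by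
    intro m
    rw [Nat.cast_choose_two, Nat.choose_one_right]
    ring
  simp only [hid]
  refine ⟨((h2.const_mul 2).add (h1.const_mul _)).add (integrable_const _), ?_⟩
  have hs : Integrable (fun m : ℕ => 2 * (m.choose 2 : ℝ) + (1 - 2 * n) * (m.choose 1 : ℝ))
      (poissonMeasure n) := (h2.const_mul 2).add (h1.const_mul _)
  rw [integral_add hs (integrable_const _), integral_add (h2.const_mul 2) (h1.const_mul _),
    integral_const_mul, integral_const_mul]
  simp only [mul_one, integral_const, probReal_univ, NNReal.coe_natCast, pow_one,
    Nat.factorial, smul_eq_mul] at e1 e2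
  rw [e1, e2]
  simp only [integral_const, probReal_univ, one_smul]
  push_cast
  ring

/-- Chebyshev's inequality for the Poisson number of points, combined with a Lipschitz bound for
the characteristic functions on the window of radius `w` about `n`. -/
theorem norm_integral_sampleCharFun_sub_le (k n : ℕ) (t : ℝ) {w D : ℝ} (hw : 0 < w) (hD : 0 ≤ D)
    (h : ∀ m : ℕ, |(m : ℝ) - n| ≤ w → |((m + 1 : ℕ) : ℝ) - n| ≤ w →
      dist (sampleCharFun φ μ k m t) (sampleCharFun φ μ k (m + 1) t) ≤ D) :
    ‖∫ m, sampleCharFun φ μ k m t ∂poissonMeasure n - sampleCharFun φ μ k n t‖ ≤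
      w * D + 2 * n / w ^ 2 := by
  have hwin : ∀ m : ℕ, |(m : ℝ) - n| ≤ w →
      ‖sampleCharFun φ μ k m t - sampleCharFun φ μ k n t‖ ≤ w * D := by
    intro m hm
    rw [← dist_eq_norm]
    have habs := abs_le.1 hm
    rcases le_total m n with hmn | hmn
    · refine (dist_le_Ico_sum_of_dist_le hmn (d := fun _ => D) fun {j} hj1 hj2 =>
        h j (abs_le.2 ?_) (abs_le.2 ?_)).trans ?_
      · have a1 : (m : ℝ) ≤ j := by exact_mod_cast hj1
        have a2 : (j : ℝ) ≤ n := by exact_mod_cast hj2.le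
        constructor <;> linarith
      · have a1 : (m : ℝ) ≤ (j + 1 : ℕ) := by exact_mod_cast hj1.trans (Nat.le_succ j)
        have a2 : ((j + 1 : ℕ) : ℝ) ≤ n := by exact_mod_cast hj2
        constructor <;> linarith
      · rw [Finset.sum_const, Nat.card_Ico, nsmul_eq_mul, Nat.cast_sub hmn]
        exact mul_le_mul_of_nonneg_right (by linarith) hD
    · rw [dist_comm]
      refine (dist_le_Ico_sum_of_dist_le hmn (d := fun _ => D) fun {j} hj1 hj2 =>
        h j (abs_le.2 ?_) (abs_le.2 ?_)).trans ?_
      · have a1 : (n : ℝ) ≤ j := by exact_mod_cast hj1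
        have a2 : (j : ℝ) ≤ m := by exact_mod_cast hj2.le
        constructor <;> linarith
      · have a1 : (n : ℝ) ≤ (j + 1 : ℕ) := by exact_mod_cast hj1.trans (Nat.le_succ j)
        have a2 : ((j + 1 : ℕ) : ℝ) ≤ m := by exact_mod_cast hj2
        constructor <;> linarith
      · rw [Finset.sum_const, Nat.card_Ico, nsmul_eq_mul, Nat.cast_sub hmn]
        exact mul_le_mul_of_nonneg_right (by linarith) hD
  have hall : ∀ m : ℕ, ‖sampleCharFun φ μ k m t - sampleCharFun φ μ k n t‖ ≤
      w * D + 2 / w ^ 2 * ((m : ℝ) - n) ^ 2 := by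
    intro m
    rcases le_or_gt |(m : ℝ) - n| w with hm | hm
    · exact (hwin m hm).trans (le_add_of_nonneg_right (by positivity))
    · have h1 : ‖sampleCharFun φ μ k m t - sampleCharFun φ μ k n t‖ ≤ 2 :=
        (norm_sub_le _ _).trans (by
          have := norm_sampleCharFun_le_one (φ := φ) (μ := μ) k m t
          have := norm_sampleCharFun_le_one (φ := φ) (μ := μ) k n t
          linarith)
      have h2 : w ^ 2 ≤ ((m : ℝ) - n) ^ 2 := by
        rw [← sq_abs ((m : ℝ) - n)]
        exact pow_le_pow_left₀ hw.le hm.le 2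
      have h3 : 2 ≤ 2 / w ^ 2 * ((m : ℝ) - n) ^ 2 := by
        rw [div_mul_eq_mul_div, le_div_iff₀ (by positivity)]
        linarith
      have h4 : 0 ≤ w * D := by positivity
      linarith
  have hint : Integrable (fun m => sampleCharFun φ μ k m t) (poissonMeasure n) :=
    Integrable.of_bound (Measurable.of_discrete).aestronglyMeasurable 1
      (Eventually.of_forall fun m => norm_sampleCharFun_le_one k m t)
  obtain ⟨hsq, hsqI⟩ := integral_sq_sub_poisson n
  have h1 : ∫ m, sampleCharFun φ μ k m t ∂poissonMeasure n - sampleCharFun φ μ k n t =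
      ∫ m, (sampleCharFun φ μ k m t - sampleCharFun φ μ k n t) ∂poissonMeasure n := by
    rw [integral_sub hint (integrable_const _)]
    simp
  rw [h1]
  have hsum : Integrable (fun m : ℕ => w * D + 2 / w ^ 2 * ((m : ℝ) - n) ^ 2)
      (poissonMeasure n) := (integrable_const _).add (hsq.const_mul _)
  refine (norm_integral_le_of_norm_le hsum (Eventually.of_forall hall)).trans (le_of_eq ?_)
  rw [integral_add (integrable_const _) (hsq.const_mul _), integral_const_mul (2 / w ^ 2), hsqI]
  simp only [integral_const, probReal_univ, one_smul]
  ring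

lemma integral_cexp_poisson_eq (k n : ℕ) (t : ℝ) :
    ∫ p, Complex.exp (t * sampleCount φ k p.1 p.2 * Complex.I)
      ∂((poissonMeasure n).prod (sampleMeasure μ)) =
      ∫ m, sampleCharFun φ μ k m t ∂poissonMeasure n :=
  integral_prod _ (integrable_cexp_mul_I t (measurable_uncurry_nat (measurable_sampleCount φ k)))

/-- If `√n` times the maximal connection probability of a point vanishes, the Poisson fluctuations
of the number of points do not matter. -/
theorem tendsto_integral_sampleCharFun_sub {φ : ℕ → ConnectionFunction X} {k : ℕ} (hk : 1 ≤ k)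
    {α : ℝ} (hα : Tendsto (fun n : ℕ => poissonMeanCount (φ n) μ k n) atTop (𝓝 α))
    (hM : Tendsto (fun n : ℕ => √n * maxDegree (φ n) μ) atTop (𝓝 0)) (t : ℝ) :
    Tendsto (fun n : ℕ => ∫ m, sampleCharFun (φ n) μ k m t ∂poissonMeasure n -
      sampleCharFun (φ n) μ k n t) atTop (𝓝 0) := by
  have hM1 : Tendsto (fun n : ℕ => maxDegree (φ n) μ) atTop (𝓝 0) := by
    refine squeeze_zero' (Eventually.of_forall fun n => maxDegree_nonneg _ _) ?_ hM
    filter_upwards [eventually_ge_atTop 1] with n hn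
    exact le_mul_of_one_le_left (maxDegree_nonneg _ _)
      (Real.one_le_sqrt.2 (by exact_mod_cast hn))
  have hsqrt : Tendsto (fun n : ℕ => √(n : ℝ)) atTop atTop :=
    Real.tendsto_sqrt_atTop.comp tendsto_natCast_atTop_atTop
  have hinv : Tendsto (fun n : ℕ => (√(n : ℝ))⁻¹) atTop (𝓝 0) := hsqrt.inv_tendsto_atTop
  refine Metric.tendsto_atTop'.2 fun δ hδ => ?_
  -- the window has radius `K √n`, with `K` large enough for Chebyshev's inequality
  set K := √(8 / δ) with hK
  have hK0 : 0 < K := Real.sqrt_pos.2 (by positivity)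
  have hK2 : K ^ 2 = 8 / δ := Real.sq_sqrt (by positivity)
  set E : ℕ → ℝ := fun n => 2 ^ k * Real.exp ((K * √n + k) * (k * maxDegree (φ n) μ)) *
    poissonMeanCount (φ n) μ k n with hE
  have hElim : Tendsto E atTop (𝓝 (2 ^ k * 1 * α)) := by
    refine Tendsto.mul (Tendsto.const_mul _ ?_) hα
    have h1 : Tendsto (fun n : ℕ => (K * √n + k) * (k * maxDegree (φ n) μ)) atTop (𝓝 0) := by
      have h2 := (hM.const_mul (K * k)).add (hM1.const_mul ((k : ℝ) ^ 2))
      simp only [mul_zero, add_zero] at h2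
      refine h2.congr fun n => ?_
      ring
    have h3 := (Real.continuous_exp.tendsto _).comp h1
    rwa [Real.exp_zero] at h3
  have hlim : Tendsto (fun n : ℕ => |t| * k * E n * (2 * K * (√n)⁻¹ +
      K * (√n * maxDegree (φ n) μ))) atTop (𝓝 0) := by
    have := (hElim.const_mul (|t| * k)).mul ((hinv.const_mul (2 * K)).add (hM.const_mul K))
    simpa using this
  obtain ⟨N, hN⟩ := eventually_atTop.1 ((hlim.eventually_lt_const (half_pos hδ)).and
    ((hsqrt.eventually_ge_atTop (2 * K)).and (eventually_ge_atTop 1)))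
  refine ⟨N, fun n hn => ?_⟩
  obtain ⟨h1, h2, h3⟩ := hN n hn.le
  have hn0 : (0 : ℝ) < n := by exact_mod_cast h3
  have hs0 : 0 < √(n : ℝ) := Real.sqrt_pos.2 hn0
  have hss : √(n : ℝ) * √n = n := Real.mul_self_sqrt hn0.le
  have hwn : K * √n ≤ n / 2 := by nlinarith
  have hMn := maxDegree_nonneg (φ n) μ
  have hEn : 0 ≤ E n :=
    mul_nonneg (by positivity) (poissonMeanCount_nonneg μ (φ n) k n)
  have hb := norm_integral_sampleCharFun_sub_le (φ := φ n) (μ := μ) k n t (w := K * √n)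
    (D := |t| * (k * E n * (2 / n + maxDegree (φ n) μ))) (by positivity) (by positivity) (by
      intro m hm hm1
      have habs := abs_le.1 hm
      have habs1 := abs_le.1 hm1
      have hle : ∀ j : ℕ, |(j : ℝ) - n| ≤ K * √n →
          ∫ ω, sampleCount (φ n) k j ω ∂sampleMeasure μ ≤ E n := fun j hj => by
        have hj' := abs_le.1 hj
        exact integral_sampleCount_le (integral_le_maxDegree (φ n) μ)
          (by
            have : (j : ℝ) ≤ 2 * n := by linarith
            exact_mod_cast this)
          (by positivity) (by linarith)
      refine (dist_sampleCharFun_succ_le (integral_le_maxDegree (φ n) μ) hk m t).trans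
        (mul_le_mul_of_nonneg_left ?_ (abs_nonneg t))
      have hkm : (k : ℝ) / (m + 1) ≤ k * (2 / n) := by
        rw [div_le_iff₀ (by positivity)]
        push_cast at habs1
        have : (n : ℝ) / 2 ≤ m + 1 := by linarith
        have h4 : (2 : ℝ) / n * (n / 2) = 1 := by field_simp
        have h5 : (k : ℝ) * (2 / n) * (n / 2) ≤ k * (2 / n) * (m + 1) :=
          mul_le_mul_of_nonneg_left this (by positivity)
        rw [mul_assoc, h4, mul_one] at h5
        exact h5
      have h6 := mul_le_mul hkm (hle (m + 1) hm1)
        (integral_nonneg fun ω => sampleCount_nonneg _ _ _ _) (by positivity)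
      have h7 := mul_le_mul_of_nonneg_left (hle m hm)
        (by positivity : (0 : ℝ) ≤ k * maxDegree (φ n) μ)
      refine (add_le_add h6 h7).trans (le_of_eq ?_)
      ring)
  rw [dist_zero_right]
  refine hb.trans_lt ?_
  have e1 : K * √n * (|t| * (k * E n * (2 / n + maxDegree (φ n) μ))) =
      |t| * k * E n * (2 * K * (√n)⁻¹ + K * (√n * maxDegree (φ n) μ)) := by
    have : √(n : ℝ) / n = (√n)⁻¹ := by
      rw [div_eq_iff hn0.ne', inv_mul_eq_div, eq_div_iff hs0.ne', hss]
    rw [← this]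
    ring
  have e2 : 2 * n / (K * √n) ^ 2 = δ / 4 := by
    rw [mul_pow, hK2, Real.sq_sqrt hn0.le]
    field_simp
    norm_num
  rw [e1, e2]
  linarith

end DePoissonization

section FixedNumber

variable {X : Type*} [MeasurableSpace X] (μ : Measure X) [IsProbabilityMeasure μ]
  {φ : ℝ → ConnectionFunction X} {k : ℕ}

theorem tendstoInDistribution_binomial (hk : 1 ≤ k) {α : ℝ≥0}
    (hα : Tendsto (fun s : ℝ => expectedCount μ k s (φ s)) atTop (𝓝 (α : ℝ)))
    (hB : Tendsto (fun s : ℝ => steinError (φ s) μ k s.toNNReal) atTop (𝓝 0))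
    (hM : Tendsto (fun s : ℝ => √s * maxDegree (φ s) μ) atTop (𝓝 0)) :
    TendstoInDistribution
      (fun (s : ℝ) ω => componentCount k (binomialGraph (φ (⌊s⌋₊ : ℝ)) ⌊s⌋₊ ω))
      atTop (id : ℕ → ℕ) (fun _ : ℝ => sampleMeasure μ) (poissonMeasure α) := by
  refine tendstoInDistribution_nat_of_charFun
    (fun s => measurable_componentCount_binomialGraph _ k _) _ fun t => ?_
  simp only [componentCount_binomialGraph]
  have hαn : Tendsto (fun n : ℕ => poissonMeanCount (φ n) μ k n) atTop (𝓝 (α : ℝ)) := by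
    refine (hα.comp tendsto_natCast_atTop_atTop).congr fun n => ?_
    simp only [Function.comp_apply, expectedCount_eq, Real.toNNReal_natCast]
  have h1 := tendsto_integral_sampleCharFun_sub (μ := μ) (φ := fun n : ℕ => φ n) hk hαn
    (hM.comp tendsto_natCast_atTop_atTop) t
  have h2 : Tendsto (fun n : ℕ => ∫ m, sampleCharFun (φ n) μ k m t ∂poissonMeasure n) atTop
      (𝓝 (charFun ((poissonMeasure α).map (Nat.cast : ℕ → ℝ)) t)) := by
    refine ((tendsto_integral_cexp_sampleCount μ hα hB t).comp
      tendsto_natCast_atTop_atTop).congr fun n => ?_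
    rw [← integral_cexp_poisson_eq]
    simp only [Function.comp_apply, poissonSampleMeasure, Real.toNNReal_natCast]
  have h3 : Tendsto (fun n : ℕ => sampleCharFun (φ n) μ k n t) atTop
      (𝓝 (charFun ((poissonMeasure α).map (Nat.cast : ℕ → ℝ)) t)) := by
    have := h2.sub h1
    simpa using this
  exact h3.comp tendsto_nat_floor_atTop

lemma tendsto_sqrt_mul_supValue
    (hφ : (fun s : ℝ => (φ s).supValue) =o[atTop] (fun s : ℝ => s ^ (-(1 / 2) : ℝ))) :
    Tendsto (fun s : ℝ => √s * (φ s).supValue) atTop (𝓝 0) := by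
  refine hφ.tendsto_div_nhds_zero.congr' ?_
  filter_upwards [eventually_gt_atTop 0] with s hs
  rw [Real.rpow_neg hs.le, div_inv_eq_mul, Real.sqrt_eq_rpow, mul_comm]

lemma isLittleO_one_div_log
    (hφ : (fun s : ℝ => (φ s).supValue) =o[atTop] (fun s : ℝ => s ^ (-(1 / 2) : ℝ))) :
    (fun s : ℝ => (φ s).supValue) =o[atTop] (fun s : ℝ => 1 / Real.log s) := by
  refine hφ.trans ?_
  have h := (isLittleO_log_rpow_atTop (r := 1 / 2) (by norm_num)).inv_rev (by
    filter_upwards [Real.tendsto_log_atTop.eventually_gt_atTop 0] with s hs h0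
    exact absurd h0 hs.ne')
  refine (h.congr' ?_ ?_)
  · filter_upwards [eventually_ge_atTop 0] with s hs
    rw [Real.rpow_neg hs]
  · exact Eventually.of_forall fun s => (one_div _).symm

/-- Let `x` be `s` times the maximal degree. The mean number of components per point decays
exponentially in `x`, and it is of order `1 / s`; hence `x` is at most of order `log s`. The crude
bound `x ^ 3 = O(s)` is all that is needed. -/
theorem tendsto_sqrt_mul_maxDegree (hk : 1 ≤ k) {α : ℝ≥0} (hα0 : 0 < α)
    (hα : Tendsto (fun s : ℝ => expectedCount μ k s (φ s)) atTop (𝓝 (α : ℝ))) {ε : ℝ} (hε : 0 < ε)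
    (hφ : ∀ s : ℝ, 0 < s → (φ s).Homogeneous μ ε) :
    Tendsto (fun s : ℝ => √s * maxDegree (φ s) μ) atTop (𝓝 0) := by
  set y : ℝ → ℝ := fun s => √s * maxDegree (φ s) μ with hy
  have hy0 : ∀ s, 0 ≤ y s := fun s => mul_nonneg (Real.sqrt_nonneg s) (maxDegree_nonneg _ _)
  set C : ℝ := treeConst k / k.factorial * ((k + 2).factorial / ε ^ (k + 2)) with hC
  have hα' : (α : ℝ) ≠ 0 := by exact_mod_cast hα0.ne'
  have hinv : Tendsto (fun s : ℝ => (√s)⁻¹) atTop (𝓝 0) :=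
    Real.tendsto_sqrt_atTop.inv_tendsto_atTop
  have h1 : Tendsto (fun s => expectedCount μ k s (φ s) * y s ^ 3) atTop (𝓝 0) := by
    have hlim : Tendsto (fun s : ℝ => C * (√s)⁻¹) atTop (𝓝 0) := by
      simpa using hinv.const_mul C
    refine squeeze_zero' (Eventually.of_forall fun s => ?_) ?_ hlim
    · rw [expectedCount_eq]
      exact mul_nonneg (poissonMeanCount_nonneg μ _ k _) (pow_nonneg (hy0 s) 3)
    · filter_upwards [eventually_gt_atTop 0] with s hs
      have hM0 := maxDegree_nonneg (φ s) μ
      have h2 := poissonMeanCount_le (integral_le_maxDegree (φ s) μ) (hφ s hs).le_integral hk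
        s.toNNReal
      rw [← expectedCount_eq, Real.coe_toNNReal s hs.le] at h2
      set x := s * maxDegree (φ s) μ with hx
      have hx0 : 0 ≤ x := mul_nonneg hs.le hM0
      have h3 : x ^ (k - 1) * Real.exp (-(ε * x)) * x ^ 3 ≤ (k + 2).factorial / ε ^ (k + 2) := by
        have h4 := Real.pow_div_factorial_le_exp (ε * x) (by positivity) (k + 2)
        rw [div_le_iff₀ (by positivity), mul_pow] at h4
        have h5 : x ^ (k - 1) * x ^ 3 = x ^ (k + 2) := by rw [← pow_add]; congr 1; omega
        rw [Real.exp_neg, mul_right_comm, h5, ← div_eq_mul_inv, div_le_div_iff₀ (Real.exp_pos _)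
          (by positivity)]
        linarith
      have hss : √s * √s = s := Real.mul_self_sqrt hs.le
      have hs0 : 0 < √s := Real.sqrt_pos.2 hs
      have hyx : y s ^ 3 * (s * √s) = x ^ 3 := by
        rw [hx, hy]
        simp only
        rw [mul_pow, mul_pow]
        linear_combination (maxDegree (φ s) μ ^ 3 * (s * (√s * √s) + s * s)) * hss
      have h6 : expectedCount μ k s (φ s) * x ^ 3 ≤ s * C := by
        refine (mul_le_mul_of_nonneg_right h2 (by positivity)).trans ?_
        rw [hC]
        have := mul_le_mul_of_nonneg_left h3
          (by positivity : (0 : ℝ) ≤ s * (treeConst k / k.factorial))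
        linarith
      rw [← div_eq_mul_inv, le_div_iff₀ hs0]
      refine le_of_mul_le_mul_left ?_ hs
      rw [← hyx] at h6
      linarith
  have h2 : Tendsto (fun s => y s ^ 3) atTop (𝓝 0) := by
    have h3 := h1.div hα hα'
    rw [zero_div] at h3
    refine h3.congr' ?_
    filter_upwards [hα.eventually_ne hα'] with s hs
    exact mul_div_cancel_left₀ _ hs
  have h3 := h2.rpow_const (p := ((3 : ℕ) : ℝ)⁻¹) (Or.inr (by positivity))
  rw [Real.zero_rpow (by norm_num)] at h3
  exact h3.congr fun s => Real.pow_rpow_inv_natCast (hy0 s) (by norm_num)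

end FixedNumber

end IRG

theorem theorem2p2 {X : Type*} [MeasurableSpace X] (μ : Measure X) [IsProbabilityMeasure μ]
    (k : ℕ) (hk : 1 ≤ k) (φ : ℝ → IRG.ConnectionFunction X) :
    (∀ α : ℝ≥0, 0 < α →
      Tendsto (fun s : ℝ => IRG.expectedCount μ k s (φ s)) atTop (𝓝 (α : ℝ)) →
      ((fun s : ℝ => (φ s).supValue) =o[atTop] (fun s : ℝ => 1 / Real.log s) →
        TendstoInDistribution
          (fun (s : ℝ) ω => IRG.componentCount k (IRG.poissonGraph (φ s) ω))
          atTop (id : ℕ → ℕ) (fun s : ℝ => IRG.poissonSampleMeasure μ s) (poissonMeasure α)) ∧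
      ((fun s : ℝ => (φ s).supValue) =o[atTop] (fun s : ℝ => s ^ (-(1 / 2) : ℝ)) →
        TendstoInDistribution
          (fun (s : ℝ) ω => IRG.componentCount k (IRG.binomialGraph (φ (⌊s⌋₊ : ℝ)) ⌊s⌋₊ ω))
          atTop (id : ℕ → ℕ) (fun _ : ℝ => IRG.sampleMeasure μ) (poissonMeasure α)) ∧
      ((∃ ε : ℝ, 0 < ε ∧ ∀ s : ℝ, 0 < s →
          (φ s).Homogeneous μ ε ∧ (φ s).supValue ≤ 1 - ε) →
        TendstoInDistribution
          (fun (s : ℝ) ω => IRG.componentCount k (IRG.poissonGraph (φ s) ω))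
          atTop (id : ℕ → ℕ) (fun s : ℝ => IRG.poissonSampleMeasure μ s) (poissonMeasure α) ∧
        TendstoInDistribution
          (fun (s : ℝ) ω => IRG.componentCount k (IRG.binomialGraph (φ (⌊s⌋₊ : ℝ)) ⌊s⌋₊ ω))
          atTop (id : ℕ → ℕ) (fun _ : ℝ => IRG.sampleMeasure μ) (poissonMeasure α))) ∧
    (Tendsto (fun s : ℝ => IRG.expectedCount μ k s (φ s)) atTop atTop →
      (fun s : ℝ => IRG.expectedCount μ k s (φ s)) =o[atTop] (fun s : ℝ => s) →
      (∃ ε : ℝ, 0 < ε ∧ ∀ s : ℝ, 0 < s →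
          (φ s).Homogeneous μ ε ∧ (φ s).supValue ≤ 1 - ε) →
      TendstoInDistribution
        (fun (s : ℝ) ω =>
          ((IRG.componentCount k (IRG.poissonGraph (φ s) ω) : ℝ) -
              IRG.expectedCount μ k s (φ s)) / √(IRG.expectedCount μ k s (φ s)))
        atTop (id : ℝ → ℝ) (fun s : ℝ => IRG.poissonSampleMeasure μ s) (gaussianReal 0 1)) := by
  refine ⟨fun α hα0 hα => ⟨fun hφ => ?_, fun hφ => ?_, fun ⟨ε, hε, hφ⟩ => ?_⟩,
    fun hα hα' ⟨ε, hε, hφ⟩ => ?_⟩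
  · exact IRG.tendstoInDistribution_poisson μ hα (IRG.tendsto_steinError_of_isLittleO μ hα hφ)
  · refine IRG.tendstoInDistribution_binomial μ hk hα
      (IRG.tendsto_steinError_of_isLittleO μ hα (IRG.isLittleO_one_div_log hφ)) ?_
    exact squeeze_zero
      (fun s => mul_nonneg (Real.sqrt_nonneg s) (IRG.maxDegree_nonneg (φ s) μ))
      (fun s => mul_le_mul_of_nonneg_left (IRG.maxDegree_le_supValue (φ s) μ) (Real.sqrt_nonneg s))
      (IRG.tendsto_sqrt_mul_supValue hφ)
  · have hB : Tendsto (fun s : ℝ => IRG.steinError (φ s) μ k s.toNNReal) atTop (𝓝 0) := by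
      have ho : (fun s : ℝ => IRG.expectedCount μ k s (φ s)) =o[atTop] (fun s : ℝ => s) :=
        (hα.isBigO_one ℝ).trans_isLittleO (isLittleO_const_id_atTop (1 : ℝ))
      obtain ⟨η, hη, hle⟩ := IRG.tendsto_steinError_of_homogeneous μ hk ho hε hφ
      have hlim := hα.mul hη
      rw [mul_zero] at hlim
      exact squeeze_zero' (Eventually.of_forall fun s => IRG.steinError_nonneg μ (φ s) k _) hle hlim
    exact ⟨IRG.tendstoInDistribution_poisson μ hα hB, IRG.tendstoInDistribution_binomial μ hk hα hB
      (IRG.tendsto_sqrt_mul_maxDegree μ hk hα0 hα hε fun s hs => (hφ s hs).1)⟩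
  · obtain ⟨η, hη, hle⟩ := IRG.tendsto_steinError_of_homogeneous μ hk hα' hε hφ
    refine IRG.tendstoInDistribution_gaussian μ hα (squeeze_zero' ?_ ?_ hη)
    · filter_upwards [hα.eventually_gt_atTop 0] with s hs
      exact div_nonneg (IRG.steinError_nonneg μ (φ s) k _) hs.le
    · filter_upwards [hle, hα.eventually_gt_atTop 0] with s hs hs0
      rw [div_le_iff₀ hs0, mul_comm]
      exact hs
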